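/- **Setting.** Let $v$ be an indeterminate, $[k]=\frac{v^k-v^{-k}}{v-v^{-1}}$, $[k]!=[1]\cdots[k]$, $\begin{bmatrix}a\\ s\end{bmatrix}=\prod_{t=0}^{s-1}(v^{a-t}-v^{-a+t})\big/\prod_{t=1}^{s}(v^t-v^{-t})$ and $x^{(k)}=x^k/[k]!$. Let $\tilde{\mathbf f}$ be the $\mathbb Q(v)$-algebra of type $A_2$ with generators $\theta_i,\theta_{i'}$ and the quantum Serre relations ($i\cdot i=i'\cdot i'=2$, $i\cdot i'=-1$), $\tilde{\mathbf B}$ its (Lusztig) canonical basis, and $\mathbf f\subset\tilde{\mathbf f}$ the subalgebra generated by $\theta_i$ (type $A_1$). Let $r:\mathbf f\to\mathbf f\otimes\mathbf f$ be the comultiplication, the algebra homomorphism with $r(\theta_i)=\theta_i\otimes1+1\otimes\theta_i$ for the product $(x_1\otimes x_2)(y_1\otimes y_2)=v^{|x_2|\cdot|y_1|}x_1y_1\otimes x_2y_2$. For $n\in\mathbb N$ let $\Lambda_n=\mathbf f/\mathbf f\theta_i^{n+1}$, with $\eta_n$ the image of $1$ and $F_i$ acting by left multiplication by $\theta_i$;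 this is the simple $U_v(\mathfrak{sl}_2)$-module of dimension $n+1$. Fix $m,n\in\mathbb N$ and put $\theta_n=\theta_{i'}^{(n)}$. Let $\mathbf f\theta_n\mathbf f\subset\tilde{\mathbf f}$ be the span of all $x\theta_ny$ with $x,y\in\mathbf f$. Let $\pi_{m\odot n}:\tilde{\mathbf f}\to\tilde{\mathbf f}/(\tilde{\mathbf f}\theta_i^{m+1}+\tilde{\mathbf f}\theta_{i'}^{n+1})$ be the projection, and $\Lambda_{m,n}=\pi_{m\odot n}(\mathbf f\theta_n\mathbf f)$. Let $\tilde{\mathbf B}(m,n)$ be the set of all $b\in\tilde{\mathbf B}$ that occur with non-zero coefficient in the expansion in $\tilde{\mathbf B}$ of some product $\theta_i^{(a_1)}\cdots\theta_i^{(a_p)}\,\theta_n\,\theta_i^{(c_1)}\cdots\theta_i^{(c_q)}$, and for which there is $0\le t\le m$ with $b\in\tilde{\mathbf f}\theta_i^t\setminus\tilde{\mathbf f}\theta_i^{t+1}$. For $0\le k\le m$, $0\le l\le n$ put $$\alpha_{k,l}=\sum_{s=0}^{\min(k,l)}v^{s(k-m-s)}\begin{bmatrix}n-l+s\\ s\end{bmatrix}F_i^{(m-k+s)}\eta_m\otimes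 F_i^{(l-s)}\eta_n,\qquad \beta_{k,l}=\sum_{s=0}^{\min(k,l)}v^{s(l-n-s)}\begin{bmatrix}m-k+s\\ s\end{bmatrix}F_i^{(m-k+s)}\eta_m\otimes F_i^{(l-s)}\eta_n .$$ **Proposition.** 1. We have $$\tilde{\mathbf B}(m,n)=\{\theta_{i'}^{(n-l)}\theta_i^{(m-k+l)}\theta_{i'}^{(l)}\mid 0\le k\le m,\ 0\le l\le n,\ k-l\le m-n\}\cup\{\theta_i^{(l)}\theta_{i'}^{(n)}\theta_i^{(m-k)}\mid 0\le k\le m,\ 0\le l\le n,\ k-l\ge m-n\},$$ and $\theta_{i'}^{(n-l)}\theta_i^{(m-k+l)}\theta_{i'}^{(l)}=\theta_i^{(l)}\theta_{i'}^{(n)}\theta_i^{(m-k)}$ whenever $k-l=m-n$. 2. There is a unique linear isomorphism $\varphi:\Lambda_{m,n}\to\Lambda_m\otimes\Lambda_n$ with $\varphi\pi_{m\odot n}(x\theta_ny)=\sum v^{|x_2|\cdot|\theta_n|}\,x_2y\,\eta_m\otimes x_1\eta_n$ for all $x,y\in\mathbf f$, where $r(x)=\sum x_1\otimes x_2$ with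 homogeneous $x_1,x_2$ and $|\theta_n|=n\,i'$ (so $i\cdot|\theta_n|=-n$). The elements listed in (1) lie in $\mathbf f\theta_n\mathbf f$, and for $0\le k\le m$, $0\le l\le n$, $$\varphi\pi_{m\odot n}(\theta_{i'}^{(n-l)}\theta_i^{(m-k+l)}\theta_{i'}^{(l)})=\alpha_{k,l}\ \text{ if } k-l\le m-n,\qquad \varphi\pi_{m\odot n}(\theta_i^{(l)}\theta_{i'}^{(n)}\theta_i^{(m-k)})=\beta_{k,l}\ \text{ if } k-l\ge m-n.$$ 3. The elements $\alpha_{k,l}$ (with $k-l\le m-n$) and $\beta_{k,l}$ (with $k-l\ge m-n$) are exactly the elements of Lusztig's canonical basis of $\Lambda_m\otimes\Lambda_n$: the $\Psi$-invariant elements of the $\mathbb Z[v^{-1}]$-lattice $\mathcal L$ spanned by the $F_i^{(a)}\eta_m\otimes F_i^{(b)}\eta_n$ ($0\le a\le m$, $0\le b\le n$) that are congruent modulo $v^{-1}\mathcal L$ to some $F_i^{(a)}\eta_m\otimes F_i^{(b)}\eta_n$. Here $\Psi=\Theta\circ\bar{\ }$, where $\Theta$ is the quasi-$\mathcal R$-matrix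 and $\bar{\ }$ is the tensor product of the bar involutions of $\Lambda_m$ and $\Lambda_n$. -/

import Mathlib

open scoped TensorProduct

namespace FramedTensor

noncomputable section

/-! ### Quantum integers -/

/-- The field `ℚ(v)`. -/
abbrev K : Type := RatFunc ℚ

/-- The indeterminate `v`. -/
def v : K := RatFunc.X

/-- `[n] = (v^n - v^{-n}) / (v - v^{-1})`. -/
def qInt (n : ℤ) : K := (v ^ n - v ^ (-n)) / (v - v⁻¹)

/-- `[m]! = [1][2]⋯[m]`. -/
def qFact (m : ℕ) : K := ∏ k ∈ Finset.Icc 1 m, qInt k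

/-- The Gaussian binomial coefficient, for `n ∈ ℤ` and `m ∈ ℕ`. -/
def qBinom (n : ℤ) (m : ℕ) : K :=
  (∏ k ∈ Finset.range m, (v ^ (n - k) - v ^ (-n + k))) /
    ∏ k ∈ Finset.Icc 1 m, (v ^ (k : ℤ) - v ^ (-(k : ℤ)))

/-- The divided power `x^{(n)} = x^n / [n]!`. -/
def dp {A : Type*} [Ring A] [Algebra K A] (x : A) (n : ℕ) : A := (qFact n)⁻¹ • x ^ n

theorem v_ne_zero : v ≠ 0 := RatFunc.X_ne_zero

theorem v_transcendental : Transcendental ℚ v := by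
  convert RatFunc.transcendental_X (K := ℚ)
  · exact Subsingleton.elim _ _
  · rfl

theorem transcendental_v_inv : Transcendental ℚ v⁻¹ := by
  intro h
  exact v_transcendental (inv_inv v ▸ h.inv)

/-- The field automorphism of `ℚ(v)` with `v ↦ v⁻¹`. -/
def barK : K →+* K :=
  RatFunc.liftRingHom (Polynomial.aeval (R := ℚ) (v⁻¹ : K)).toRingHom
    (nonZeroDivisors_le_comap_nonZeroDivisors_of_injective _
      (transcendental_iff_injective.mp transcendental_v_inv))

theorem barK_v : barK v = v⁻¹ := by
  have := RatFunc.liftRingHom_apply_div (Polynomial.aeval (R := ℚ) (v⁻¹ : K)).toRingHom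
    (nonZeroDivisors_le_comap_nonZeroDivisors_of_injective _
      (transcendental_iff_injective.mp transcendental_v_inv)) Polynomial.X 1
  simpa only [barK, v, map_one, div_one, RatFunc.algebraMap_X, AlgHom.toRingHom_eq_coe,
    RingHom.coe_coe, Polynomial.aeval_X] using this

theorem v_sq_ne_one : v ^ 2 ≠ 1 := by
  intro h
  refine v_transcendental ⟨Polynomial.X ^ 2 - 1, ?_, by simp [h]⟩
  exact (Polynomial.monic_X_pow_sub_C (1 : ℚ) two_ne_zero).ne_zero

theorem v_sub_inv_ne_zero : v - v⁻¹ ≠ 0 := by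
  intro h
  apply v_sq_ne_one
  have h' : v = v⁻¹ := sub_eq_zero.mp h
  rw [pow_two]
  nth_rewrite 2 [h']
  exact mul_inv_cancel₀ v_ne_zero

theorem barK_qInt (n : ℤ) : barK (qInt n) = qInt n := by
  simp only [qInt, map_div₀, map_sub, map_zpow₀, map_inv₀, barK_v, inv_inv, inv_zpow', neg_neg]
  rw [← neg_sub v v⁻¹, ← neg_sub (v ^ n), neg_div_neg_eq]

theorem barK_qFact (m : ℕ) : barK (qFact m) = qFact m := by
  simp [qFact, barK_qInt]

theorem qInt_one : qInt 1 = 1 := by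
  simp [qInt, div_self v_sub_inv_ne_zero]

theorem qInt_two : qInt 2 = v + v⁻¹ := by
  have h := v_sub_inv_ne_zero
  have h0 := v_ne_zero
  rw [qInt, div_eq_iff h, zpow_neg]
  simp only [zpow_ofNat]
  field_simp
  ring

theorem qFact_zero : qFact 0 = 1 := by simp [qFact]

theorem qFact_one : qFact 1 = 1 := by simp [qFact, qInt_one]

theorem qFact_two : qFact 2 = v + v⁻¹ := by
  rw [qFact, Finset.prod_Icc_succ_top (by norm_num)]
  simp [qInt_one, qInt_two]

theorem v_add_inv_ne_zero : v + v⁻¹ ≠ 0 := by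
  intro h
  refine v_transcendental ⟨Polynomial.X ^ 2 + 1, ?_, ?_⟩
  · exact (Polynomial.monic_X_pow_add_C (1 : ℚ) two_ne_zero).ne_zero
  · have h0 := v_ne_zero
    field_simp at h
    simpa using h

theorem dp_zero {A : Type*} [Ring A] [Algebra K A] (x : A) : dp x 0 = 1 := by
  simp [dp, qFact_zero]

theorem dp_one {A : Type*} [Ring A] [Algebra K A] (x : A) : dp x 1 = x := by
  simp [dp, qFact_one]

theorem dp_two {A : Type*} [Ring A] [Algebra K A] (x : A) :
    dp x 2 = (v + v⁻¹)⁻¹ • (x * x) := by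
  simp [dp, qFact_two, pow_two]

/-! ### The algebra `f` of a simply laced Cartan datum -/

/-- A symmetric Cartan datum with `i · j ∈ {0, -1}` for `i ≠ j`. -/
structure CartanDatum (I : Type) where
  form : I → I → ℤ
  symm : ∀ i j, form i j = form j i
  diag : ∀ i, form i i = 2
  offdiag : ∀ i j, i ≠ j → form i j = 0 ∨ form i j = -1

/-- The left hand side of the quantum Serre relation,
`∑_{n=0}^{1-i·j} (-1)^n t_i^{(n)} t_j t_i^{(1-i·j-n)}`. -/
def serre {I : Type} (C : CartanDatum I) {A : Type*} [Ring A] [Algebra K A] (t : I → A)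
    (i j : I) : A :=
  ∑ n ∈ Finset.range ((1 - C.form i j).toNat + 1),
    (-1) ^ n * (dp (t i) n * t j * dp (t i) ((1 - C.form i j).toNat - n))

theorem serre_eq_zero_iff {I : Type} (C : CartanDatum I) {A : Type*} [Ring A] [Algebra K A]
    (t : I → A) (i j : I) (hij : i ≠ j) :
    serre C t i j = 0 ↔
      (C.form i j = 0 → t i * t j = t j * t i) ∧
      (C.form i j = -1 →
        t i * t i * t j + t j * t i * t i = (v + v⁻¹) • (t i * t j * t i)) := by
  rcases C.offdiag i j hij with h | h
  · simp [serre, h, Finset.sum_range_succ, dp_zero, dp_one, ← sub_eq_add_neg, sub_eq_zero, eq_comm]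
  · have h2 := v_add_inv_ne_zero
    have : serre C t i j = (v + v⁻¹)⁻¹ •
        ((t i * t i * t j + t j * t i * t i) - (v + v⁻¹) • (t i * t j * t i)) := by
      simp only [serre, h, show ((1 : ℤ) - -1).toNat = 2 from rfl, Finset.sum_range_succ,
        Finset.sum_range_zero, dp_zero, dp_one, dp_two, smul_sub, smul_smul, inv_mul_cancel₀ h2,
        one_smul, smul_add, Nat.sub_zero, Nat.sub_self, Nat.reduceSub]
      simp only [smul_mul_assoc, mul_smul_comm, pow_zero, pow_one, pow_two, mul_assoc]
      simp
      abel
    rw [this, smul_eq_zero, sub_eq_zero]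
    simp [h, h2]

/-- The quantum Serre relations. -/
inductive SerreRel {I : Type} (C : CartanDatum I) : FreeAlgebra K I → FreeAlgebra K I → Prop
  | mk (i j : I) (hij : i ≠ j) : SerreRel C (serre C (FreeAlgebra.ι K) i j) 0

/-- The `ℚ(v)`-algebra `f` with generators `θ_i` and the quantum Serre relations. -/
def HalfAlg {I : Type} (C : CartanDatum I) : Type := RingQuot (SerreRel C)

instance {I : Type} (C : CartanDatum I) : Ring (HalfAlg C) :=
  inferInstanceAs (Ring (RingQuot (SerreRel C)))

instance {I : Type} (C : CartanDatum I) : Algebra K (HalfAlg C) :=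
  inferInstanceAs (Algebra K (RingQuot (SerreRel C)))

/-- The generators `θ_i`. -/
def θ {I : Type} (C : CartanDatum I) (i : I) : HalfAlg C :=
  RingQuot.mkAlgHom K (SerreRel C) (FreeAlgebra.ι K i)

theorem map_dp {A B : Type*} [Ring A] [Algebra K A] [Ring B] [Algebra K B] (g : A →ₐ[K] B)
    (x : A) (n : ℕ) : g (dp x n) = dp (g x) n := by
  simp [dp]

theorem map_serre {I : Type} (C : CartanDatum I) {A B : Type*} [Ring A] [Algebra K A] [Ring B]
    [Algebra K B] (g : A →ₐ[K] B) (t : I → A) (i j : I) :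
    g (serre C t i j) = serre C (fun k => g (t k)) i j := by
  simp [serre, map_dp]

theorem serre_θ {I : Type} (C : CartanDatum I) (i j : I) (hij : i ≠ j) :
    serre C (θ C) i j = 0 := by
  have h := RingQuot.mkAlgHom_rel K (SerreRel.mk (C := C) i j hij)
  rw [map_zero, map_serre] at h
  exact h

/-- The universal property of `f`. -/
def lift {I : Type} (C : CartanDatum I) {A : Type*} [Ring A] [Algebra K A] (t : I → A)
    (ht : ∀ i j, i ≠ j → serre C t i j = 0) : HalfAlg C →ₐ[K] A :=
  RingQuot.liftAlgHom K ⟨FreeAlgebra.lift K t, by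
    rintro _ _ ⟨i, j, hij⟩
    rw [map_serre, map_zero]
    simpa using ht i j hij⟩

@[simp]
theorem lift_θ {I : Type} (C : CartanDatum I) {A : Type*} [Ring A] [Algebra K A] (t : I → A)
    (ht : ∀ i j, i ≠ j → serre C t i j = 0) (i : I) : lift C t ht (θ C i) = t i := by
  simp only [lift, θ]
  erw [RingQuot.liftAlgHom_mkAlgHom_apply]
  simp

theorem algHom_ext {I : Type} (C : CartanDatum I) {A : Type*} [Ring A] [Algebra K A]
    (g h : HalfAlg C →ₐ[K] A) (H : ∀ i, g (θ C i) = h (θ C i)) : g = h :=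
  RingQuot.ringQuot_ext' _ _ _ (FreeAlgebra.hom_ext (funext H))

theorem adjoin_θ {I : Type} (C : CartanDatum I) : Algebra.adjoin K (Set.range (θ C)) = ⊤ := by
  have h : Set.range (θ C) = RingQuot.mkAlgHom K (SerreRel C) '' Set.range (FreeAlgebra.ι K) := by
    rw [← Set.range_comp]; rfl
  rw [h]
  erw [← AlgHom.map_adjoin, FreeAlgebra.adjoin_range_ι, Algebra.map_top, AlgHom.range_eq_top]
  exact RingQuot.mkAlgHom_surjective K _

/-- A subspace containing `1` and stable under left multiplication by all `θ_i` is everything. -/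
theorem submodule_eq_top {I : Type} (C : CartanDatum I) (S : Submodule K (HalfAlg C))
    (h1 : (1 : HalfAlg C) ∈ S) (hS : ∀ i, ∀ x ∈ S, θ C i * x ∈ S) : S = ⊤ := by
  have key : ∀ a : HalfAlg C, a ∈ Algebra.adjoin K (Set.range (θ C)) → ∀ s ∈ S, a * s ∈ S := by
    intro a ha
    induction ha using Algebra.adjoin_induction with
    | mem x hx => obtain ⟨i, rfl⟩ := hx; exact hS i
    | algebraMap r => intro s hs; rw [← Algebra.smul_def]; exact S.smul_mem r hs
    | add x y _ _ hx hy => intro s hs; rw [add_mul]; exact S.add_mem (hx s hs) (hy s hs)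
    | mul x y _ _ hx hy => intro s hs; rw [mul_assoc]; exact hx _ (hy s hs)
  rw [eq_top_iff]
  intro a _
  simpa using key a (by rw [adjoin_θ]; trivial) 1 h1

/-- Two linear maps on `f` that agree at `1` and satisfy the same recursion are equal. -/
theorem linearMap_ext {I : Type} (C : CartanDatum I) {M : Type*} [AddCommGroup M] [Module K M]
    (g h : HalfAlg C →ₗ[K] M) (h1 : g 1 = h 1)
    (hS : ∀ i x, g x = h x → g (θ C i * x) = h (θ C i * x)) : g = h := by
  have := submodule_eq_top C (LinearMap.eqLocus g h) h1 hS
  exact LinearMap.eqLocus_eq_top.mp this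

/-! ### Bar involution -/

/-- The ring `f` with the `ℚ(v)`-algebra structure twisted by the bar involution of `ℚ(v)`. -/
def BarTwist {I : Type} (C : CartanDatum I) : Type := HalfAlg C

instance {I : Type} (C : CartanDatum I) : Ring (BarTwist C) := inferInstanceAs (Ring (HalfAlg C))

instance {I : Type} (C : CartanDatum I) : Algebra K (BarTwist C) :=
  ((algebraMap K (HalfAlg C)).comp barK).toAlgebra' fun c x =>
    Algebra.commutes (A := HalfAlg C) (barK c) x

theorem barTwist_smul {I : Type} (C : CartanDatum I) (c : K) (x : BarTwist C) :
    c • x = (barK c • (show HalfAlg C from x) : HalfAlg C) := by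
  rw [Algebra.smul_def]
  exact (Algebra.smul_def (A := HalfAlg C) (barK c) x).symm

theorem serre_barTwist {I : Type} (C : CartanDatum I) (i j : I) (hij : i ≠ j) :
    serre C (A := BarTwist C) (θ C) i j = 0 := by
  obtain ⟨h0, h1⟩ := (serre_eq_zero_iff C (θ C) i j hij).mp (serre_θ C i j hij)
  refine (serre_eq_zero_iff C (A := BarTwist C) (θ C) i j hij).mpr ⟨h0, fun h => ?_⟩
  refine (h1 h).trans ((barTwist_smul C (v + v⁻¹) (θ C i * θ C j * θ C i : HalfAlg C)).trans ?_).symm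
  rw [map_add, map_inv₀, barK_v, inv_inv, add_comm]

/-- The bar involution of `f`: the ring homomorphism with `θ_i ↦ θ_i` and `v ↦ v⁻¹`. -/
def bar {I : Type} (C : CartanDatum I) : HalfAlg C →+* HalfAlg C :=
  (lift C (A := BarTwist C) (θ C) (serre_barTwist C) : HalfAlg C →ₐ[K] BarTwist C).toRingHom

theorem bar_θ {I : Type} (C : CartanDatum I) (i : I) : bar C (θ C i) = θ C i :=
  lift_θ C (A := BarTwist C) _ (serre_barTwist C) i

theorem bar_smul {I : Type} (C : CartanDatum I) (c : K) (x : HalfAlg C) :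
    bar C (c • x) = barK c • bar C x :=
  (map_smul (lift C (A := BarTwist C) (θ C) (serre_barTwist C)) c x).trans (barTwist_smul C c _)

/-! ### Comultiplication -/

/-- The algebra endomorphism of `f` with `θ_j ↦ c_j θ_j`. -/
def scale {I : Type} (C : CartanDatum I) (c : I → K) : HalfAlg C →ₐ[K] HalfAlg C :=
  lift C (fun j => c j • θ C j) fun i j hij => by
    obtain ⟨h0, h1⟩ := (serre_eq_zero_iff C (θ C) i j hij).mp (serre_θ C i j hij)
    refine (serre_eq_zero_iff C _ i j hij).mpr ⟨fun h => ?_, fun h => ?_⟩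
    · simp only [smul_mul_smul_comm, h0 h, mul_comm (c i)]
    · simp only [smul_mul_smul_comm]
      rw [mul_comm (c j), mul_right_comm, ← smul_add, h1 h, smul_comm, mul_right_comm (c i)]

/-- For `x` homogeneous, `degTwist i x = v^{i · |x|} x`. -/
def degTwist {I : Type} (C : CartanDatum I) (i : I) : HalfAlg C →ₐ[K] HalfAlg C :=
  scale C fun j => v ^ C.form i j

@[simp]
theorem scale_θ {I : Type} (C : CartanDatum I) (c : I → K) (i : I) :
    scale C c (θ C i) = c i • θ C i := lift_θ _ _ _ _

theorem serre_two_add {F A : Type*} [Field F] [Ring A] [Algebra F A] (q : F) (hv : q ≠ 0) (ai aj bi bj : A)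
   (a2 : ai * ai * aj + aj * ai * ai = (q + q⁻¹) • (ai * aj * ai))
   (b2 : bi * bi * bj + bj * bi * bi = (q + q⁻¹) • (bi * bj * bi))
   (h1 : bi * aj = q⁻¹ • (aj * bi)) (h2 : bj * ai = q⁻¹ • (ai * bj))
   (h3 : bi * ai = q ^ 2 • (ai * bi)) : 
   (ai + bi) * (ai + bi) * (aj + bj) + (aj + bj) * (ai + bi) * (ai + bi) = 
     (q + q⁻¹) • ((ai + bi) * (aj + bj) * (ai + bi)) := by
    have g1 : ∀ x, bi * (aj * x) = q⁻¹ • (aj * (bi * x)) := by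
      intro x; rw [← mul_assoc, h1, smul_mul_assoc, mul_assoc]
    have g2 : ∀ x, bj * (ai * x) = q⁻¹ • (ai * (bj * x)) := by
      intro x; rw [← mul_assoc, h2, smul_mul_assoc, mul_assoc]
    have g3 : ∀ x, bi * (ai * x) = q ^ 2 • (ai * (bi * x)) := by
      intro x; rw [← mul_assoc, h3, smul_mul_assoc, mul_assoc]
    have key : (ai + bi) * (ai + bi) * (aj + bj) + (aj + bj) * (ai + bi) * (ai + bi) -
        (q + q⁻¹) • ((ai + bi) * (aj + bj) * (ai + bi)) =
        (ai * ai * aj + aj * ai * ai - (q + q⁻¹) • (ai * aj * ai)) +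
        (bi * bi * bj + bj * bi * bi - (q + q⁻¹) • (bi * bj * bi)) := by
      simp only [mul_add, add_mul, mul_assoc, h1, h2, h3, g1, g2, g3, mul_smul_comm, smul_mul_assoc, smul_smul]
      match_scalars <;> field_simp <;> ring
    rw [a2, b2, sub_self, sub_self, add_zero] at key
    exact sub_eq_zero.mp key

theorem serre_add {I : Type} (C : CartanDatum I) {A : Type*} [Ring A] [Algebra K A]
    (a b : I → A) (i j : I) (hij : i ≠ j) (ha : serre C a i j = 0) (hb : serre C b i j = 0)
    (hba : ∀ k l, b k * a l = v ^ C.form k l • (a l * b k)) :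
    serre C (fun k => a k + b k) i j = 0 := by
  obtain ⟨a0, a1⟩ := (serre_eq_zero_iff C a i j hij).mp ha
  obtain ⟨b0, b1⟩ := (serre_eq_zero_iff C b i j hij).mp hb
  refine (serre_eq_zero_iff C _ i j hij).mpr ⟨fun h => ?_, fun h => ?_⟩
  · have h1 := hba i j
    have h2 := hba j i
    rw [C.symm j i] at h2
    rw [h, zpow_zero, one_smul] at h1 h2
    simp only [mul_add, add_mul, a0 h, b0 h, h1, h2]
    abel
  · have h1 := hba i j
    have h2 := hba j i
    have h3 := hba i i
    rw [C.symm j i] at h2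
    rw [h, zpow_neg_one] at h1 h2
    rw [C.diag] at h3
    exact serre_two_add v v_ne_zero _ _ _ _ (a1 h) (b1 h) h1 h2 h3

/-- Left multiplication by `θ_i ⊗ 1 + 1 ⊗ θ_i` in the algebra `f ⊗ f` with the product
`(x₁ ⊗ x₂)(y₁ ⊗ y₂) = v^{|x₂| · |y₁|} x₁y₁ ⊗ x₂y₂`. -/
def mulPrim {I : Type} (C : CartanDatum I) (i : I) :
    Module.End K (HalfAlg C ⊗[K] HalfAlg C) :=
  TensorProduct.map (LinearMap.mulLeft K (θ C i)) LinearMap.id +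
    TensorProduct.map (degTwist C i).toLinearMap (LinearMap.mulLeft K (θ C i))

theorem serre_mulPrim {I : Type} (C : CartanDatum I) (i j : I) (hij : i ≠ j) :
    serre C (mulPrim C) i j = 0 := by
  refine serre_add C _ _ i j hij ?_ ?_ ?_
  · obtain ⟨h0, h1⟩ := (serre_eq_zero_iff C (θ C) i j hij).mp (serre_θ C i j hij)
    refine (serre_eq_zero_iff C _ i j hij).mpr ⟨fun h => ?_, fun h => ?_⟩
    · ext x y
      simp [← mul_assoc, h0 h]
    · ext x y
      have := congrArg (fun z => (z * x) ⊗ₜ[K] y) (h1 h)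
      simpa [← mul_assoc, add_mul, TensorProduct.add_tmul, TensorProduct.smul_tmul'] using this
  · obtain ⟨h0, h1⟩ := (serre_eq_zero_iff C (θ C) i j hij).mp (serre_θ C i j hij)
    have hcomm : ∀ x, degTwist C i (degTwist C j x) = degTwist C j (degTwist C i x) := by
      intro x
      have : (degTwist C i).comp (degTwist C j) = (degTwist C j).comp (degTwist C i) :=
        algHom_ext C _ _ fun k => by simp [degTwist, smul_smul, mul_comm]
      exact DFunLike.congr_fun this x
    refine (serre_eq_zero_iff C _ i j hij).mpr ⟨fun h => ?_, fun h => ?_⟩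
    · ext x y
      simp [← mul_assoc, h0 h, hcomm]
    · ext x y
      have := congrArg (fun z => degTwist C j (degTwist C i (degTwist C i x)) ⊗ₜ[K] (z * y)) (h1 h)
      simpa [← mul_assoc, add_mul, TensorProduct.tmul_add, TensorProduct.tmul_smul, hcomm] using this
  · intro k l
    ext x y
    simp [degTwist, TensorProduct.smul_tmul']

/-- The comultiplication `r : f → f ⊗ f`, the homomorphism for the twisted product on `f ⊗ f`
with `r(θ_i) = θ_i ⊗ 1 + 1 ⊗ θ_i`, written as `r(x) = r(x) · (1 ⊗ 1)`. -/
def r {I : Type} (C : CartanDatum I) : HalfAlg C →ₗ[K] HalfAlg C ⊗[K] HalfAlg C :=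
  (LinearMap.applyₗ (1 ⊗ₜ[K] 1 : HalfAlg C ⊗[K] HalfAlg C)).comp
    (lift C (mulPrim C) (serre_mulPrim C)).toLinearMap

theorem r_one {I : Type} (C : CartanDatum I) : r C 1 = 1 ⊗ₜ[K] 1 := by
  simp [r]

theorem r_θ_mul {I : Type} (C : CartanDatum I) (i : I) (x : HalfAlg C) :
    r C (θ C i * x) = mulPrim C i (r C x) := by
  simp [r]

/-! ### The bilinear form -/

/-- The algebra homomorphism `f → ℚ(v)` with `θ_i ↦ 0`: projection to the degree `0` component. -/
def counit {I : Type} (C : CartanDatum I) : HalfAlg C →ₐ[K] K :=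
  lift C (fun _ => 0) fun i j hij => by simp [serre_eq_zero_iff C _ i j hij]

/-- The algebra homomorphism `f → ℚ(v)[ε]/(ε²)` with `θ_i ↦ ε` and `θ_j ↦ 0` for `j ≠ i`. -/
def dualHom {I : Type} [DecidableEq I] (C : CartanDatum I) (i : I) :
    HalfAlg C →ₐ[K] DualNumber K :=
  lift C (fun j => if j = i then DualNumber.eps else 0) fun k l hkl => by
    rw [serre_eq_zero_iff C _ k l hkl]
    constructor <;> intro _ <;> split_ifs <;> simp

/-- The linear form on `f` that is `1` on `θ_i` and `0` on `θ_j`, `j ≠ i`, and on all homogeneous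
components of total degree different from `1`. -/
def coeffθ {I : Type} [DecidableEq I] (C : CartanDatum I) (i : I) : HalfAlg C →ₗ[K] K :=
  (TrivSqZeroExt.sndHom K K).comp (dualHom C i).toLinearMap

theorem coeffθ_one {I : Type} [DecidableEq I] (C : CartanDatum I) (i : I) : coeffθ C i 1 = 0 := by
  simp [coeffθ]

theorem coeffθ_θ_mul {I : Type} [DecidableEq I] (C : CartanDatum I) (i j : I) (x : HalfAlg C) :
    coeffθ C i (θ C j * x) = if j = i then counit C x else 0 := by
  have h : ∀ y, (dualHom C i y).fst = counit C y := by
    intro y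
    have : (TrivSqZeroExt.fstHom K K K).comp (dualHom C i) = counit C := by
      refine algHom_ext C _ _ fun k => ?_
      simp only [AlgHom.comp_apply, dualHom, counit, lift_θ]
      split_ifs <;> simp
    exact DFunLike.congr_fun this y
  simp only [coeffθ, LinearMap.comp_apply, AlgHom.toLinearMap_apply, map_mul]
  have h2 : dualHom C i (θ C j) = if j = i then DualNumber.eps else 0 := lift_θ _ _ _ _
  rw [h2]
  split_ifs <;> simp [h]

/-- The linear map `_ir : f → f` with `r(x) = θ_i ⊗ _ir(x) + (terms x₁ ⊗ x₂ with |x₁| ≠ i)`. -/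
def leftDer {I : Type} [DecidableEq I] (C : CartanDatum I) (i : I) : Module.End K (HalfAlg C) :=
  (TensorProduct.lid K (HalfAlg C)).toLinearMap.comp
    ((TensorProduct.map (coeffθ C i) LinearMap.id).comp (r C))

theorem counit_r {I : Type} (C : CartanDatum I) (x : HalfAlg C) :
    TensorProduct.lid K (HalfAlg C)
      (TensorProduct.map (counit C).toLinearMap LinearMap.id (r C x)) = x := by
  have : (TensorProduct.lid K (HalfAlg C)).toLinearMap.comp
      ((TensorProduct.map (counit C).toLinearMap LinearMap.id).comp (r C)) = LinearMap.id := by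
    refine linearMap_ext C _ _ ?_ fun i x hx => ?_
    · simp [r_one]
    · simp only [LinearMap.comp_apply, LinearMap.id_apply, LinearEquiv.coe_coe] at hx ⊢
      have key : ∀ t : HalfAlg C ⊗[K] HalfAlg C,
          TensorProduct.lid K (HalfAlg C)
            (TensorProduct.map (counit C).toLinearMap LinearMap.id (mulPrim C i t)) =
          θ C i * TensorProduct.lid K (HalfAlg C)
            (TensorProduct.map (counit C).toLinearMap LinearMap.id t) := by
        intro t
        have hc : ∀ y, counit C (degTwist C i y) = counit C y := by
          intro y
          have : (counit C).comp (degTwist C i) = counit C :=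
            algHom_ext C _ _ fun k => by simp [counit, degTwist]
          exact DFunLike.congr_fun this y
        have h0 : counit C (θ C i) = 0 := by simp [counit]
        induction t with
        | zero => simp
        | add a b ha hb => simp only [map_add, mul_add, ha, hb]
        | tmul a b => simp [mulPrim, hc, h0]
      rw [r_θ_mul, key, hx]
  exact LinearMap.congr_fun this x

theorem leftDer_one {I : Type} [DecidableEq I] (C : CartanDatum I) (i : I) :
    leftDer C i 1 = 0 := by
  simp [leftDer, r_one, coeffθ_one]

theorem leftDer_θ_mul {I : Type} [DecidableEq I] (C : CartanDatum I) (i j : I) (x : HalfAlg C) :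
    leftDer C i (θ C j * x) =
      (if j = i then x else 0) + v ^ C.form i j • (θ C j * leftDer C i x) := by
  have hs : ∀ y, coeffθ C i (degTwist C j y) = v ^ C.form i j * coeffθ C i y := by
    intro y
    have : (coeffθ C i).comp (degTwist C j).toLinearMap = v ^ C.form i j • coeffθ C i := by
      refine linearMap_ext C _ _ ?_ fun k x _ => ?_
      · simp [coeffθ_one]
      · have hc : counit C (degTwist C j x) = counit C x := by
          have : (counit C).comp (degTwist C j) = counit C :=
            algHom_ext C _ _ fun k => by simp [counit, degTwist]
          exact DFunLike.congr_fun this x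
        simp only [LinearMap.comp_apply, AlgHom.toLinearMap_apply, map_mul, degTwist, scale_θ,
          LinearMap.smul_apply, coeffθ_θ_mul, smul_mul_assoc, map_smul] at hc ⊢
        split_ifs with h
        · subst h; rw [hc, C.symm]
        · simp
    exact LinearMap.congr_fun this y
  have key : ∀ t : HalfAlg C ⊗[K] HalfAlg C,
      TensorProduct.lid K (HalfAlg C)
        (TensorProduct.map (coeffθ C i) LinearMap.id (mulPrim C j t)) =
      (if j = i then TensorProduct.lid K (HalfAlg C)
        (TensorProduct.map (counit C).toLinearMap LinearMap.id t) else 0) +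
      v ^ C.form i j • (θ C j * TensorProduct.lid K (HalfAlg C)
        (TensorProduct.map (coeffθ C i) LinearMap.id t)) := by
    intro t
    induction t with
    | zero => simp
    | add a b ha hb =>
      simp only [map_add, ha, hb, mul_add, smul_add]
      split_ifs <;> abel
    | tmul a b =>
      simp only [mulPrim, LinearMap.add_apply, TensorProduct.map_tmul, LinearMap.mulLeft_apply,
        LinearMap.id_apply, map_add, TensorProduct.lid_tmul, coeffθ_θ_mul,
        AlgHom.toLinearMap_apply, hs, ite_smul, zero_smul, mul_smul_comm, smul_smul]
  have := key (r C x)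
  rw [counit_r] at this
  simpa only [leftDer, LinearMap.comp_apply, LinearEquiv.coe_coe, r_θ_mul] using this

theorem serre_mul_comm {F A : Type*} [Field F] [Ring A] [Algebra F A] (q p s d e : F) (hq : q ≠ 0)
    (a b t : A) (ha : a * t = d • 1 + p • (t * a)) (hb : b * t = e • 1 + s • (t * b))
    (h : d = 0 ∧ e = 0 ∨ e = 0 ∧ p = q ^ 2 ∧ s = q⁻¹ ∨ d = 0 ∧ p = q⁻¹ ∧ s = q ^ 2) :
    (b * a * a + a * a * b - (q + q⁻¹) • (a * b * a)) * t =
      (p ^ 2 * s) • (t * (b * a * a + a * a * b - (q + q⁻¹) • (a * b * a))) := by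
  have ha' : ∀ x, a * (t * x) = d • x + p • (t * (a * x)) := by
    intro x; rw [← mul_assoc, ha]; simp [add_mul, mul_assoc]
  have hb' : ∀ x, b * (t * x) = e • x + s • (t * (b * x)) := by
    intro x; rw [← mul_assoc, hb]; simp [add_mul, mul_assoc]
  simp only [mul_add, add_mul, mul_sub, sub_mul, mul_assoc, ha, hb, ha', hb', mul_smul_comm,
    smul_mul_assoc, mul_one]
  rcases h with ⟨rfl, rfl⟩ | ⟨rfl, rfl, rfl⟩ | ⟨rfl, rfl, rfl⟩ <;>
  match_scalars <;> field_simp <;> ring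

theorem serre_leftDer {I : Type} [DecidableEq I] (C : CartanDatum I) (c : K) (i j : I)
    (hij : i ≠ j) :
    serre C (A := (Module.End K (HalfAlg C))ᵐᵒᵖ)
      (fun k => MulOpposite.op (c • leftDer C k)) i j = 0 := by
  have hv := v_ne_zero
  refine (serre_eq_zero_iff C _ i j hij).mpr ⟨fun h => ?_, fun h => ?_⟩
  · have : leftDer C j * leftDer C i = leftDer C i * leftDer C j := by
      refine linearMap_ext C _ _ ?_ fun k x hx => ?_
      · simp [leftDer_one]
      · simp only [Module.End.mul_apply] at hx ⊢
        simp only [leftDer_θ_mul, map_add, map_smul]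
        by_cases h1 : k = i
        · subst h1
          simp [hij, C.symm j k, h, hx]
        · by_cases h2 : k = j
          · subst h2
            simp [Ne.symm hij, h, hx]
          · simp [h1, h2, hx, smul_smul, mul_comm]
    simp only [← MulOpposite.op_mul, smul_mul_smul_comm, this]
  · have : leftDer C j * leftDer C i * leftDer C i + leftDer C i * leftDer C i * leftDer C j =
        (v + v⁻¹) • (leftDer C i * leftDer C j * leftDer C i) := by
      refine linearMap_ext C _ _ ?_ fun k x hx => ?_
      · simp [leftDer_one]
      · have ht : ∀ l, leftDer C l * LinearMap.mulLeft K (θ C k) =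
            (if k = l then (1 : K) else 0) • (1 : Module.End K (HalfAlg C)) +
              v ^ C.form l k • (LinearMap.mulLeft K (θ C k) * leftDer C l) := by
          intro l
          ext y
          simp only [Module.End.mul_apply, LinearMap.mulLeft_apply, leftDer_θ_mul,
            LinearMap.add_apply, LinearMap.smul_apply, Module.End.one_apply]
          split_ifs <;> simp
        have key := serre_mul_comm v _ _ _ _ hv _ _ _ (ht i) (ht j) (by
          by_cases h1 : k = i
          · subst h1
            refine Or.inr (Or.inl ⟨by simp [hij], ?_, ?_⟩)
            · rw [C.diag]; rfl
            · rw [C.symm, h, zpow_neg_one]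
          · by_cases h2 : k = j
            · subst h2
              refine Or.inr (Or.inr ⟨by simp [h1], ?_, ?_⟩)
              · rw [h, zpow_neg_one]
              · rw [C.diag]; rfl
            · exact Or.inl ⟨by simp [h1], by simp [h2]⟩)
        have key' := LinearMap.congr_fun key x
        rw [← sub_eq_zero, ← LinearMap.sub_apply] at hx
        rw [Module.End.mul_apply, LinearMap.smul_apply, Module.End.mul_apply, hx, map_zero,
          smul_zero, LinearMap.sub_apply, sub_eq_zero] at key'
        exact key'
    have h3 := congrArg (fun z => MulOpposite.op ((c * c * c) • z)) this
    simpa [smul_smul, mul_assoc, mul_comm, mul_left_comm, smul_add] using h3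

/-- The algebra homomorphism `f → End(f)ᵒᵖ` with `θ_i ↦ (1 - v⁻²)⁻¹ _ir`. -/
def formHom {I : Type} [DecidableEq I] (C : CartanDatum I) :
    HalfAlg C →ₐ[K] (Module.End K (HalfAlg C))ᵐᵒᵖ :=
  lift C (fun i => MulOpposite.op ((1 - v ^ (-2 : ℤ))⁻¹ • leftDer C i)) (serre_leftDer C _)

/-- The symmetric bilinear form on `f` with `(1, 1) = 1`, `(θ_i, θ_j) = δ_{ij} (1 - v⁻²)⁻¹` and
`(x₁x₂, x) = (x₁ ⊗ x₂, r(x))`; it is given by `(1, y) = ε(y)` and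
`(θ_i x, y) = (1 - v⁻²)⁻¹ (x, _ir(y))`. -/
def form {I : Type} [DecidableEq I] (C : CartanDatum I) :
    HalfAlg C →ₗ[K] HalfAlg C →ₗ[K] K :=
  LinearMap.mk₂ K (fun x y => counit C ((formHom C x).unop y)) (by simp) (by simp) (by simp)
    (by simp)

theorem form_one {I : Type} [DecidableEq I] (C : CartanDatum I) (y : HalfAlg C) :
    form C 1 y = counit C y := by
  simp [form]

theorem form_θ_mul {I : Type} [DecidableEq I] (C : CartanDatum I) (i : I) (x y : HalfAlg C) :
    form C (θ C i * x) y = (1 - v ^ (-2 : ℤ))⁻¹ * form C x (leftDer C i y) := by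
  simp [form, formHom]

theorem form_θ_θ {I : Type} [DecidableEq I] (C : CartanDatum I) (i j : I) :
    form C (θ C i) (θ C j) = if i = j then (1 - v ^ (-2 : ℤ))⁻¹ else 0 := by
  have h : leftDer C i (θ C j) = if j = i then 1 else 0 := by
    have := leftDer_θ_mul C i j 1
    simpa [leftDer_one] using this
  have := form_θ_mul C i 1 (θ C j)
  rw [mul_one, form_one, h] at this
  rw [this]
  by_cases hij : i = j
  · simp [hij]
  · simp [hij, Ne.symm hij]

theorem counit_θ_mul {I : Type} (C : CartanDatum I) (i : I) (x : HalfAlg C) :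
    counit C (θ C i * x) = 0 := by
  simp [counit]

theorem form_mul_θ {I : Type} [DecidableEq I] (C : CartanDatum I) (i : I) (x y : HalfAlg C) :
    form C x (θ C i * y) = (1 - v ^ (-2 : ℤ))⁻¹ * form C (leftDer C i x) y := by
  have : (LinearMap.lcomp K K (LinearMap.mulLeft K (θ C i))).comp (form C) =
      (1 - v ^ (-2 : ℤ))⁻¹ • (form C).comp (leftDer C i) := by
    refine linearMap_ext C _ _ ?_ fun j x hx => ?_
    · ext y
      simp [form_one, counit_θ_mul, leftDer_one]
    · ext y
      have hx' : ∀ y, form C x (θ C i * y) =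
          (1 - v ^ (-2 : ℤ))⁻¹ * form C (leftDer C i x) y := LinearMap.congr_fun hx
      simp only [LinearMap.comp_apply, LinearMap.lcomp_apply, LinearMap.mulLeft_apply,
        LinearMap.smul_apply, smul_eq_mul]
      rw [form_θ_mul, leftDer_θ_mul, leftDer_θ_mul, map_add, map_add, LinearMap.add_apply,
        map_smul, map_smul, LinearMap.smul_apply, hx', form_θ_mul, C.symm]
      by_cases hij : i = j
      · simp [hij]
      · simp [hij, Ne.symm hij]
  exact LinearMap.congr_fun (LinearMap.congr_fun this x) y

theorem form_symm {I : Type} [DecidableEq I] (C : CartanDatum I) (x y : HalfAlg C) :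
    form C x y = form C y x := by
  have : form C = (form C).flip := by
    refine linearMap_ext C _ _ ?_ fun i x hx => ?_
    · refine linearMap_ext C _ _ rfl fun i x _ => ?_
      rw [LinearMap.flip_apply, form_one, counit_θ_mul, form_θ_mul, leftDer_one, map_zero, mul_zero]
    · ext y
      rw [LinearMap.flip_apply, form_θ_mul, form_mul_θ, hx, LinearMap.flip_apply]
  exact LinearMap.congr_fun (LinearMap.congr_fun this x) y

theorem leftDer_degTwist {I : Type} [DecidableEq I] (C : CartanDatum I) (i j : I) (x : HalfAlg C) :
    leftDer C i (degTwist C j x) = v ^ C.form i j • degTwist C j (leftDer C i x) := by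
  have : (leftDer C i).comp (degTwist C j).toLinearMap =
      v ^ C.form i j • (degTwist C j).toLinearMap.comp (leftDer C i) := by
    refine linearMap_ext C _ _ ?_ fun k x hx => ?_
    · simp [leftDer_one]
    · simp only [LinearMap.comp_apply, LinearMap.smul_apply, AlgHom.toLinearMap_apply] at hx ⊢
      have hk : degTwist C j (θ C k) = v ^ C.form j k • θ C k := scale_θ _ _ _
      rw [map_mul, hk, smul_mul_assoc, map_smul, leftDer_θ_mul, leftDer_θ_mul, hx, map_add,
        map_smul, map_mul, hk]
      by_cases h : k = i
      · subst h
        simp [smul_smul, mul_comm, C.symm j k]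
      · simp [h, smul_smul, mul_assoc, mul_comm]
  exact LinearMap.congr_fun this x

theorem r_leftDer {I : Type} [DecidableEq I] (C : CartanDatum I) (i : I) (x : HalfAlg C) :
    r C (leftDer C i x) = TensorProduct.map (leftDer C i) LinearMap.id (r C x) := by
  have : (r C).comp (leftDer C i) =
      (TensorProduct.map (leftDer C i) LinearMap.id).comp (r C) := by
    refine linearMap_ext C _ _ ?_ fun j x hx => ?_
    · simp [leftDer_one, r_one]
    · simp only [LinearMap.comp_apply] at hx ⊢
      have key : ∀ t : HalfAlg C ⊗[K] HalfAlg C,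
          TensorProduct.map (leftDer C i) LinearMap.id (mulPrim C j t) =
          (if j = i then t else 0) +
            v ^ C.form i j • mulPrim C j (TensorProduct.map (leftDer C i) LinearMap.id t) := by
        intro t
        induction t with
        | zero => simp
        | add a b ha hb =>
          simp only [map_add, ha, hb, smul_add]
          split_ifs <;> abel
        | tmul a b =>
          simp only [mulPrim, LinearMap.add_apply, TensorProduct.map_tmul, LinearMap.mulLeft_apply,
            LinearMap.id_apply, map_add, leftDer_θ_mul, AlgHom.toLinearMap_apply, leftDer_degTwist,
            TensorProduct.add_tmul, smul_add, ← TensorProduct.smul_tmul', add_assoc]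
          split_ifs <;> simp
      rw [r_θ_mul, key, leftDer_θ_mul, map_add, map_smul, r_θ_mul, hx]
      congr 1
      split_ifs <;> simp
  exact LinearMap.congr_fun this x

theorem form_mul {I : Type} [DecidableEq I] (C : CartanDatum I) (x₁ x₂ x : HalfAlg C) :
    form C (x₁ * x₂) x =
      TensorProduct.lid K K (TensorProduct.map (form C x₁) (form C x₂) (r C x)) := by
  have h1 : form C 1 = (counit C).toLinearMap := LinearMap.ext (form_one C)
  have h2 : ∀ t : HalfAlg C ⊗[K] HalfAlg C,
      TensorProduct.lid K K (TensorProduct.map (counit C).toLinearMap (form C x₂) t) =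
      form C x₂ (TensorProduct.lid K (HalfAlg C)
        (TensorProduct.map (counit C).toLinearMap LinearMap.id t)) := by
    intro t
    induction t with
    | zero => simp
    | add a b ha hb => simp only [map_add, ha, hb]
    | tmul a b => simp
  let h : HalfAlg C →ₗ[K] HalfAlg C →ₗ[K] K :=
    { toFun := fun a => (TensorProduct.lid K K).toLinearMap.comp
        ((TensorProduct.map (form C a) (form C x₂)).comp (r C))
      map_add' := fun a b => by
        ext x
        simp [TensorProduct.map_add_left]
      map_smul' := fun c a => by
        ext x
        simp [TensorProduct.map_smul_left] }
  have : (form C).comp (LinearMap.mulRight K x₂) = h := by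
    refine linearMap_ext C _ _ ?_ fun i a ha => ?_
    · ext x
      simp only [h, LinearMap.comp_apply, LinearMap.mulRight_apply, one_mul, LinearMap.coe_mk,
        AddHom.coe_mk, h1, LinearEquiv.coe_coe]
      rw [h2, counit_r]
    · ext x
      have ha' : ∀ x, form C (a * x₂) x =
        TensorProduct.lid K K (TensorProduct.map (form C a) (form C x₂) (r C x)) :=
        LinearMap.congr_fun ha
      have h3 : form C (θ C i * a) =
          (1 - v ^ (-2 : ℤ))⁻¹ • (form C a).comp (leftDer C i) := by
        ext y
        simpa using form_θ_mul C i a y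
      have h4 : ∀ t : HalfAlg C ⊗[K] HalfAlg C,
          TensorProduct.map ((form C a).comp (leftDer C i)) (form C x₂) t =
          TensorProduct.map (form C a) (form C x₂)
            (TensorProduct.map (leftDer C i) LinearMap.id t) := by
        intro t
        induction t with
        | zero => simp
        | add a b ha hb => simp only [map_add, ha, hb]
        | tmul a b => simp
      simp only [h, LinearMap.comp_apply, LinearMap.mulRight_apply, LinearMap.coe_mk,
        AddHom.coe_mk, LinearEquiv.coe_coe]
      rw [mul_assoc, form_θ_mul, ha', h3, TensorProduct.map_smul_left, LinearMap.smul_apply,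
        map_smul, h4, r_leftDer, smul_eq_mul]
  exact LinearMap.congr_fun (LinearMap.congr_fun this x₁) x

/-! ### Canonical basis of `f` -/

/-- `𝒜 = ℤ[v, v⁻¹]`. -/
def laurentInt : Subalgebra ℤ K := Algebra.adjoin ℤ {v, v⁻¹}

/-- The integral form `_𝒜 f`, generated over `𝒜` by the divided powers `θ_i^{(n)}`. -/
def integralForm {I : Type} (C : CartanDatum I) : Subalgebra laurentInt (HalfAlg C) :=
  Algebra.adjoin laurentInt {x | ∃ (i : I) (n : ℕ), x = dp (θ C i) n}

/-- `c ∈ v⁻¹ 𝐀`, where `𝐀 = ℚ⟦v⁻¹⟧ ∩ ℚ(v)`. -/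
def VanishesAtInfinity (c : K) : Prop := c = 0 ∨ c.intDegree < 0

/-- Lusztig's signed basis `B ∪ (-B)`: the bar invariant elements `x` of the integral form with
`(x, x) ∈ 1 + v⁻¹ 𝐀`. -/
def signedBasis {I : Type} [DecidableEq I] (C : CartanDatum I) : Set (HalfAlg C) :=
  {x | x ∈ integralForm C ∧ bar C x = x ∧ VanishesAtInfinity (form C x x - 1)}

/-- The subspace `θ_i^n f`. -/
def powLeft {I : Type} (C : CartanDatum I) (i : I) (n : ℕ) : Set (HalfAlg C) :=
  {x | ∃ y, x = θ C i ^ n * y}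

/-- The subspace `f θ_i^n`. -/
def powRight {I : Type} (C : CartanDatum I) (i : I) (n : ℕ) : Set (HalfAlg C) :=
  {x | ∃ y, x = y * θ C i ^ n}

/-- Lusztig's canonical basis of `f`, which chooses the signs: `1` is canonical, and if `b` is
canonical with `b ∉ θ_i f` and `n > 0`, then so is the unique element
`b' = π_{i,n}(b)` of the signed basis with `b' ∈ θ_i^n f \ θ_i^{n+1} f` and
`θ_i^{(n)} b - b' ∈ θ_i^{n+1} f`. -/
inductive IsCanonical {I : Type} [DecidableEq I] (C : CartanDatum I) : HalfAlg C → Prop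
  | one : IsCanonical C 1
  | step (i : I) (n : ℕ) (b b' : HalfAlg C) (hn : 0 < n) (hb : IsCanonical C b)
      (hbi : b ∉ powLeft C i 1) (hb' : b' ∈ signedBasis C) (hin : b' ∈ powLeft C i n)
      (hnot : b' ∉ powLeft C i (n + 1)) (h : dp (θ C i) n * b - b' ∈ powLeft C i (n + 1)) :
      IsCanonical C b'

/-- The canonical basis `B` of `f`. -/
def canonicalBasis {I : Type} [DecidableEq I] (C : CartanDatum I) : Set (HalfAlg C) :=
  {b | IsCanonical C b}

/-- `B^σ_{i,n}`: the canonical basis elements in `f θ_i^n` and not in `f θ_i^{n+1}`. -/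
def sigmaStratum {I : Type} [DecidableEq I] (C : CartanDatum I) (i : I) (n : ℕ) :
    Set (HalfAlg C) :=
  (canonicalBasis C ∩ powRight C i n) \ (canonicalBasis C ∩ powRight C i (n + 1))

/-- `b` appears in `x`: in the expansion of `x` in the canonical basis, the coefficient of `b` is
not zero. -/
def Appears {I : Type} [DecidableEq I] (C : CartanDatum I) (b x : HalfAlg C) : Prop :=
  ∃ (hb : b ∈ canonicalBasis C) (c : canonicalBasis C →₀ K),
    Finsupp.linearCombination K (Subtype.val : canonicalBasis C → HalfAlg C) c = x ∧ c ⟨b, hb⟩ ≠ 0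

/-! ### Integrable highest weight modules -/

/-- The left ideal `∑_i f θ_i^{⟨i,λ⟩+1}`, for the dominant weight `λ` with `⟨i,λ⟩ = w i`. -/
def hwSubspace {I : Type} (C : CartanDatum I) (w : I → ℕ) : Submodule K (HalfAlg C) :=
  (Ideal.span (Set.range fun i => θ C i ^ (w i + 1))).restrictScalars K

/-- The integrable highest weight module `Λ_λ = f / ∑_i f θ_i^{⟨i,λ⟩+1}`. -/
abbrev HWModule {I : Type} (C : CartanDatum I) (w : I → ℕ) : Type :=
  HalfAlg C ⧸ hwSubspace C w

/-- The projection `π_λ : f → Λ_λ`, `x ↦ x⁻ η_λ`. -/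
def hwProj {I : Type} (C : CartanDatum I) (w : I → ℕ) : HalfAlg C →ₗ[K] HWModule C w :=
  (hwSubspace C w).mkQ

/-! ### Type `A₁` and its framing -/

/-- The framed Cartan datum on `I ⊔ I'`: `i · j' = -δ_{ij}` and `i' · j' = 2 δ_{ij}`. -/
def framed {I : Type} [DecidableEq I] (C : CartanDatum I) : CartanDatum (I ⊕ I) where
  form
    | .inl i, .inl j => C.form i j
    | .inl i, .inr j => if i = j then -1 else 0
    | .inr i, .inl j => if i = j then -1 else 0
    | .inr i, .inr j => if i = j then 2 else 0
  symm := by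
    rintro (i | i) (j | j)
    · exact C.symm i j
    · simp only [eq_comm]
    · simp only [eq_comm]
    · simp only [eq_comm]
  diag := by
    rintro (i | i)
    · exact C.diag i
    · simp
  offdiag := by
    rintro (i | i) (j | j) h
    · exact C.offdiag i j fun e => h (congrArg _ e)
    · by_cases e : i = j <;> simp [e]
    · by_cases e : i = j <;> simp [e]
    · have e : i ≠ j := fun e => h (congrArg _ e)
      simp [e]

/-- The Cartan datum of type `A₁`. -/
def A1 : CartanDatum Unit where
  form _ _ := 2
  symm _ _ := rfl
  diag _ := rfl
  offdiag _ _ h := absurd rfl h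

/-- The framed Cartan datum of `A₁`, of type `A₂`, on `{i, i'}` with `i = inl ()`, `i' = inr ()`. -/
def A2 : CartanDatum (Unit ⊕ Unit) := framed A1

/-- The generator `θ_i` of `f`. -/
def θ₁ : HalfAlg A1 := θ A1 ()

/-- The generator `θ_i` of the framed algebra. -/
def θi : HalfAlg A2 := θ A2 (Sum.inl ())

/-- The generator `θ_{i'}` of the framed algebra. -/
def θi' : HalfAlg A2 := θ A2 (Sum.inr ())

/-- The embedding of `f` in the framed algebra. -/
def incl : HalfAlg A1 →ₐ[K] HalfAlg A2 :=
  lift A1 (fun _ => θi) fun _ _ h => absurd rfl h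

/-- `θ_λ = θ_{i'}^{(n)}` for `λ = n`. -/
def θwt (n : ℕ) : HalfAlg A2 := dp θi' n

/-- The subspace `f θ_λ f` of the framed algebra, for `λ = n`. -/
def fθf (n : ℕ) : Submodule K (HalfAlg A2) :=
  Submodule.span K {z | ∃ x y : HalfAlg A1, z = incl x * θwt n * incl y}

theorem mem_fθf (n : ℕ) (x y : HalfAlg A1) : incl x * θwt n * incl y ∈ fθf n :=
  Submodule.subset_span ⟨x, y, rfl⟩

/-- The monomial `θ_i^{(a₁)} ⋯ θ_i^{(a_s)}` of `f` attached to a sequence `a₁, …, a_s`. -/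
def monomial (a : List ℕ) : HalfAlg A1 := (a.map (dp θ₁)).prod

/-- `B̃(f θ_λ f)`, for `λ = n`: the canonical basis elements of the framed algebra that appear in
some `θ_{ν₁} θ_λ θ_{ν₂}`. -/
def basisfθf (n : ℕ) : Set (HalfAlg A2) :=
  {b | ∃ a₁ a₂ : List ℕ, Appears A2 b (incl (monomial a₁) * θwt n * incl (monomial a₂))}

/-- `B̃(ξ, λ)`, for `ξ = m` and `λ = n`. -/
def framedBasis (m n : ℕ) : Set (HalfAlg A2) :=
  basisfθf n ∩ ⋃ t ∈ Set.Icc 0 m, sigmaStratum A2 (Sum.inl ()) t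

/-- `Λ_n`, for the dominant weight `n` of `A₁`. -/
abbrev L (n : ℕ) : Type := HWModule A1 fun _ => n

/-- The framed module with highest weight `m ⊙ n`, that is,
`⟨i, m ⊙ n⟩ = m` and `⟨i', m ⊙ n⟩ = n`. -/
abbrev framedL (m n : ℕ) : Type := HWModule A2 (Sum.elim (fun _ => m) fun _ => n)

/-- `Λ_{m,n}`, the image of `f θ_λ f` in the framed module. -/
def subL (m n : ℕ) : Submodule K (framedL m n) := (fθf n).map (hwProj A2 _)

/-- The projection `π_{m⊙n} : f θ_λ f → Λ_{m,n}`. -/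
def framedProj (m n : ℕ) : fθf n →ₗ[K] subL m n := (hwProj A2 _).submoduleMap (fθf n)

/-- The element `F^{(a)} η_n` of `Λ_n`. -/
def Fη (n a : ℕ) : L n := hwProj A1 _ (dp θ₁ a)

/-- `∑ v^{|x₂| · |θ_λ|} x₂⁻ y⁻ η_m ⊗ x₁⁻ η_n`, where `r(x) = ∑ x₁ ⊗ x₂` with homogeneous
`x₁, x₂`; here `i · |θ_λ| = i · n i' = -n`. -/
def framedFormula (m n : ℕ) (x y : HalfAlg A1) : L m ⊗[K] L n :=
  TensorProduct.map
    ((hwProj A1 fun _ => m).comp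
      ((LinearMap.mulRight K y).comp (scale A1 fun _ => v ^ (-(n : ℤ))).toLinearMap))
    (hwProj A1 fun _ => n)
    (TensorProduct.comm K (HalfAlg A1) (HalfAlg A1) (r A1 x))

/-- `φ` is the isomorphism `Λ_{m,n} → Λ_m ⊗ Λ_n` with
`φ(π(x θ_λ y)) = ∑ v^{|x₂| · |θ_λ|} x₂⁻ y⁻ η_m ⊗ x₁⁻ η_n` for all `x, y ∈ f`. -/
def IsFramedIso (m n : ℕ) (φ : subL m n ≃ₗ[K] L m ⊗[K] L n) : Prop :=
  ∀ x y : HalfAlg A1,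
    φ (framedProj m n ⟨incl x * θwt n * incl y, mem_fθf n x y⟩) = framedFormula m n x y

/-- `θ_{i'}^{(n-l)} θ_i^{(m-k+l)} θ_{i'}^{(l)}`, for `k ≤ m` and `l ≤ n`. -/
def elemA (m n k l : ℕ) : HalfAlg A2 := dp θi' (n - l) * dp θi (m - k + l) * dp θi' l

/-- `θ_i^{(l)} θ_{i'}^{(n)} θ_i^{(m-k)}`, for `k ≤ m`. -/
def elemB (m n k l : ℕ) : HalfAlg A2 := dp θi l * dp θi' n * dp θi (m - k)

/-- `α_{k,l}`, for `k ≤ m` and `l ≤ n`. -/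
def α (m n k l : ℕ) : L m ⊗[K] L n :=
  ∑ s ∈ Finset.range (min k l + 1),
    (v ^ ((s : ℤ) * (k - m - s)) * qBinom (n - l + s) s) •
      (Fη m (m - k + s) ⊗ₜ[K] Fη n (l - s))

/-- `β_{k,l}`, for `k ≤ m` and `l ≤ n`. -/
def β (m n k l : ℕ) : L m ⊗[K] L n :=
  ∑ s ∈ Finset.range (min k l + 1),
    (v ^ ((s : ℤ) * (l - n - s)) * qBinom (m - k + s) s) •
      (Fη m (m - k + s) ⊗ₜ[K] Fη n (l - s))

/-! ### Canonical basis of `Λ_m ⊗ Λ_n` -/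

/-- `x ↦ [n - 2 deg x] x` on `f`: the action of `(K_i - K_{-i}) / (v - v⁻¹)` on the Verma module
with highest weight `n`. -/
def vermaH (n : ℕ) : HalfAlg A1 →ₗ[K] HalfAlg A1 :=
  (v - v⁻¹)⁻¹ • (v ^ (n : ℤ) • (scale A1 fun _ => v ^ (-2 : ℤ)).toLinearMap -
    v ^ (-(n : ℤ)) • (scale A1 fun _ => v ^ (2 : ℤ)).toLinearMap)

/-- The map `(x, y) ↦ (θ x, θ y + [n - 2 deg x] x)` on `f × f`. -/
def vermaAux (n : ℕ) : Module.End K (HalfAlg A1 × HalfAlg A1) :=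
  LinearMap.prod ((LinearMap.mulLeft K θ₁).comp (LinearMap.fst K _ _))
    ((LinearMap.mulLeft K θ₁).comp (LinearMap.snd K _ _) +
      (vermaH n).comp (LinearMap.fst K _ _))

/-- The action of `E_i` on the Verma module `M_n = f`: it is determined by `E 1 = 0` and
`E (θ x) = θ (E x) + [n - 2 deg x] x`. -/
def vermaE (n : ℕ) : Module.End K (HalfAlg A1) :=
  (LinearMap.snd K (HalfAlg A1) (HalfAlg A1)).comp
    ((LinearMap.applyₗ (1, 0)).comp
      (lift A1 (fun _ => vermaAux n) fun _ _ h => absurd rfl h).toLinearMap)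

theorem vermaE_one (n : ℕ) : vermaE n 1 = 0 := by
  simp [vermaE]

theorem vermaE_θ_mul (n : ℕ) (x : HalfAlg A1) :
    vermaE n (θ₁ * x) = θ₁ * vermaE n x + vermaH n x := by
  have h : ∀ x, (lift A1 (fun _ => vermaAux n) (fun _ _ h => absurd rfl h) x (1, 0)).1 = x := by
    intro x
    have : (LinearMap.fst K (HalfAlg A1) (HalfAlg A1)).comp
        ((LinearMap.applyₗ (1, 0)).comp
          (lift A1 (fun _ => vermaAux n) fun _ _ h => absurd rfl h).toLinearMap) =
        LinearMap.id := by
      refine linearMap_ext A1 _ _ (by simp) fun i x hx => ?_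
      simp only [LinearMap.comp_apply, AlgHom.toLinearMap_apply, LinearMap.applyₗ_apply_apply,
        LinearMap.fst_apply, LinearMap.id_apply, map_mul, lift_θ, Module.End.mul_apply] at hx ⊢
      exact congrArg (θ₁ * ·) hx
    exact LinearMap.congr_fun this x
  have hθ : lift A1 (fun _ => vermaAux n) (fun _ _ h => absurd rfl h) θ₁ = vermaAux n :=
    lift_θ _ _ _ _
  simp only [vermaE, LinearMap.comp_apply, AlgHom.toLinearMap_apply,
    LinearMap.applyₗ_apply_apply, LinearMap.snd_apply, map_mul, Module.End.mul_apply, hθ]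
  refine Eq.trans rfl (congrArg (fun z => θ₁ * _ + vermaH n z) (h x))

theorem vermaH_pow (n k : ℕ) : vermaH n (θ₁ ^ k) = qInt (n - 2 * k) • θ₁ ^ k := by
  have h : ∀ c : K, scale A1 (fun _ => c) (θ₁ ^ k) = c ^ k • θ₁ ^ k := by
    intro c
    rw [map_pow, θ₁, scale_θ, smul_pow]
  have hv := v_ne_zero
  simp only [vermaH, LinearMap.smul_apply, LinearMap.sub_apply, AlgHom.toLinearMap_apply, h,
    smul_smul, ← sub_smul]
  congr 1
  rw [qInt, div_eq_inv_mul, ← zpow_natCast, ← zpow_natCast, ← zpow_mul, ← zpow_mul,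
    ← zpow_add₀ hv, ← zpow_add₀ hv]
  ring_nf

theorem vermaE_pow (n k : ℕ) :
    vermaE n (θ₁ ^ (k + 1)) = (∑ j ∈ Finset.range (k + 1), qInt (n - 2 * j)) • θ₁ ^ k := by
  induction k with
  | zero =>
    rw [zero_add, pow_one, ← mul_one θ₁, vermaE_θ_mul, vermaE_one]
    have := vermaH_pow n 0
    simpa using this
  | succ k ih =>
    rw [pow_succ' θ₁ (k + 1), vermaE_θ_mul, ih, vermaH_pow, mul_smul_comm, ← pow_succ',
      Finset.sum_range_succ _ (k + 1), add_smul]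

theorem vermaE_pow_top (n : ℕ) : vermaE n (θ₁ ^ (n + 1)) = 0 := by
  rw [vermaE_pow]
  have hneg : ∀ a : ℤ, qInt (-a) = -qInt a := by
    intro a
    simp only [qInt, neg_neg]
    rw [← neg_sub, neg_div]
  have h : (∑ j ∈ Finset.range (n + 1), qInt (n - 2 * j)) =
      -∑ j ∈ Finset.range (n + 1), qInt (n - 2 * j) := by
    conv_lhs => rw [← Finset.sum_range_reflect]
    rw [← Finset.sum_neg_distrib]
    refine Finset.sum_congr rfl fun j hj => ?_
    have hj' : j ≤ n := Nat.lt_succ_iff.mp (Finset.mem_range.mp hj)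
    rw [← hneg]
    congr 1
    rw [Nat.add_sub_cancel, Nat.cast_sub hj']
    ring
  rw [self_eq_neg.mp h, zero_smul]

theorem hwSubspace_A1 (n : ℕ) (x : HalfAlg A1) :
    x ∈ hwSubspace A1 (fun _ => n) ↔ ∃ a, a * θ₁ ^ (n + 1) = x := by
  rw [hwSubspace, Submodule.restrictScalars_mem]
  have : Set.range (fun i : Unit => θ A1 i ^ (n + 1)) = {θ₁ ^ (n + 1)} := by
    ext z
    exact ⟨fun ⟨_, h⟩ => h.symm, fun h => ⟨(), h.symm⟩⟩
  rw [this]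
  exact Ideal.mem_span_singleton'

theorem scale_mem_hwSubspace (n : ℕ) (c : K) (x : HalfAlg A1)
    (hx : x ∈ hwSubspace A1 fun _ => n) :
    scale A1 (fun _ => c) x ∈ hwSubspace A1 fun _ => n := by
  obtain ⟨a, rfl⟩ := (hwSubspace_A1 n _).mp hx
  refine (hwSubspace_A1 n _).mpr ⟨c ^ (n + 1) • scale A1 (fun _ => c) a, ?_⟩
  rw [map_mul, map_pow, θ₁, scale_θ, smul_pow, mul_smul_comm, smul_mul_assoc]

theorem mul_mem_hwSubspace {I : Type} (C : CartanDatum I) (w : I → ℕ) (a x : HalfAlg C)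
    (hx : x ∈ hwSubspace C w) : a * x ∈ hwSubspace C w :=
  Ideal.mul_mem_left _ a hx

theorem vermaE_mem (n : ℕ) :
    hwSubspace A1 (fun _ => n) ≤ (hwSubspace A1 fun _ => n).comap (vermaE n) := by
  intro x hx
  obtain ⟨a, rfl⟩ := (hwSubspace_A1 n _).mp hx
  have hS := submodule_eq_top A1
    (((hwSubspace A1 fun _ => n).comap (vermaE n)).comap (LinearMap.mulRight K (θ₁ ^ (n + 1))))
    (by simp [vermaE_pow_top]) (by
      intro _ y hy
      simp only [Submodule.mem_comap, LinearMap.mulRight_apply] at hy ⊢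
      rw [mul_assoc]
      change vermaE n (θ₁ * (y * θ₁ ^ (n + 1))) ∈ _
      rw [vermaE_θ_mul]
      have h : y * θ₁ ^ (n + 1) ∈ hwSubspace A1 fun _ => n := (hwSubspace_A1 n _).mpr ⟨y, rfl⟩
      refine Submodule.add_mem _ (mul_mem_hwSubspace _ _ _ _ hy) ?_
      simp only [vermaH, LinearMap.smul_apply, LinearMap.sub_apply, AlgHom.toLinearMap_apply]
      exact Submodule.smul_mem _ _ (Submodule.sub_mem _
        (Submodule.smul_mem _ _ (scale_mem_hwSubspace n _ _ h))
        (Submodule.smul_mem _ _ (scale_mem_hwSubspace n _ _ h))))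
  have : a ∈ (⊤ : Submodule K (HalfAlg A1)) := trivial
  rw [← hS] at this
  exact this

/-- The action of `E_i` on `Λ_n`. -/
def actE (n : ℕ) : Module.End K (L n) :=
  (hwSubspace A1 fun _ => n).mapQ (hwSubspace A1 fun _ => n) (vermaE n) (vermaE_mem n)

/-- The action of `F_i` on `Λ_n`. -/
def actF (n : ℕ) : Module.End K (L n) :=
  (hwSubspace A1 fun _ => n).mapQ (hwSubspace A1 fun _ => n) (LinearMap.mulLeft K θ₁)
    fun x hx => mul_mem_hwSubspace _ _ _ x hx

/-- The bar involution of `f` as a semilinear map. -/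
def barLin {I : Type} (C : CartanDatum I) : HalfAlg C →ₛₗ[barK] HalfAlg C where
  toFun := bar C
  map_add' := map_add _
  map_smul' := bar_smul C

/-- The bar involution of `Λ_n`, `x⁻ η_n ↦ (bar x)⁻ η_n`. -/
def barL (n : ℕ) : L n →ₛₗ[barK] L n :=
  (hwSubspace A1 fun _ => n).mapQ (hwSubspace A1 fun _ => n) (barLin A1) fun x hx => by
    obtain ⟨a, rfl⟩ := (hwSubspace_A1 n _).mp hx
    refine (hwSubspace_A1 n _).mpr ⟨bar A1 a, ?_⟩
    change _ = bar A1 _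
    rw [map_mul, map_pow, θ₁, bar_θ]

/-- The quasi-`ℛ`-matrix `Θ = ∑_k (-v)^k b_k⁻ ⊗ (b_k^*)⁺` on `Λ_m ⊗ Λ_n`, where
`b_k = θ_i^{(k)}` is the canonical basis of the component of degree `k` of `f` and
`b_k^* = (b_k, b_k)⁻¹ b_k` is its dual basis. The terms with `k > n` act by `0`. -/
def quasiR (m n : ℕ) : Module.End K (L m ⊗[K] L n) :=
  ∑ k ∈ Finset.range (n + 1),
    ((-v) ^ k * (form A1 (dp θ₁ k) (dp θ₁ k))⁻¹) •
      TensorProduct.map (dp (actF m) k) (dp (actE n) k)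

/-- The involution `Ψ(z) = Θ(bar z)` of `Λ_m ⊗ Λ_n`, where `bar (x ⊗ y) = bar x ⊗ bar y`. -/
def Ψ (m n : ℕ) (z : L m ⊗[K] L n) : L m ⊗[K] L n :=
  quasiR m n (TensorProduct.map (barL m) (barL n) z)

/-- The ring `ℤ[v⁻¹]`. -/
def intVInv : Subalgebra ℤ K := Algebra.adjoin ℤ {v⁻¹}

/-- The `ℤ[v⁻¹]`-lattice spanned by the tensor products of canonical basis elements
`F^{(a)} η_m ⊗ F^{(b)} η_n`, `0 ≤ a ≤ m`, `0 ≤ b ≤ n`. -/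
def lattice (m n : ℕ) : Submodule intVInv (L m ⊗[K] L n) :=
  Submodule.span intVInv {z | ∃ a b : ℕ, a ≤ m ∧ b ≤ n ∧ z = Fη m a ⊗ₜ[K] Fη n b}

/-- Lusztig's canonical basis of `Λ_m ⊗ Λ_n`: the `Ψ`-invariant elements `z` of the lattice that
are congruent modulo `v⁻¹` times the lattice to some `F^{(a)} η_m ⊗ F^{(b)} η_n`. -/
def tensorCanonicalBasis (m n : ℕ) : Set (L m ⊗[K] L n) :=
  {z | z ∈ lattice m n ∧ Ψ m n z = z ∧
    ∃ a b : ℕ, a ≤ m ∧ b ≤ n ∧ ∃ w ∈ lattice m n, z - Fη m a ⊗ₜ[K] Fη n b = v⁻¹ • w}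

end

end FramedTensor

open FramedTensor
open scoped TensorProduct

open scoped TensorProduct
namespace FramedTensor
noncomputable section

/-! ### Quantum factorials and Gaussian binomial coefficients -/

/-! Write x = θ_i, y = θ_{i'} and T = yx - v⁻¹xy. The Serre relations say that T commutes with x and
y up to a power of v, so products of divided powers can be straightened into the PBW monomials
x^{(a)} T^{(b)} y^{(c)}. The derivations adjoint to multiplication show that these monomials are
orthogonal for Lusztig's form, with norms in 1 + v⁻¹𝐀 (`form_pbw`); hence they form a basis.

Both y^{(b)} x^{(a+b)} y^{(c)} and x^{(a)} y^{(b+c)} x^{(b)} have leading PBW term (a, b, c). Their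
other terms sit at (a+u, b-u, c+u), with coefficient v^{-(a+u)u} times the Gaussian binomial of u +
c over u, respectively v^{-(c+u)u} times that of a + u over u. The top power of v in the Gaussian
binomial of p + q over p is v^{pq}. So the corrections lie in v⁻¹ℤ[v⁻¹] for the first family when c
≤ a, and for the second when a ≤ c; for a = c the two expansions coincide. Products of divided
powers are bar invariant and integral, so the elements `can (a, b, c)` belong to the signed basis.
Conversely, almost orthonormality makes an element of the signed basis congruent to ± one PBW
monomial, and a bar invariant vector whose coordinates all lie in v⁻¹ℤ[v⁻¹] is zero
(`IsUnitriangular.eq_zero_of_bar_invariant`). So the signed basis consists of the ± `can p`, and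
following the inductive choice of signs fixes the sign + (`canonicalBasis_A2`).

Exchanging the two generators turns the monomials of the theorem into these. The space fθ_nf is the
whole part of θ_{i'}-degree n, spanned by the swapped PBW monomials with a + b = n, and the exponent
c is the exact power of θ_i dividing on the right. This gives part 1 with a = n - l, b = l, c = m -
k.

For part 2, let `Φ` send the swapped PBW monomial (a, b, c) with a + b = n to F^{(c)}η_m ⊗
F^{(b)}η_n. Left multiplication by θ_i becomes 1 ⊗ F + F ⊗ K⁻¹, which is also the recursion
satisfied by the prescribed formula, so `Φ` induces the required isomorphism. The PBW expansions of
the monomials become the sums α and β.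

For part 3, the quasi-ℛ-matrix intertwines 1 ⊗ F + F ⊗ K⁻¹ with its bar conjugate
(`quasiR_intertwines`), so `Φ` carries bar to Ψ on fθ_nf (`Φ_bar`). The images of the framed basis
are then Ψ-invariant and congruent to the F^{(a)}η_m ⊗ F^{(b)}η_n modulo v⁻¹ℒ. The uniqueness
argument used for the signed basis shows that nothing else is. -/

theorem v_zpow_ne_one {k : ℤ} (hk : k ≠ 0) : v ^ k ≠ 1 := by
  intro h
  have hd : ∀ j : ℤ, (v ^ j : K).intDegree = j := by
    have hn : ∀ j : ℕ, (v ^ j : K).intDegree = j := by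
      intro j
      induction j with
      | zero => simp
      | succ j ih =>
        rw [pow_succ, RatFunc.intDegree_mul (pow_ne_zero _ v_ne_zero) v_ne_zero, ih, v,
          RatFunc.intDegree_X]
        push_cast; rfl
    intro j
    obtain ⟨j, rfl | rfl⟩ := j.eq_nat_or_neg
    · simpa using hn j
    · rw [zpow_neg, RatFunc.intDegree_inv, zpow_natCast, hn]
  have := hd k
  rw [h, RatFunc.intDegree_one] at this
  exact hk this.symm

theorem v_zpow_sub_ne_zero {k : ℤ} (hk : k ≠ 0) : v ^ k - v ^ (-k) ≠ 0 := by
  intro h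
  refine v_zpow_ne_one (k := 2 * k) (by omega) ?_
  rw [two_mul, zpow_add₀ v_ne_zero]
  nth_rewrite 1 [sub_eq_zero.mp h]
  rw [← zpow_add₀ v_ne_zero]
  simp

theorem qInt_mul_sub (k : ℤ) : qInt k * (v - v⁻¹) = v ^ k - v ^ (-k) :=
  div_mul_cancel₀ _ v_sub_inv_ne_zero

theorem qInt_ne_zero {k : ℤ} (hk : k ≠ 0) : qInt k ≠ 0 :=
  div_ne_zero (v_zpow_sub_ne_zero hk) v_sub_inv_ne_zero

theorem qInt_zero : qInt 0 = 0 := by simp [qInt]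

/-- After clearing v - v⁻¹ the two cross terms v^{b-a} cancel. Nearly every coefficient identity
below is an instance of this one. -/
theorem qInt_add (a b : ℤ) : qInt (a + b) = v ^ b * qInt a + v ^ (-a) * qInt b := by
  have h := v_sub_inv_ne_zero
  have hv := v_ne_zero
  rw [← mul_left_inj' h, add_mul, mul_assoc, mul_assoc, qInt_mul_sub, qInt_mul_sub, qInt_mul_sub,
    neg_add, zpow_add₀ hv, zpow_add₀ hv]
  ring

theorem qFact_succ (m : ℕ) : qFact (m + 1) = qFact m * qInt (m + 1) := by
  rw [qFact, Finset.prod_Icc_succ_top (by omega), ← qFact]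
  push_cast; rfl

theorem qInt_succ_ne_zero (m : ℕ) : qInt ((m : ℤ) + 1) ≠ 0 := qInt_ne_zero (by omega)

theorem qFact_ne_zero (m : ℕ) : qFact m ≠ 0 := by
  induction m with
  | zero => simp [qFact_zero]
  | succ m ih => rw [qFact_succ]; exact mul_ne_zero ih (qInt_succ_ne_zero m)

/-- The Gaussian binomial coefficient `[a+b]! / ([a]! [b]!)`. -/
def gauss (a b : ℕ) : K := qFact (a + b) / (qFact a * qFact b)

theorem gauss_zero_left (b : ℕ) : gauss 0 b = 1 := by
  simp [gauss, qFact_zero, div_self (qFact_ne_zero b)]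

theorem gauss_comm (a b : ℕ) : gauss a b = gauss b a := by
  rw [gauss, gauss, add_comm, mul_comm (qFact a)]

theorem gauss_zero_right (a : ℕ) : gauss a 0 = 1 := by rw [gauss_comm, gauss_zero_left]

/-- The q-Pascal rule: split the top quantum integer [(a+1) + (b+1)] with `qInt_add`. -/
theorem gauss_succ_succ (a b : ℕ) :
    gauss (a + 1) (b + 1) =
      v ^ ((b : ℤ) + 1) * gauss a (b + 1) + v ^ (-((a : ℤ) + 1)) * gauss (a + 1) b := by
  have ha := qFact_ne_zero a
  have hb := qFact_ne_zero b
  have ha' := qInt_succ_ne_zero a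
  have hb' := qInt_succ_ne_zero b
  have h := qInt_add ((a : ℤ) + 1) ((b : ℤ) + 1)
  have e1 : a + 1 + (b + 1) = (a + b + 1) + 1 := by ring
  have e2 : a + (b + 1) = a + b + 1 := by ring
  have e3 : a + 1 + b = a + b + 1 := by ring
  have e4 : (((a + b + 1 : ℕ) : ℤ) + 1) = (a : ℤ) + 1 + (b + 1) := by push_cast; ring
  rw [gauss, gauss, gauss, e1, e2, e3, qFact_succ (a + b + 1), e4, h, qFact_succ a, qFact_succ b]
  field_simp

theorem qBinom_eq_gauss (a b : ℕ) : qBinom ((a : ℤ) + b) b = gauss a b := by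
  have hs := v_sub_inv_ne_zero
  have h1 : ∀ b : ℕ, (∏ k ∈ Finset.Icc 1 b, (v ^ (k : ℤ) - v ^ (-(k : ℤ)))) =
      qFact b * (v - v⁻¹) ^ b := by
    intro b
    simp only [← qInt_mul_sub, Finset.prod_mul_distrib, qFact]
    simp
  have h2 : ∀ b : ℕ, (∏ k ∈ Finset.range b,
      (v ^ ((a : ℤ) + b - k) - v ^ (-((a : ℤ) + b) + k))) * qFact a =
      qFact (a + b) * (v - v⁻¹) ^ b := by
    intro b
    induction b with
    | zero => simp
    | succ b ih =>
      have e1 : ((a : ℤ) + ((b + 1 : ℕ) : ℤ) - ((0 : ℕ) : ℤ)) = ((a + b : ℕ) : ℤ) + 1 := by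
        push_cast; ring
      have e2 : (-((a : ℤ) + ((b + 1 : ℕ) : ℤ)) + ((0 : ℕ) : ℤ)) = -(((a + b : ℕ) : ℤ) + 1) := by
        push_cast; ring
      have e3 : ∀ k : ℕ, ((a : ℤ) + ((b + 1 : ℕ) : ℤ) - ((k + 1 : ℕ) : ℤ)) = (a : ℤ) + b - k := by
        intro k; push_cast; ring
      have e4 : ∀ k : ℕ, (-((a : ℤ) + ((b + 1 : ℕ) : ℤ)) + ((k + 1 : ℕ) : ℤ)) =
          -((a : ℤ) + b) + k := by
        intro k; push_cast; ring
      -- The factor k = 0 is split off; shifting the remaining indices by one gives the numerator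
      -- for b.
      rw [Finset.prod_range_succ', e1, e2, ← qInt_mul_sub, ← add_assoc, qFact_succ, pow_succ]
      simp only [e3, e4]
      rw [mul_right_comm, ih]
      ring
  rw [qBinom, h1, gauss, div_eq_div_iff (mul_ne_zero (qFact_ne_zero b) (pow_ne_zero _ hs))
    (mul_ne_zero (qFact_ne_zero a) (qFact_ne_zero b)), ← mul_assoc, h2]
  ring

/-! ### Integrality and degree bounds for Gaussian binomials -/

theorem v_inv_mem_intVInv : v⁻¹ ∈ intVInv := Algebra.subset_adjoin rfl

theorem v_zpow_mem_intVInv {k : ℤ} (hk : k ≤ 0) : v ^ k ∈ intVInv := by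
  obtain ⟨j, rfl⟩ : ∃ j : ℕ, k = -j := ⟨k.natAbs, by omega⟩
  rw [zpow_neg, zpow_natCast, ← inv_pow]
  exact pow_mem v_inv_mem_intVInv j

theorem v_zpow_mem_laurentInt (k : ℤ) : v ^ k ∈ laurentInt := by
  obtain ⟨j, rfl | rfl⟩ := k.eq_nat_or_neg
  · rw [zpow_natCast]
    exact pow_mem (Algebra.subset_adjoin (by simp)) j
  · rw [zpow_neg, zpow_natCast, ← inv_pow]
    exact pow_mem (Algebra.subset_adjoin (by simp)) j

theorem intVInv_le_laurentInt : intVInv ≤ laurentInt :=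
  Algebra.adjoin_mono (by simp)

/-- The top power of v in the Gaussian binomial is v^{ab}. After division by it, the q-Pascal rule
has coefficients 1 and v^{-2(a+1)}, so the bound passes through the double induction. -/
theorem gauss_mem_intVInv (a b : ℕ) : v ^ (-((a : ℤ) * b)) * gauss a b ∈ intVInv := by
  have hv := v_ne_zero
  induction a generalizing b with
  | zero => simp [gauss_zero_left, one_mem]
  | succ a iha =>
    induction b with
    | zero => simp [gauss_zero_right, one_mem]
    | succ b ihb =>
      have : v ^ (-(((a + 1 : ℕ) : ℤ) * ((b + 1 : ℕ) : ℤ))) * gauss (a + 1) (b + 1) =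
          v ^ (-((a : ℤ) * ((b + 1 : ℕ) : ℤ))) * gauss a (b + 1) +
          v ^ (-2 * ((a : ℤ) + 1)) * (v ^ (-(((a + 1 : ℕ) : ℤ) * b)) * gauss (a + 1) b) := by
        rw [gauss_succ_succ, mul_add, ← mul_assoc, ← mul_assoc, ← mul_assoc, ← zpow_add₀ hv,
          ← zpow_add₀ hv, ← zpow_add₀ hv]
        congr 3 <;> push_cast <;> ring_nf
      rw [this]
      exact add_mem (iha _) (mul_mem (v_zpow_mem_intVInv (by omega)) ihb)

theorem gauss_mem_laurentInt (a b : ℕ) : gauss a b ∈ laurentInt := by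
  have := mul_mem (v_zpow_mem_laurentInt (a * b)) (intVInv_le_laurentInt (gauss_mem_intVInv a b))
  rwa [← mul_assoc, ← zpow_add₀ v_ne_zero, add_neg_cancel, zpow_zero, one_mul] at this

/-- The subgroup `v⁻¹ ℤ[v⁻¹]`. -/
def vInvIdeal : Submodule intVInv K where
  carrier := {c | ∃ w ∈ intVInv, c = v⁻¹ * w}
  zero_mem' := ⟨0, zero_mem _, by simp⟩
  add_mem' := by
    rintro _ _ ⟨a, ha, rfl⟩ ⟨b, hb, rfl⟩
    exact ⟨a + b, add_mem ha hb, by ring⟩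
  smul_mem' := by
    rintro ⟨c, hc⟩ _ ⟨a, ha, rfl⟩
    exact ⟨c * a, mul_mem hc ha, by rw [Subalgebra.smul_def, smul_eq_mul]; ring⟩

/-- The inequality is strict, so one factor v⁻¹ can be set aside after the top power v^{ab} has been
compensated. -/
theorem v_zpow_mul_gauss_mem {k : ℤ} (a b : ℕ) (hk : k < -((a : ℤ) * b)) :
    v ^ k * gauss a b ∈ vInvIdeal := by
  refine ⟨_, mul_mem (v_zpow_mem_intVInv (k := k + 1 + a * b) (by omega))
    (gauss_mem_intVInv a b), ?_⟩
  rw [← mul_assoc, ← mul_assoc, ← zpow_neg_one, ← zpow_add₀ v_ne_zero, ← zpow_add₀ v_ne_zero]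
  ring_nf

/-! ### Divided powers -/

section DividedPowers

variable {A : Type*} [Ring A] [Algebra K A]

theorem mul_dp (x : A) (n : ℕ) : x * dp x n = qInt (n + 1) • dp x (n + 1) := by
  have h := qFact_ne_zero n
  have h' := qInt_succ_ne_zero n
  rw [dp, dp, mul_smul_comm, ← pow_succ', smul_smul, qFact_succ]
  congr 1
  field_simp

theorem dp_mul_self (x : A) (n : ℕ) : dp x n * x = qInt (n + 1) • dp x (n + 1) := by
  rw [← mul_dp, dp, mul_smul_comm, smul_mul_assoc, ← pow_succ, ← pow_succ']

theorem dp_succ (x : A) (n : ℕ) : dp x (n + 1) = (qInt (n + 1))⁻¹ • (x * dp x n) := by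
  rw [mul_dp, smul_smul, inv_mul_cancel₀ (qInt_succ_ne_zero n), one_smul]

theorem pow_eq_dp (x : A) (n : ℕ) : x ^ n = qFact n • dp x n := by
  rw [dp, smul_smul, mul_inv_cancel₀ (qFact_ne_zero n), one_smul]

theorem dp_mul_dp (x : A) (a b : ℕ) : dp x a * dp x b = gauss a b • dp x (a + b) := by
  have ha := qFact_ne_zero a
  have hb := qFact_ne_zero b
  have hab := qFact_ne_zero (a + b)
  rw [dp, dp, dp, smul_mul_smul_comm, ← pow_add, smul_smul, gauss]
  congr 1
  field_simp

theorem mul_dp_comm {x y : A} {q : K} (h : y * x = q • (x * y)) (n : ℕ) :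
    y * dp x n = q ^ n • (dp x n * y) := by
  induction n with
  | zero => simp [dp_zero]
  | succ n ih =>
    rw [dp_succ, mul_smul_comm, ← mul_assoc, h, smul_mul_assoc, mul_assoc, ih, mul_smul_comm,
      smul_mul_assoc, mul_assoc]
    simp only [smul_smul]
    congr 1
    ring

/-- Elements `x, T, y` with the commutation relations of the root vectors of type `A₂`. -/
structure RootTriple (x T y : A) : Prop where
  yx : y * x = v⁻¹ • (x * y) + T
  Tx : T * x = v • (x * T)
  yT : y * T = v • (T * y)

/-- Move y through one factor x at a time; each passage leaves a T, which is carried to the right of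
the remaining x's at the cost of powers of v. -/
theorem RootTriple.mul_dp {x T y : A} (h : RootTriple x T y) (a : ℕ) :
    y * dp x (a + 1) = v ^ (-((a : ℤ) + 1)) • (dp x (a + 1) * y) + dp x a * T := by
  have hv := v_ne_zero
  induction a with
  | zero => simp [dp_zero, dp_one, h.yx]
  | succ a ih =>
    have hq := qInt_succ_ne_zero (a + 1)
    have hT : T * dp x (a + 1) = v ^ (a + 1) • (dp x (a + 1) * T) := mul_dp_comm h.Tx _
    -- The T-terms come from two sources: v⁻¹[a+1] from the induction hypothesis, and v^{a+1} from
    -- moving the newly created T across x^{(a+1)}. They add up to [a+2].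
    have hk : v⁻¹ * qInt ((a : ℤ) + 1) + v ^ (a + 1) = qInt (((a + 1 : ℕ) : ℤ) + 1) := by
      have := qInt_add 1 ((a : ℤ) + 1)
      rw [qInt_one, mul_one, zpow_neg_one, add_comm (1 : ℤ)] at this
      push_cast
      rw [this, add_comm]
      norm_cast
    refine (smul_right_inj hq).mp ?_
    rw [← mul_smul_comm, ← FramedTensor.mul_dp, ← mul_assoc, h.yx, add_mul, smul_mul_assoc, mul_assoc, ih, hT,
      mul_add, ← mul_assoc x (dp x a), FramedTensor.mul_dp x a, mul_smul_comm, ← mul_assoc,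
      FramedTensor.mul_dp x (a + 1), ← hk]
    simp only [smul_add, smul_mul_assoc, smul_smul, hk]
    have e : v ^ (-(((a + 1 : ℕ) : ℤ) + 1)) = v⁻¹ * v ^ (-((a : ℤ) + 1)) := by
      rw [← zpow_neg_one, ← zpow_add₀ hv]; congr 1; push_cast; ring
    rw [e, add_assoc, ← add_smul, hk]
    congr 2
    ring

/-- The straightening of `y^{(n)} x^{(a)}`. -/
theorem RootTriple.dp_mul_dp {x T y : A} (h : RootTriple x T y) (n a : ℕ) :
    dp y n * dp x a = ∑ t ∈ Finset.range (n + 1), if t ≤ a then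
      v ^ (-(((a : ℤ) - t) * ((n : ℤ) - t))) • (dp x (a - t) * dp T t * dp y (n - t)) else 0 := by
  have hv := v_ne_zero
  induction n with
  | zero => simp [dp_zero]
  | succ n ih =>
    refine (smul_right_inj (qInt_succ_ne_zero n)).mp ?_
    rw [← smul_mul_assoc, ← FramedTensor.mul_dp, mul_assoc, ih, Finset.mul_sum, Finset.smul_sum]
    -- Multiplying the t-th term by y either lets y reach the right end, which keeps t and is `g t`,
    -- or creates one more T, which is `f (t + 1)`. On the other side [n+1] splits as v^t[n+1-t] +
    -- v^{-(n+1-t)}[t], the coefficients in `g t` and `f t`. The sums agree because `g (n + 1)` and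
    -- `f 0` contain the factor [0]. The test t ≤ a excludes the terms where the natural subtraction
    -- a - t would be truncated.
    let g : ℕ → A := fun t => if t ≤ a then
      (v ^ (-(((a : ℤ) - t) * ((n : ℤ) + 1 - t))) * (v ^ (t : ℤ) * qInt ((n : ℤ) + 1 - t))) •
        (dp x (a - t) * dp T t * dp y (n + 1 - t)) else 0
    let f : ℕ → A := fun t => if t ≤ a then
      (v ^ (-(((a : ℤ) - t) * ((n : ℤ) + 1 - t))) * (v ^ (-((n : ℤ) + 1 - t)) * qInt t)) •
        (dp x (a - t) * dp T t * dp y (n + 1 - t)) else 0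
    have hR : ∀ t ∈ Finset.range (n + 1 + 1), (qInt ((n : ℤ) + 1) • if t ≤ a then
        v ^ (-(((a : ℤ) - t) * (((n + 1 : ℕ) : ℤ) - t))) •
          (dp x (a - t) * dp T t * dp y (n + 1 - t)) else 0) = g t + f t := by
      intro t _
      simp only [g, f]
      split_ifs with hta
      · rw [smul_smul, ← add_smul]
        congr 1
        have := qInt_add ((n : ℤ) + 1 - t) t
        rw [sub_add_cancel] at this
        rw [this]
        push_cast
        ring
      · simp
    have hL : ∀ t ∈ Finset.range (n + 1), (y * if t ≤ a then
        v ^ (-(((a : ℤ) - t) * ((n : ℤ) - t))) • (dp x (a - t) * dp T t * dp y (n - t)) else 0) =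
        g t + f (t + 1) := by
      intro t ht
      have htn : t ≤ n := Nat.lt_succ_iff.mp (Finset.mem_range.mp ht)
      have hyT : y * dp T t = v ^ t • (dp T t * y) := mul_dp_comm h.yT t
      have en : n + 1 - t = (n - t) + 1 := by omega
      have en' : n + 1 - (t + 1) = n - t := by omega
      have eq1 : qInt ((n : ℤ) + 1 - t) = qInt (((n - t : ℕ) : ℤ) + 1) := by
        congr 1; push_cast [htn]; ring
      simp only [g, f]
      rw [en, en', eq1]
      rcases lt_trichotomy t a with hta | rfl | hta
      · obtain ⟨d, rfl⟩ : ∃ d, a = t + 1 + d := ⟨a - t - 1, by omega⟩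
        rw [if_pos (by omega), if_pos (by omega), if_pos (by omega),
          show t + 1 + d - t = d + 1 by omega, show t + 1 + d - (t + 1) = d by omega,
          mul_smul_comm, ← mul_assoc, ← mul_assoc, h.mul_dp d, add_mul, add_mul, smul_mul_assoc,
          mul_assoc _ y, hyT, smul_mul_assoc, mul_smul_comm, smul_mul_assoc, ← mul_assoc,
          mul_assoc _ y (dp y _), FramedTensor.mul_dp y, mul_assoc _ T (dp T t),
          FramedTensor.mul_dp T t, mul_smul_comm, mul_smul_comm, smul_mul_assoc]
        simp only [smul_add, smul_smul]
        congr 2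
        · rw [← mul_assoc, ← mul_assoc, ← zpow_natCast, ← zpow_add₀ hv, ← zpow_add₀ hv,
            ← mul_assoc, ← zpow_add₀ hv]
          congr 2; push_cast; ring
        · push_cast
          rw [← mul_assoc, ← zpow_add₀ hv]
          congr 2; ring
      · rw [if_pos le_rfl, if_pos le_rfl, if_neg (by omega), Nat.sub_self, dp_zero, one_mul,
          sub_self, zero_mul, zero_mul, neg_zero, zpow_zero, one_smul, add_zero, ← mul_assoc,
          hyT, smul_mul_assoc, mul_assoc, FramedTensor.mul_dp, mul_smul_comm, smul_smul, one_mul,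
          zpow_natCast]
      · rw [if_neg (by omega), if_neg (by omega), if_neg (by omega)]
        simp
    rw [Finset.sum_congr rfl hL, Finset.sum_congr rfl hR, Finset.sum_add_distrib,
      Finset.sum_add_distrib, Finset.sum_range_succ g (n + 1), Finset.sum_range_succ' f (n + 1)]
    have h1 : g (n + 1) = 0 := by simp [g, qInt_zero]
    have h2 : f 0 = 0 := by simp [f, qInt_zero]
    rw [h1, h2, add_zero, add_zero]

/-- Reindexing by u = b - t measures the distance from the term with the highest power of T, which
is the leading term. -/
theorem RootTriple.dp_mul_dp_of_ge {x T y : A} (h : RootTriple x T y) (a b : ℕ) :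
    dp y b * dp x (a + b) = ∑ u ∈ Finset.range (b + 1),
      v ^ (-(((a : ℤ) + u) * u)) • (dp x (a + u) * dp T (b - u) * dp y u) := by
  rw [h.dp_mul_dp, ← Finset.sum_range_reflect]
  refine Finset.sum_congr rfl fun u hu => ?_
  have hub : u ≤ b := Nat.lt_succ_iff.mp (Finset.mem_range.mp hu)
  rw [if_pos (by omega), show b + 1 - 1 - u = b - u by omega,
    show a + b - (b - u) = a + u by omega, show b - (b - u) = u by omega]
  push_cast [hub]
  ring_nf

/-- The same reindexing when y has the larger exponent; the c terms with t > b are absent. -/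
theorem RootTriple.dp_mul_dp_of_le {x T y : A} (h : RootTriple x T y) (b c : ℕ) :
    dp y (b + c) * dp x b = ∑ u ∈ Finset.range (b + 1),
      v ^ (-(((c : ℤ) + u) * u)) • (dp x u * dp T (b - u) * dp y (c + u)) := by
  rw [h.dp_mul_dp, show b + c + 1 = b + 1 + c by ring, Finset.sum_range_add, ← Finset.sum_range_reflect,
    Finset.sum_eq_zero (s := Finset.range c), add_zero]
  · refine Finset.sum_congr rfl fun u hu => ?_
    have hub : u ≤ b := Nat.lt_succ_iff.mp (Finset.mem_range.mp hu)
    rw [if_pos (by omega), show b + 1 - 1 - u = b - u by omega,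
      show b - (b - u) = u by omega, show b + c - (b - u) = c + u by omega]
    push_cast [hub]
    ring_nf
  · intro u _
    rw [if_neg (by omega)]

/-- `x^{(a)} T^{(b)} y^{(c)}`. -/
def pbwMonomial (x T y : A) (p : ℕ × ℕ × ℕ) : A := dp x p.1 * dp T p.2.1 * dp y p.2.2

theorem RootTriple.expand_yxy {x T y : A} (h : RootTriple x T y) (a b c : ℕ) :
    dp y b * dp x (a + b) * dp y c = ∑ u ∈ Finset.range (b + 1),
      (v ^ (-(((a : ℤ) + u) * u)) * gauss u c) • pbwMonomial x T y (a + u, b - u, c + u) := by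
  rw [h.dp_mul_dp_of_ge, Finset.sum_mul]
  refine Finset.sum_congr rfl fun u _ => ?_
  rw [smul_mul_assoc, mul_assoc, FramedTensor.dp_mul_dp, mul_smul_comm, smul_smul, pbwMonomial,
    add_comm c]

theorem RootTriple.expand_xyx {x T y : A} (h : RootTriple x T y) (a b c : ℕ) :
    dp x a * dp y (b + c) * dp x b = ∑ u ∈ Finset.range (b + 1),
      (v ^ (-(((c : ℤ) + u) * u)) * gauss a u) • pbwMonomial x T y (a + u, b - u, c + u) := by
  rw [mul_assoc, h.dp_mul_dp_of_le, Finset.mul_sum]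
  refine Finset.sum_congr rfl fun u _ => ?_
  rw [mul_smul_comm, ← mul_assoc, ← mul_assoc, FramedTensor.dp_mul_dp, smul_mul_assoc,
    smul_mul_assoc, smul_smul, pbwMonomial]

end DividedPowers

end
end FramedTensor

open scoped TensorProduct
namespace FramedTensor
noncomputable section

/-! ### The right derivations -/

section RightDer

variable {I : Type} [DecidableEq I] (C : CartanDatum I)

/-- The linear map `r_i : f → f` with `r(x) = r_i(x) ⊗ θ_i + (terms x₁ ⊗ x₂ with |x₂| ≠ i)`. -/
def rightDer (i : I) : Module.End K (HalfAlg C) :=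
  (TensorProduct.rid K (HalfAlg C)).toLinearMap.comp
    ((TensorProduct.map LinearMap.id (coeffθ C i)).comp (r C))

omit [DecidableEq I] in
theorem r_counit (x : HalfAlg C) :
    TensorProduct.rid K (HalfAlg C)
      (TensorProduct.map LinearMap.id (counit C).toLinearMap (r C x)) = x := by
  have : (TensorProduct.rid K (HalfAlg C)).toLinearMap.comp
      ((TensorProduct.map LinearMap.id (counit C).toLinearMap).comp (r C)) = LinearMap.id := by
    refine linearMap_ext C _ _ ?_ fun i x hx => ?_
    · simp [r_one]
    · simp only [LinearMap.comp_apply, LinearMap.id_apply, LinearEquiv.coe_coe] at hx ⊢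
      have key : ∀ t : HalfAlg C ⊗[K] HalfAlg C,
          TensorProduct.rid K (HalfAlg C)
            (TensorProduct.map LinearMap.id (counit C).toLinearMap (mulPrim C i t)) =
          θ C i * TensorProduct.rid K (HalfAlg C)
            (TensorProduct.map LinearMap.id (counit C).toLinearMap t) := by
        intro t
        have h0 : counit C (θ C i) = 0 := by simp [counit]
        induction t with
        | zero => simp
        | add a b ha hb => simp only [map_add, mul_add, ha, hb]
        | tmul a b => simp [mulPrim, h0]
      rw [r_θ_mul, key, hx]
  exact LinearMap.congr_fun this x

theorem rightDer_one (i : I) : rightDer C i 1 = 0 := by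
  simp [rightDer, r_one, coeffθ_one]

/-- The twist comes from moving 1 ⊗ θ_j past the first tensor factor; the counit selects the terms
of r(x) whose second factor has degree 0, which together give x. -/
theorem rightDer_θ_mul (i j : I) (x : HalfAlg C) :
    rightDer C i (θ C j * x) = θ C j * rightDer C i x + if j = i then degTwist C j x else 0 := by
  have key : ∀ t : HalfAlg C ⊗[K] HalfAlg C,
      TensorProduct.rid K (HalfAlg C)
        (TensorProduct.map LinearMap.id (coeffθ C i) (mulPrim C j t)) =
      θ C j * TensorProduct.rid K (HalfAlg C)
        (TensorProduct.map LinearMap.id (coeffθ C i) t) +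
      if j = i then degTwist C j (TensorProduct.rid K (HalfAlg C)
        (TensorProduct.map LinearMap.id (counit C).toLinearMap t)) else 0 := by
    intro t
    induction t with
    | zero => simp
    | add a b ha hb =>
      simp only [map_add, ha, hb, mul_add]
      split_ifs <;> abel
    | tmul a b =>
      simp only [mulPrim, LinearMap.add_apply, TensorProduct.map_tmul, LinearMap.mulLeft_apply,
        LinearMap.id_apply, map_add, TensorProduct.rid_tmul, coeffθ_θ_mul,
        AlgHom.toLinearMap_apply, ite_smul, zero_smul, mul_smul_comm, map_smul]
  have := key (r C x)
  rw [r_counit] at this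
  simpa only [rightDer, LinearMap.comp_apply, LinearEquiv.coe_coe, r_θ_mul] using this

theorem counit_leftDer (i : I) (x : HalfAlg C) : counit C (leftDer C i x) = coeffθ C i x := by
  have : (counit C).toLinearMap.comp (leftDer C i) = coeffθ C i := by
    refine linearMap_ext C _ _ ?_ fun j x _ => ?_
    · simp [leftDer_one, coeffθ_one]
    · simp only [LinearMap.comp_apply, AlgHom.toLinearMap_apply, leftDer_θ_mul, map_add, map_smul,
        counit_θ_mul, smul_zero, add_zero, coeffθ_θ_mul]
      split_ifs <;> simp
  exact LinearMap.congr_fun this x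

/-- The form is built from left multiplication. The adjunction for right multiplication follows from
its compatibility with r, and is needed to remove the powers of θ_{i'} at the right end of a PBW
monomial. -/
theorem form_mul_θ_right (i : I) (x y : HalfAlg C) :
    form C (x * θ C i) y = (1 - v ^ (-2 : ℤ))⁻¹ * form C x (rightDer C i y) := by
  have h : form C (θ C i) = (1 - v ^ (-2 : ℤ))⁻¹ • coeffθ C i := by
    ext z
    have := form_θ_mul C i 1 z
    rw [mul_one, form_one, counit_leftDer] at this
    simpa using this
  have h2 : ∀ t : HalfAlg C ⊗[K] HalfAlg C,
      TensorProduct.lid K K (TensorProduct.map (form C x) (coeffθ C i) t) =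
      form C x (TensorProduct.rid K (HalfAlg C)
        (TensorProduct.map LinearMap.id (coeffθ C i) t)) := by
    intro t
    induction t with
    | zero => simp
    | add a b ha hb => simp only [map_add, ha, hb]
    | tmul a b => simp [mul_comm]
  rw [form_mul, h, TensorProduct.map_smul_right, LinearMap.smul_apply, map_smul, h2]
  rfl

end RightDer

/-! ### Root vectors of type `A₂` -/

/-- The root vector `θ_{i'} θ_i - v⁻¹ θ_i θ_{i'}`. -/
def θT : HalfAlg A2 := θi' * θi - v⁻¹ • (θi * θi')

theorem A2_serre (j k : Unit ⊕ Unit) (h : A2.form j k = -1) :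
    θ A2 j * θ A2 j * θ A2 k + θ A2 k * θ A2 j * θ A2 j =
      (v + v⁻¹) • (θ A2 j * θ A2 k * θ A2 j) := by
  have hjk : j ≠ k := by
    rintro rfl
    rw [A2.diag] at h
    norm_num at h
  exact ((serre_eq_zero_iff A2 (θ A2) j k hjk).mp (serre_θ A2 j k hjk)).2 h

/-- With T = yx - v⁻¹xy inserted, Tx = v xT and yT = v Ty are the two Serre relations rearranged. -/
theorem rootTriple_of_serre {A : Type*} [Ring A] [Algebra K A] {x y : A}
    (hx : x * x * y + y * x * x = (v + v⁻¹) • (x * y * x))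
    (hy : y * y * x + x * y * y = (v + v⁻¹) • (y * x * y)) :
    RootTriple x (y * x - v⁻¹ • (x * y)) y := by
  have hv := v_ne_zero
  refine ⟨by abel, ?_, ?_⟩
  · have := eq_sub_of_add_eq' hx
    rw [sub_mul, mul_sub, smul_sub, mul_smul_comm, smul_smul, mul_inv_cancel₀ hv, one_smul,
      smul_mul_assoc, ← mul_assoc, ← mul_assoc, this, add_smul]
    abel
  · have := eq_sub_of_add_eq hy
    rw [mul_sub, sub_mul, smul_sub, smul_mul_assoc, mul_smul_comm, smul_smul,
      mul_inv_cancel₀ hv, one_smul, ← mul_assoc, ← mul_assoc, this, add_smul]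
    abel

theorem rootTriple_A2 : RootTriple θi θT θi' :=
  rootTriple_of_serre (A2_serre _ _ rfl) (A2_serre _ _ rfl)

/-! ### The swap of the two generators -/

/-- The automorphism of the framed algebra of type `A₁` that exchanges `θ_i` and `θ_{i'}`. -/
def swapAlg : HalfAlg A2 →ₐ[K] HalfAlg A2 :=
  lift A2 (fun j => θ A2 j.swap) fun j k hjk => by
    have h : A2.form j.swap k.swap = A2.form j k := by
      rcases j with j | j <;> rcases k with k | k <;> rfl
    have hs := (serre_eq_zero_iff A2 (θ A2) j.swap k.swap
      (fun e => hjk (by simpa using congrArg Sum.swap e))).mp (serre_θ A2 _ _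
      (fun e => hjk (by simpa using congrArg Sum.swap e)))
    rw [h] at hs
    exact (serre_eq_zero_iff A2 _ j k hjk).mpr hs

theorem swapAlg_θi : swapAlg θi = θi' := lift_θ _ _ _ _

theorem swapAlg_θi' : swapAlg θi' = θi := lift_θ _ _ _ _

theorem swapAlg_swapAlg (x : HalfAlg A2) : swapAlg (swapAlg x) = x := by
  have : swapAlg.comp swapAlg = AlgHom.id K _ := by
    refine algHom_ext A2 _ _ fun j => ?_
    rcases j with j | j
    · exact (congrArg swapAlg swapAlg_θi).trans swapAlg_θi'
    · exact (congrArg swapAlg swapAlg_θi').trans swapAlg_θi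
  exact DFunLike.congr_fun this x

/-! ### The PBW basis -/

/-- The PBW basis element `θ_i^{(a)} T^{(b)} θ_{i'}^{(c)}`. -/
def pbw (p : ℕ × ℕ × ℕ) : HalfAlg A2 := pbwMonomial θi θT θi' p

theorem pbw_eq (a b c : ℕ) : pbw (a, b, c) = dp θi a * dp θT b * dp θi' c := rfl

/-! ### Derivations on products with root vectors -/

theorem leftDer_inl_θi_mul (x : HalfAlg A2) :
    leftDer A2 (.inl ()) (θi * x) = x + v ^ (2 : ℤ) • (θi * leftDer A2 (.inl ()) x) := by
  rw [θi, leftDer_θ_mul, if_pos rfl]; rfl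

theorem leftDer_inl_θi'_mul (x : HalfAlg A2) :
    leftDer A2 (.inl ()) (θi' * x) = v⁻¹ • (θi' * leftDer A2 (.inl ()) x) := by
  rw [θi', leftDer_θ_mul, if_neg (by simp), zero_add, ← zpow_neg_one]; rfl

theorem leftDer_inr_θi_mul (x : HalfAlg A2) :
    leftDer A2 (.inr ()) (θi * x) = v⁻¹ • (θi * leftDer A2 (.inr ()) x) := by
  rw [θi, leftDer_θ_mul, if_neg (by simp), zero_add, ← zpow_neg_one]; rfl

theorem leftDer_inr_θi'_mul (x : HalfAlg A2) :
    leftDer A2 (.inr ()) (θi' * x) = x + v ^ (2 : ℤ) • (θi' * leftDer A2 (.inr ()) x) := by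
  rw [θi', leftDer_θ_mul, if_pos rfl]; rfl

/-- The two inhomogeneous terms v⁻¹θ_{i'}x produced by T = θ_{i'}θ_i - v⁻¹θ_iθ_{i'} cancel. This is
the reason for the coefficient v⁻¹ in T. -/
theorem leftDer_inl_θT_mul (x : HalfAlg A2) :
    leftDer A2 (.inl ()) (θT * x) = v • (θT * leftDer A2 (.inl ()) x) := by
  have hv := v_ne_zero
  have e : θT * x = θi' * (θi * x) - v⁻¹ • (θi * (θi' * x)) := by
    simp only [θT, sub_mul, smul_mul_assoc, mul_assoc]
  rw [e, map_sub, map_smul]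
  simp only [leftDer_inl_θi_mul, leftDer_inl_θi'_mul, θT, mul_add, smul_add, mul_smul_comm, smul_smul,
    sub_mul, smul_mul_assoc, mul_assoc, smul_sub]
  rw [show v⁻¹ * v ^ (2 : ℤ) = v by field_simp, show v⁻¹ * (v ^ (2 : ℤ) * v⁻¹) = v * v⁻¹ by field_simp]
  abel

/-- Here the inhomogeneous terms are θ_i x and v⁻²θ_i x, which do not cancel. -/
theorem leftDer_inr_θT_mul (x : HalfAlg A2) :
    leftDer A2 (.inr ()) (θT * x) =
      (1 - v ^ (-2 : ℤ)) • (θi * x) + v • (θT * leftDer A2 (.inr ()) x) := by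
  have hv := v_ne_zero
  have e : θT * x = θi' * (θi * x) - v⁻¹ • (θi * (θi' * x)) := by
    simp only [θT, sub_mul, smul_mul_assoc, mul_assoc]
  rw [e, map_sub, map_smul]
  simp only [leftDer_inr_θi_mul, leftDer_inr_θi'_mul, θT, mul_add, smul_add, mul_smul_comm, smul_smul,
    sub_mul, smul_mul_assoc, mul_assoc, smul_sub, sub_smul, one_smul]
  rw [show v ^ (2 : ℤ) * v⁻¹ = v by field_simp, show v⁻¹ * (v⁻¹ * v ^ (2 : ℤ)) = v * v⁻¹ by field_simp,
    show v⁻¹ * v⁻¹ = v ^ (-2 : ℤ) by rw [← zpow_neg_one, ← zpow_add₀ hv]; rfl]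
  abel

theorem rightDer_inr_θi_mul (x : HalfAlg A2) :
    rightDer A2 (.inr ()) (θi * x) = θi * rightDer A2 (.inr ()) x := by
  rw [θi, rightDer_θ_mul, if_neg (by simp), add_zero]

/-- Moving the twist past θ_i yields v⁻¹, which cancels against the coefficient in T. Hence divided
powers of T can be pulled out of this derivation on the left. -/
theorem rightDer_inr_θT_mul (x : HalfAlg A2) :
    rightDer A2 (.inr ()) (θT * x) = θT * rightDer A2 (.inr ()) x := by
  have e : θT * x = θi' * (θi * x) - v⁻¹ • (θi * (θi' * x)) := by
    simp only [θT, sub_mul, smul_mul_assoc, mul_assoc]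
  have h1 : ∀ y, rightDer A2 (.inr ()) (θi' * y) =
      θi' * rightDer A2 (.inr ()) y + degTwist A2 (.inr ()) y := by
    intro y
    rw [θi', rightDer_θ_mul, if_pos rfl]
  have h2 : degTwist A2 (.inr ()) θi = v⁻¹ • θi := by
    rw [degTwist, θi, scale_θ, ← zpow_neg_one]; rfl
  rw [e, map_sub, map_smul]
  simp only [h1, rightDer_inr_θi_mul, map_mul, h2, θT, sub_mul, smul_mul_assoc, mul_add, smul_add,
    mul_assoc]
  abel

theorem dp_mul_induction {A : Type*} [Ring A] [Algebra K A] {P : A → Prop} {x z : A}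
    (h : ∀ w, P w → P (x * w)) (hs : ∀ (c : K) w, P w → P (c • w)) (hz : P z) (n : ℕ) :
    P (dp x n * z) := by
  induction n with
  | zero => simpa [dp_zero] using hz
  | succ n ih =>
    rw [dp_succ, smul_mul_assoc, mul_assoc]
    exact hs _ _ (h _ ih)

theorem map_dp_mul_of_comm {A : Type*} [Ring A] [Algebra K A] (D : Module.End K A) {x z : A}
    (h : ∀ w, D (x * w) = x * D w) (n : ℕ) : D (dp x n * z) = dp x n * D z := by
  induction n with
  | zero => simp [dp_zero]
  | succ n ih => rw [dp_succ, smul_mul_assoc, map_smul, mul_assoc, h, ih, smul_mul_assoc, mul_assoc]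

/-- Iterating the recursion gives c(1 + v² + ⋯ + v^{2a}) = c v^a [a+1], and [a+1] is absorbed by the
divided power. The recursion is only required on the vectors x^{(n)}z, because for T it depends on
their being killed by the other derivation. -/
theorem map_dp_succ_mul {A : Type*} [Ring A] [Algebra K A] (D : Module.End K A) {x z : A} {c : K}
    (h : ∀ n, D (x * (dp x n * z)) = c • (dp x n * z) + v ^ (2 : ℤ) • (x * D (dp x n * z)))
    (hz : D z = 0) (a : ℕ) : D (dp x (a + 1) * z) = (c * v ^ (a : ℤ)) • (dp x a * z) := by
  have hv := v_ne_zero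
  induction a with
  | zero =>
    have := h 0
    simpa [dp_zero, dp_one, hz] using this
  | succ a ih =>
    rw [dp_succ, smul_mul_assoc, map_smul, mul_assoc, h, ih, mul_smul_comm, ← mul_assoc, mul_dp,
      smul_mul_assoc]
    simp only [smul_smul, ← add_smul]
    congr 1
    have := qInt_add ((a : ℤ) + 1) 1
    rw [qInt_one, zpow_one, mul_one] at this
    have hq := qInt_succ_ne_zero (a + 1)
    push_cast at hq ⊢
    rw [inv_mul_eq_iff_eq_mul₀ hq, this, zpow_neg, zpow_add₀ hv, zpow_one]
    field_simp
    norm_cast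
    ring

/-- `∏_{s=1}^{a} (1 - v^{-2s})⁻¹`, the norm of a divided power of a root vector. -/
def dpNorm (a : ℕ) : K := ∏ s ∈ Finset.range a, (1 - v ^ (-2 * ((s : ℤ) + 1)))⁻¹

/-! ### Norms and orthogonality of PBW monomials -/

theorem one_sub_zpow_ne_zero {k : ℤ} (hk : k ≠ 0) : 1 - v ^ k ≠ 0 :=
  fun h => v_zpow_ne_one hk (sub_eq_zero.mp h).symm

theorem dpNorm_zero : dpNorm 0 = 1 := by simp [dpNorm]

theorem dpNorm_ne_zero (a : ℕ) : dpNorm a ≠ 0 :=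
  Finset.prod_ne_zero_iff.mpr fun s _ => inv_ne_zero (one_sub_zpow_ne_zero (by omega))

/-- The right side is in the form in which adjunction delivers it: [a+1]⁻¹ from the divided power,
(1 - v⁻²)⁻¹ from the form and v^a from the derivation. -/
theorem dpNorm_succ (a : ℕ) :
    dpNorm (a + 1) = (qInt (a + 1))⁻¹ * ((1 - v ^ (-2 : ℤ))⁻¹ * v ^ (a : ℤ)) * dpNorm a := by
  have hv := v_ne_zero
  rw [dpNorm, Finset.prod_range_succ, mul_comm, ← dpNorm]
  congr 1
  have h1 := one_sub_zpow_ne_zero (k := -2) (by omega)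
  have h2 := one_sub_zpow_ne_zero (k := -2 * ((a : ℤ) + 1)) (by omega)
  have h3 := qInt_succ_ne_zero a
  rw [inv_eq_iff_eq_inv]
  rw [mul_inv, mul_inv, inv_inv, inv_inv, ← zpow_neg]
  have h4 : (1 - v ^ (-2 : ℤ)) = v⁻¹ * (v - v⁻¹) := by
    rw [mul_sub, inv_mul_cancel₀ hv, ← zpow_neg_one, ← zpow_add₀ hv]; rfl
  rw [h4, mul_assoc, mul_comm v⁻¹, mul_assoc, ← mul_assoc, ← mul_assoc, qInt_mul_sub, mul_assoc,
    ← zpow_neg_one, ← zpow_add₀ hv, sub_mul, ← zpow_add₀ hv, ← zpow_add₀ hv]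
  ring_nf
  rw [zpow_zero]
  ring

/-- When z and z' are killed by the derivation adjoint to θ_i, the powers of θ_i at the left split
off: take the adjoint of one θ_i at a time until one side runs out. -/
theorem form_dp_θi_mul {z z' : HalfAlg A2} (hz : leftDer A2 (.inl ()) z = 0)
    (hz' : leftDer A2 (.inl ()) z' = 0) (a a' : ℕ) :
    form A2 (dp θi a * z) (dp θi a' * z') = if a = a' then dpNorm a * form A2 z z' else 0 := by
  have hD : ∀ {z}, leftDer A2 (.inl ()) z = 0 → ∀ a,
      leftDer A2 (.inl ()) (dp θi (a + 1) * z) = v ^ (a : ℤ) • (dp θi a * z) := by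
    intro z hz a
    have := map_dp_succ_mul (leftDer A2 (.inl ())) (x := θi) (z := z) (c := 1)
      (fun n => by rw [leftDer_inl_θi_mul, one_smul]) hz a
    rwa [one_mul] at this
  have hl : ∀ (a : ℕ) (z w : HalfAlg A2), form A2 (dp θi (a + 1) * z) w =
      (qInt (a + 1))⁻¹ * ((1 - v ^ (-2 : ℤ))⁻¹ * form A2 (dp θi a * z) (leftDer A2 (.inl ()) w)) := by
    intro a z w
    rw [dp_succ, smul_mul_assoc, map_smul, LinearMap.smul_apply, mul_assoc, smul_eq_mul]
    congr 1
    exact form_θ_mul A2 _ _ _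
  induction a generalizing a' with
  | zero =>
    cases a' with
    | zero => simp [dp_zero, dpNorm_zero]
    | succ a' => rw [if_neg (by omega), form_symm, hl, dp_zero, one_mul, hz, map_zero]; simp
  | succ a ih =>
    cases a' with
    | zero => rw [if_neg (by omega), hl, dp_zero, one_mul, hz', map_zero]; simp
    | succ a' =>
      rw [hl, hD hz', map_smul, ih, smul_eq_mul]
      by_cases h : a = a'
      · subst h
        rw [if_pos rfl, if_pos rfl, dpNorm_succ]
        ring
      · rw [if_neg h, if_neg (by omega)]
        simp

theorem rightDer_inr_dp (c : ℕ) :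
    rightDer A2 (.inr ()) (dp θi' (c + 1)) = v ^ (c : ℤ) • dp θi' c := by
  have hv := v_ne_zero
  have h1 : ∀ y, rightDer A2 (.inr ()) (θi' * y) =
      θi' * rightDer A2 (.inr ()) y + degTwist A2 (.inr ()) y := by
    intro y
    rw [θi', rightDer_θ_mul, if_pos rfl]
  have h2 : degTwist A2 (.inr ()) θi' = v ^ (2 : ℤ) • θi' := by
    rw [degTwist, θi', scale_θ]; rfl
  have h3 : ∀ n, degTwist A2 (.inr ()) (dp θi' n) = v ^ (2 * (n : ℤ)) • dp θi' n := by
    intro n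
    rw [map_dp, h2, dp, smul_pow, smul_comm, ← dp, ← zpow_natCast, ← zpow_mul]
  have h4 : rightDer A2 (.inr ()) (1 : HalfAlg A2) = 0 := rightDer_one _ _
  induction c with
  | zero =>
    have := h1 1
    simpa [dp_zero, dp_one, h4] using this
  | succ c ih =>
    rw [dp_succ, map_smul, h1, ih, h3, mul_smul_comm, mul_dp, smul_smul, ← add_smul, smul_smul]
    congr 1
    have := qInt_add 1 ((c : ℤ) + 1)
    rw [qInt_one, mul_one, add_comm (1 : ℤ)] at this
    have hq := qInt_succ_ne_zero (c + 1)
    push_cast at hq ⊢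
    rw [inv_mul_eq_iff_eq_mul₀ hq, this, add_mul, add_comm, ← zpow_add₀ hv, mul_right_comm,
      ← zpow_add₀ hv]
    ring_nf

/-- The mirror argument at the right end; z and z' have to behave as constants for the right
derivation. -/
theorem form_mul_dp_θi' {z z' : HalfAlg A2}
    (hz : ∀ w, rightDer A2 (.inr ()) (z * w) = z * rightDer A2 (.inr ()) w)
    (hz' : ∀ w, rightDer A2 (.inr ()) (z' * w) = z' * rightDer A2 (.inr ()) w) (c c' : ℕ) :
    form A2 (z * dp θi' c) (z' * dp θi' c') = if c = c' then dpNorm c * form A2 z z' else 0 := by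
  have h0 : ∀ {z : HalfAlg A2},
      (∀ w, rightDer A2 (.inr ()) (z * w) = z * rightDer A2 (.inr ()) w) →
      rightDer A2 (.inr ()) z = 0 := by
    intro z hz
    have := hz 1
    rwa [mul_one, rightDer_one, mul_zero] at this
  have hl : ∀ (c : ℕ) (z w : HalfAlg A2), form A2 (z * dp θi' (c + 1)) w =
      (qInt (c + 1))⁻¹ * ((1 - v ^ (-2 : ℤ))⁻¹ * form A2 (z * dp θi' c)
        (rightDer A2 (.inr ()) w)) := by
    intro c z w
    rw [← form_mul_θ_right, mul_assoc]
    change _ = _ * form A2 (z * (dp θi' c * θi')) w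
    rw [dp_mul_self, mul_smul_comm, map_smul, LinearMap.smul_apply, smul_eq_mul,
      inv_mul_cancel_left₀ (qInt_succ_ne_zero c)]
  induction c generalizing c' with
  | zero =>
    cases c' with
    | zero => simp [dp_zero, dpNorm_zero]
    | succ c' => rw [if_neg (by omega), form_symm, hl, dp_zero, mul_one, h0 hz, map_zero]; simp
  | succ c ih =>
    cases c' with
    | zero => rw [if_neg (by omega), hl, dp_zero, mul_one, h0 hz', map_zero]; simp
    | succ c' =>
      rw [hl, hz', rightDer_inr_dp, mul_smul_comm, map_smul, ih, smul_eq_mul]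
      by_cases h : c = c'
      · subst h
        rw [if_pos rfl, if_pos rfl, dpNorm_succ]
        ring
      · rw [if_neg h, if_neg (by omega)]
        simp

theorem leftDer_inl_dp_θT_mul {w : HalfAlg A2} (hw : leftDer A2 (.inl ()) w = 0) (b : ℕ) :
    leftDer A2 (.inl ()) (dp θT b * w) = 0 :=
  dp_mul_induction (P := fun w => leftDer A2 (.inl ()) w = 0)
    (fun w hw => by rw [leftDer_inl_θT_mul, hw, mul_zero, smul_zero])
    (fun c w hw => by rw [map_smul, hw, smul_zero]) hw b

theorem leftDer_inl_dp_θi' (c : ℕ) : leftDer A2 (.inl ()) (dp θi' c) = 0 := by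
  have := dp_mul_induction (P := fun w => leftDer A2 (.inl ()) w = 0) (x := θi') (z := 1)
    (fun w hw => by rw [leftDer_inl_θi'_mul, hw, mul_zero, smul_zero])
    (fun c w hw => by rw [map_smul, hw, smul_zero]) (leftDer_one _ _) c
  rwa [mul_one] at this

theorem form_dp_θT (b b' : ℕ) :
    form A2 (dp θT b) (dp θT b') = if b = b' then dpNorm b else 0 := by
  have hk := one_sub_zpow_ne_zero (k := -2) (by omega)
  set q : K := 1 - v ^ (-2 : ℤ) with hq
  have hT : ∀ n, leftDer A2 (.inl ()) (dp θT n) = 0 := by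
    intro n
    have := leftDer_inl_dp_θT_mul (leftDer_one A2 (.inl ())) n
    rwa [mul_one] at this
  -- On vectors killed by the derivation for θ_i, only the summand θ_{i'}θ_i of T contributes, so
  -- the adjoint of T there is a composite of two derivations.
  have hmul : ∀ u w, leftDer A2 (.inl ()) w = 0 → form A2 (θT * u) w =
      q⁻¹ * (q⁻¹ * form A2 u (leftDer A2 (.inl ()) (leftDer A2 (.inr ()) w))) := by
    intro u w hw
    have e : θT * u = θi' * (θi * u) - v⁻¹ • (θi * (θi' * u)) := by
      simp only [θT, sub_mul, smul_mul_assoc, mul_assoc]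
    have h1 : form A2 (θi' * (θi * u)) w =
      q⁻¹ * form A2 (θi * u) (leftDer A2 (.inr ()) w) := form_θ_mul A2 _ _ _
    have h2 : ∀ x y, form A2 (θi * x) y = q⁻¹ * form A2 x (leftDer A2 (.inl ()) y) :=
      fun x y => form_θ_mul A2 _ _ _
    rw [e, map_sub, map_smul, LinearMap.sub_apply, LinearMap.smul_apply, h1, h2, h2, hw]
    simp
  have hl : ∀ (a n : ℕ), form A2 (dp θT (a + 1)) (dp θT n) = (qInt (a + 1))⁻¹ * (q⁻¹ * (q⁻¹ *
      form A2 (dp θT a) (leftDer A2 (.inl ()) (leftDer A2 (.inr ()) (dp θT n))))) := by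
    intro a n
    rw [dp_succ, map_smul, LinearMap.smul_apply, hmul _ _ (hT n), smul_eq_mul]
  have h0 : leftDer A2 (.inl ()) (leftDer A2 (.inr ()) (dp θT 0)) = 0 := by
    rw [dp_zero, leftDer_one, map_zero]
  have hD : ∀ n, leftDer A2 (.inl ()) (leftDer A2 (.inr ()) (dp θT (n + 1))) =
      (q * v ^ (n : ℤ)) • dp θT n := by
    intro n
    -- The composite derivation obeys the recursion with constant 1 - v⁻². That constant cancels one
    -- of the two factors (1 - v⁻²)⁻¹ in `hmul`, so T has the same norms as a simple root vector.
    have := map_dp_succ_mul (leftDer A2 (.inl ()) * leftDer A2 (.inr ())) (x := θT) (z := 1)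
      (c := q) (fun n => by
        rw [mul_one, Module.End.mul_apply, leftDer_inr_θT_mul, map_add, map_smul, map_smul,
          leftDer_inl_θi_mul, leftDer_inl_θT_mul, hT, mul_zero, smul_zero, add_zero, smul_smul, zpow_ofNat, pow_two v]
        rfl) (by rw [Module.End.mul_apply, leftDer_one, map_zero]) n
    rwa [mul_one, mul_one] at this
  induction b generalizing b' with
  | zero =>
    cases b' with
    | zero => simp [dp_zero, dpNorm_zero, form_one]
    | succ b' => rw [if_neg (by omega), form_symm, hl, h0]; simp
  | succ b ih =>
    cases b' with
    | zero => rw [if_neg (by omega), hl, h0]; simp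
    | succ b' =>
      rw [hl, hD, map_smul, ih, smul_eq_mul]
      by_cases h : b = b'
      · subst h
        rw [if_pos rfl, if_pos rfl, dpNorm_succ, ← hq]
        field_simp
      · rw [if_neg h, if_neg (by omega)]
        simp

/-- The three factors are removed in turn: θ_i from the left, θ_{i'} from the right, then T. -/
theorem form_pbw (p q : ℕ × ℕ × ℕ) : form A2 (pbw p) (pbw q) =
    if p = q then dpNorm p.1 * (dpNorm p.2.1 * dpNorm p.2.2) else 0 := by
  obtain ⟨a, b, c⟩ := p
  obtain ⟨a', b', c'⟩ := q
  have hr : ∀ b w, rightDer A2 (.inr ()) (dp θT b * w) = dp θT b * rightDer A2 (.inr ()) w :=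
    fun b w => map_dp_mul_of_comm _ rightDer_inr_θT_mul b
  rw [pbw_eq, pbw_eq, mul_assoc, mul_assoc,
    form_dp_θi_mul (leftDer_inl_dp_θT_mul (leftDer_inl_dp_θi' c) b)
      (leftDer_inl_dp_θT_mul (leftDer_inl_dp_θi' c') b'),
    form_mul_dp_θi' (hr b) (hr b'), form_dp_θT]
  simp only [Prod.mk.injEq]
  split_ifs <;> first | (exfalso; tauto) | ring

theorem linearIndependent_pbw : LinearIndependent K pbw := by
  refine LinearMap.BilinForm.linearIndependent_of_iIsOrtho (B := form A2) ?_ ?_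
  · intro p q hpq
    exact (form_pbw p q).trans (if_neg hpq)
  · intro p hp
    have := (form_pbw p p).symm.trans hp
    rw [if_pos rfl] at this
    exact mul_ne_zero (dpNorm_ne_zero _) (mul_ne_zero (dpNorm_ne_zero _) (dpNorm_ne_zero _)) this

/-! ### Left multiplication on the PBW basis -/

theorem θi_mul_pbw (a b c : ℕ) : θi * pbw (a, b, c) = qInt (a + 1) • pbw (a + 1, b, c) := by
  rw [pbw_eq, pbw_eq, mul_assoc, ← mul_assoc, mul_dp, smul_mul_assoc, mul_assoc]

theorem θi'_mul_pbw_zero (b c : ℕ) :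
    θi' * pbw (0, b, c) = (v ^ (b : ℤ) * qInt (c + 1)) • pbw (0, b, c + 1) := by
  have hT : θi' * dp θT b = v ^ b • (dp θT b * θi') := mul_dp_comm rootTriple_A2.yT b
  rw [pbw_eq, pbw_eq, dp_zero, one_mul, ← mul_assoc, hT, smul_mul_assoc, mul_assoc, mul_dp,
    mul_smul_comm, smul_smul, zpow_natCast]

/-- Crossing x^{(a+1)} gives v^{-(a+1)} and crossing T^{(b)} gives v^b; the T left behind merges
with T^{(b)}. -/
theorem θi'_mul_pbw_succ (a b c : ℕ) : θi' * pbw (a + 1, b, c) =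
    (v ^ ((b : ℤ) - (a + 1)) * qInt (c + 1)) • pbw (a + 1, b, c + 1) +
      qInt (b + 1) • pbw (a, b + 1, c) := by
  have h0 := θi'_mul_pbw_zero b c
  rw [pbw_eq, pbw_eq, dp_zero, one_mul] at h0
  rw [pbw_eq, pbw_eq, pbw_eq, mul_assoc (dp θi (a + 1)), ← mul_assoc, rootTriple_A2.mul_dp, add_mul,
    smul_mul_assoc, mul_assoc, h0, mul_smul_comm, mul_assoc (dp θi a) θT, ← mul_assoc θT, mul_dp,
    smul_mul_assoc, mul_smul_comm, smul_smul, ← mul_assoc, ← mul_assoc, ← mul_assoc,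
    sub_eq_neg_add, zpow_add₀ v_ne_zero]

theorem span_pbw : Submodule.span K (Set.range pbw) = ⊤ := by
  have hm : ∀ p, pbw p ∈ Submodule.span K (Set.range pbw) := fun p => Submodule.subset_span ⟨p, rfl⟩
  refine submodule_eq_top A2 _ (Submodule.subset_span ⟨(0, 0, 0), by simp [pbw_eq, dp_zero]⟩) ?_
  intro j x hx
  suffices h : Submodule.span K (Set.range pbw) ≤
      (Submodule.span K (Set.range pbw)).comap (LinearMap.mulLeft K (θ A2 j)) from h hx
  rw [Submodule.span_le]
  rintro _ ⟨⟨a, b, c⟩, rfl⟩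
  rw [SetLike.mem_coe, Submodule.mem_comap, LinearMap.mulLeft_apply]
  rcases j with j | j
  · change θi * _ ∈ _
    rw [θi_mul_pbw]
    exact Submodule.smul_mem _ _ (hm _)
  · change θi' * _ ∈ _
    cases a with
    | zero => rw [θi'_mul_pbw_zero]; exact Submodule.smul_mem _ _ (hm _)
    | succ a =>
      rw [θi'_mul_pbw_succ]
      exact add_mem (Submodule.smul_mem _ _ (hm _)) (Submodule.smul_mem _ _ (hm _))

/-- The PBW basis of the framed algebra. -/
def pbwBasis : Module.Basis (ℕ × ℕ × ℕ) K (HalfAlg A2) :=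
  Module.Basis.mk linearIndependent_pbw span_pbw.ge

@[simp]
theorem pbwBasis_apply (p : ℕ × ℕ × ℕ) : pbwBasis p = pbw p := by simp [pbwBasis]

end
end FramedTensor

open scoped TensorProduct
namespace FramedTensor
noncomputable section

/-! ### The place at infinity -/

open Classical in
/-- The valuation of `ℚ(v)` at infinity. -/
def valInf : Valuation K (WithZero (Multiplicative ℤ)) := RatFunc.inftyValuation ℚ

theorem vanishesAtInfinity_iff (c : K) : VanishesAtInfinity c ↔ valInf c < 1 := by
  classical
  have : valInf c = if c = 0 then 0 else WithZero.exp c.intDegree := by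
    rw [valInf, RatFunc.inftyValuation_apply, RatFunc.inftyValuationDef]
  rw [VanishesAtInfinity, this]
  split_ifs with h
  · simp [h]
  · rw [← WithZero.exp_zero, WithZero.exp_lt_exp]
    simp [h]

theorem valInf_v_inv : valInf v⁻¹ < 1 := by
  rw [← vanishesAtInfinity_iff]
  right
  rw [RatFunc.intDegree_inv, v, RatFunc.intDegree_X]
  norm_num

theorem valInf_v_zpow {k : ℤ} (hk : k < 0) : valInf (v ^ k) < 1 := by
  obtain ⟨j, rfl⟩ : ∃ j : ℕ, k = -(j + 1 : ℕ) := ⟨k.natAbs - 1, by omega⟩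
  rw [zpow_neg, zpow_natCast, ← inv_pow, map_pow]
  exact pow_lt_one₀ zero_le valInf_v_inv (by omega)

theorem valInf_intCast_of_ne_zero {a : ℤ} (ha : a ≠ 0) : valInf (a : K) = 1 := by
  classical
  have e : (a : K) = RatFunc.C (a : ℚ) := by simp
  rw [e, valInf]
  exact RatFunc.inftyValuation.C ℚ (by exact_mod_cast ha)

theorem valInf_intCast {a : ℤ} (h : valInf (a : K) < 1) : a = 0 := by
  by_contra ha
  exact h.ne (valInf_intCast_of_ne_zero ha)

theorem valInf_intCast_le (a : ℤ) : valInf (a : K) ≤ 1 := by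
  by_cases ha : a = 0
  · simp [ha]
  · exact (valInf_intCast_of_ne_zero ha).le

theorem valInf_le_one {w : K} (hw : w ∈ intVInv) : valInf w ≤ 1 := by
  induction hw using Algebra.adjoin_induction with
  | mem x hx => rw [Set.mem_singleton_iff.mp hx]; exact valInf_v_inv.le
  | algebraMap a => simpa using valInf_intCast_le a
  | add x y _ _ hx hy => exact valInf.map_add_le hx hy
  | mul x y _ _ hx hy => rw [map_mul]; exact mul_le_one' hx hy

theorem valInf_lt_one {c : K} (hc : c ∈ vInvIdeal) : valInf c < 1 := by
  obtain ⟨w, hw, rfl⟩ := hc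
  rw [map_mul]
  exact mul_lt_one_of_lt_of_le valInf_v_inv (valInf_le_one hw)

theorem vInvIdeal_le {c : K} (hc : c ∈ vInvIdeal) : c ∈ intVInv := by
  obtain ⟨w, hw, rfl⟩ := hc
  exact mul_mem v_inv_mem_intVInv hw

theorem mul_mem_vInvIdeal {w c : K} (hw : w ∈ intVInv) (hc : c ∈ vInvIdeal) :
    w * c ∈ vInvIdeal :=
  vInvIdeal.smul_mem ⟨w, hw⟩ hc

/-- The integer is the constant term of w as a polynomial in v⁻¹. -/
theorem exists_intCast_sub_mem {w : K} (hw : w ∈ intVInv) : ∃ a : ℤ, w - a ∈ vInvIdeal := by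
  induction hw using Algebra.adjoin_induction with
  | mem x hx =>
    rw [Set.mem_singleton_iff.mp hx]
    exact ⟨0, 1, one_mem _, by simp⟩
  | algebraMap a => exact ⟨a, by simp⟩
  | add x y _ _ hx hy =>
    obtain ⟨a, ha⟩ := hx
    obtain ⟨b, hb⟩ := hy
    refine ⟨a + b, ?_⟩
    have := add_mem ha hb
    push_cast
    rwa [add_sub_add_comm]
  | mul x y hx' hy' hx hy =>
    obtain ⟨a, ha⟩ := hx
    obtain ⟨b, hb⟩ := hy
    refine ⟨a * b, ?_⟩
    have := add_mem (mul_mem_vInvIdeal hx' hb) (mul_mem_vInvIdeal (intCast_mem intVInv b) ha)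
    push_cast
    convert this using 1
    ring

theorem exists_pow_mul_mem {c : K} (hc : c ∈ laurentInt) :
    ∃ d : ℕ, v ^ (-(d : ℤ)) * c ∈ intVInv := by
  have hv := v_ne_zero
  induction hc using Algebra.adjoin_induction with
  | mem x hx =>
    rcases hx with rfl | hx
    · exact ⟨1, by simp [hv, one_mem]⟩
    · rw [Set.mem_singleton_iff.mp hx]
      exact ⟨0, by simpa using v_inv_mem_intVInv⟩
  | algebraMap a => exact ⟨0, by simp⟩
  | add x y _ _ hx hy =>
    obtain ⟨a, ha⟩ := hx
    obtain ⟨b, hb⟩ := hy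
    refine ⟨a + b, ?_⟩
    have h1 := mul_mem (v_zpow_mem_intVInv (k := -b) (by omega)) ha
    have h2 := mul_mem (v_zpow_mem_intVInv (k := -a) (by omega)) hb
    rw [← mul_assoc, ← zpow_add₀ hv] at h1 h2
    have := add_mem h1 h2
    convert this using 1
    push_cast
    ring_nf
  | mul x y _ _ hx hy =>
    obtain ⟨a, ha⟩ := hx
    obtain ⟨b, hb⟩ := hy
    refine ⟨a + b, ?_⟩
    have := mul_mem ha hb
    convert this using 1
    push_cast
    rw [neg_add, zpow_add₀ hv]
    ring

/-- Conjugation makes c a polynomial in v, of degree ≥ 0, whereas an element of v⁻¹ℤ[v⁻¹] is zero or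
has negative degree. -/
theorem eq_zero_of_bar_eq {c : K} (hc : c ∈ vInvIdeal) (hb : barK c = c) : c = 0 := by
  have h1 : ∃ p : Polynomial ℚ, algebraMap _ K p = barK c := by
    have hw : ∀ w ∈ intVInv, ∃ p : Polynomial ℚ, algebraMap _ K p = barK w := by
      intro w hw
      induction hw using Algebra.adjoin_induction with
      | mem x hx =>
        refine ⟨Polynomial.X, ?_⟩
        rw [Set.mem_singleton_iff.mp hx, map_inv₀, barK_v, inv_inv, RatFunc.algebraMap_X, v]
      | algebraMap a => exact ⟨a, by simp⟩
      | add x y _ _ hx hy =>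
        obtain ⟨p, hp⟩ := hx
        obtain ⟨q, hq⟩ := hy
        exact ⟨p + q, by rw [map_add, map_add, hp, hq]⟩
      | mul x y _ _ hx hy =>
        obtain ⟨p, hp⟩ := hx
        obtain ⟨q, hq⟩ := hy
        exact ⟨p * q, by rw [map_mul, map_mul, hp, hq]⟩
    exact hw c (vInvIdeal_le hc)
  obtain ⟨p, hp⟩ := h1
  rw [hb] at hp
  have h2 := (vanishesAtInfinity_iff c).mpr (valInf_lt_one hc)
  rcases h2 with h | h
  · exact h
  · rw [← hp, RatFunc.intDegree_polynomial] at h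
    omega

/-- Almost orthonormality: if `∑ c_i² N_i ∈ 1 + v⁻¹𝐀` with `N_i ∈ 1 + v⁻¹𝐀` and `c_i` Laurent
polynomials, then one `c_i` is congruent to `±1` and the others to `0` modulo `v⁻¹ℤ[v⁻¹]`. -/
theorem exists_unique_sign {ι : Type*} (s : Finset ι) (c N : ι → K)
    (hc : ∀ i ∈ s, c i ∈ laurentInt) (hN : ∀ i ∈ s, valInf (N i - 1) < 1)
    (h : valInf (∑ i ∈ s, c i ^ 2 * N i - 1) < 1) :
    ∃ j ∈ s, ∃ ε : K, (ε = 1 ∨ ε = -1) ∧ c j - ε ∈ vInvIdeal ∧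
      ∀ i ∈ s, i ≠ j → c i ∈ vInvIdeal := by
  classical
  have hv := v_ne_zero
  -- At infinity N_i reduces to 1 and x_i to its constant term a_i, so the sum reduces to the
  -- integer ∑ a_i².
  have key : ∀ (x : ι → K) (a : ι → ℤ), (∀ i ∈ s, x i ∈ intVInv) →
      (∀ i ∈ s, x i - a i ∈ vInvIdeal) →
      valInf (∑ i ∈ s, x i ^ 2 * N i - ((∑ i ∈ s, a i ^ 2 : ℤ) : K)) < 1 := by
    intro x a hx ha
    rw [Int.cast_sum, ← Finset.sum_sub_distrib]
    refine valInf.map_sum_lt one_ne_zero fun i hi => ?_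
    have e : x i ^ 2 * N i - ((a i ^ 2 : ℤ) : K) =
        x i ^ 2 * (N i - 1) + (x i + a i) * (x i - a i) := by
      push_cast; ring
    rw [e]
    refine valInf.map_add_lt ?_ ?_
    · rw [map_mul, mul_comm]
      exact mul_lt_one_of_lt_of_le (hN i hi) (valInf_le_one (pow_mem (hx i hi) 2))
    · exact valInf_lt_one (mul_mem_vInvIdeal (add_mem (hx i hi) (intCast_mem _ _)) (ha i hi))
  -- Descent on the order of the pole at infinity. After scaling by v^{-(d+1)} the weighted sum of
  -- squares vanishes at infinity, so ∑ a_i² = 0. A sum of squares of integers is zero only if every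
  -- a_i is, so one factor v can be restored.
  have desc : ∀ d : ℕ, (∀ i ∈ s, v ^ (-(d : ℤ)) * c i ∈ intVInv) → ∀ i ∈ s, c i ∈ intVInv := by
    intro d
    induction d with
    | zero => intro hd; simpa using hd
    | succ d ih =>
      intro hd
      refine ih fun i hi => ?_
      choose! a ha using fun i hi => exists_intCast_sub_mem (hd i hi)
      have h1 := key _ a hd ha
      have h2 : valInf (∑ i ∈ s, (v ^ (-((d + 1 : ℕ) : ℤ)) * c i) ^ 2 * N i) < 1 := by
        have e : ∑ i ∈ s, (v ^ (-((d + 1 : ℕ) : ℤ)) * c i) ^ 2 * N i =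
            (v ^ (-((d + 1 : ℕ) : ℤ))) ^ 2 * ((∑ i ∈ s, c i ^ 2 * N i - 1) + 1) := by
          rw [sub_add_cancel, Finset.mul_sum]
          exact Finset.sum_congr rfl fun i _ => by ring
        rw [e, map_mul, map_pow]
        refine mul_lt_one_of_lt_of_le (pow_lt_one₀ zero_le (valInf_v_zpow (by omega)) two_ne_zero) ?_
        exact valInf.map_add_le h.le (by simp)
      have h3 := valInf.map_sub_lt h2 h1
      rw [sub_sub_cancel] at h3
      have h4 := valInf_intCast h3
      have h5 : a i = 0 := by
        have := (Finset.sum_eq_zero_iff_of_nonneg fun i _ => sq_nonneg (a i)).mp h4 i hi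
        exact pow_eq_zero_iff two_ne_zero |>.mp this
      have h6 := ha i hi
      rw [h5, Int.cast_zero, sub_zero] at h6
      obtain ⟨w, hw, e⟩ := h6
      have : v ^ (-(d : ℤ)) * c i = w := by
        have e2 : v ^ (-(d : ℤ)) * c i = v * (v ^ (-((d + 1 : ℕ) : ℤ)) * c i) := by
          rw [← mul_assoc, ← zpow_one_add₀ hv]
          push_cast
          ring_nf
        rw [e2, e, mul_inv_cancel_left₀ hv]
      rwa [this]
  have hint : ∀ i ∈ s, c i ∈ intVInv := by
    choose! d hd using fun i hi => exists_pow_mul_mem (hc i hi)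
    -- The sum of the individual pole bounds serves as a common bound.
    refine desc (∑ i ∈ s, d i) fun i hi => ?_
    have h1 : d i ≤ ∑ i ∈ s, d i := Finset.single_le_sum (fun _ _ => Nat.zero_le _) hi
    have := mul_mem (v_zpow_mem_intVInv (k := d i - (∑ i ∈ s, d i : ℕ)) (by omega)) (hd i hi)
    rw [← mul_assoc, ← zpow_add₀ hv] at this
    convert this using 3
    ring
  choose! a ha using fun i hi => exists_intCast_sub_mem (hint i hi)
  -- With all c_i integral at infinity, the reduction is ∑ a_i² = 1: exactly one a_i is ±1 and the
  -- others vanish.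
  have h1 : ∑ i ∈ s, a i ^ 2 = 1 := by
    have := valInf.map_sub_lt h (key c a hint ha)
    rw [sub_sub_sub_cancel_left] at this
    have h2 := valInf_intCast (a := ∑ i ∈ s, a i ^ 2 - 1) (by push_cast at this ⊢; exact this)
    omega
  obtain ⟨j, hj, hj0⟩ : ∃ j ∈ s, a j ≠ 0 := by
    by_contra! hcon
    rw [Finset.sum_eq_zero fun i hi => by rw [hcon i hi]; rfl] at h1
    omega
  have hj1 : 1 ≤ a j ^ 2 := by have := sq_pos_of_ne_zero hj0; omega
  rw [← Finset.add_sum_erase _ _ hj] at h1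
  have h2 : 0 ≤ ∑ i ∈ s.erase j, a i ^ 2 := Finset.sum_nonneg fun i _ => sq_nonneg _
  have h3 : ∑ i ∈ s.erase j, a i ^ 2 = 0 := by omega
  refine ⟨j, hj, a j, ?_, ha j hj, fun i hi hij => ?_⟩
  · have : a j ^ 2 = 1 := by omega
    have h4 : (a j - 1) * (a j + 1) = 0 := by linarith
    rcases mul_eq_zero.mp h4 with h | h
    · left; rw [sub_eq_zero.mp h]; simp
    · right; rw [eq_neg_of_add_eq_zero_left h]; simp
  · have := (Finset.sum_eq_zero_iff_of_nonneg fun i _ => sq_nonneg (a i)).mp h3 i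
      (Finset.mem_erase.mpr ⟨hij, hi⟩)
    have h4 := ha i hi
    rwa [pow_eq_zero_iff two_ne_zero |>.mp this, Int.cast_zero, sub_zero] at h4

/-! ### Unitriangular families -/

section Unitriangular

variable {ι V : Type*} [AddCommGroup V] [Module K V]

/-- The family `C` is unitriangular with respect to the basis `E` graded by `h`. -/
def IsUnitriangular (E : Module.Basis ι K V) (h : ι → ℕ) (C : ι → V) : Prop :=
  ∀ i, C i - E i ∈ Submodule.span K (E '' {j | h j < h i})

namespace IsUnitriangular

variable {E : Module.Basis ι K V} {h : ι → ℕ} {C : ι → V}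

theorem repr_apply (hC : IsUnitriangular E h C) {i j : ι} (hij : h j ≤ h i) :
    E.repr (C j) i = Finsupp.single j 1 i := by
  have h1 := E.mem_span_image.mp (hC j)
  have h2 : E.repr (C j - E j) i = 0 := by
    by_contra hne
    have : h i < h j := h1 (Finsupp.mem_support_iff.mpr hne)
    omega
  rw [map_sub, Finsupp.sub_apply, E.repr_self, sub_eq_zero] at h2
  exact h2

/-- At an index of maximal height no other member of the family contributes, so the coordinate in
the basis `E` is the coefficient itself. Independence and the uniqueness argument both rest on this.
-/
theorem repr_linearCombination (hC : IsUnitriangular E h C) {l : ι →₀ K} {i : ι}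
    (hi : ∀ j ∈ l.support, h j ≤ h i) : E.repr (Finsupp.linearCombination K C l) i = l i := by
  classical
  rw [Finsupp.linearCombination_apply, Finsupp.sum, map_sum, Finsupp.finsetSum_apply]
  have : ∀ j ∈ l.support, E.repr (l j • C j) i = if i = j then l j else 0 := by
    intro j hj
    rw [map_smul, Finsupp.smul_apply, hC.repr_apply (hi j hj), Finsupp.single_apply, smul_eq_mul]
    simp only [eq_comm, mul_ite, mul_one, mul_zero]
  rw [Finset.sum_congr rfl this, Finset.sum_ite_eq]
  split_ifs with hl
  · rfl
  · exact (Finsupp.notMem_support_iff.mp hl).symm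

theorem linearIndependent (hC : IsUnitriangular E h C) : LinearIndependent K C := by
  rw [linearIndependent_iff]
  intro l hl
  by_contra hne
  obtain ⟨i, hi, hmax⟩ := l.support.exists_max_image h (Finsupp.support_nonempty_iff.mpr hne)
  have := hC.repr_linearCombination hmax
  rw [hl, map_zero] at this
  exact Finsupp.mem_support_iff.mp hi this.symm

/-- The inverse of a unitriangular matrix, over a subring of coefficients. -/
theorem mem_span_of_subring {R : Type*} [Ring R] [Module R V]
    (hC : ∀ i, C i - E i ∈ Submodule.span R (E '' {j | h j < h i})) (i : ι) :
    E i ∈ Submodule.span R (C '' {j | h j < h i + 1}) := by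
  induction hn : h i using Nat.strong_induction_on generalizing i with
  | _ n ih =>
    subst hn
    have h1 : Submodule.span R (E '' {j | h j < h i}) ≤
        Submodule.span R (C '' {j | h j < h i + 1}) := by
      rw [Submodule.span_le]
      rintro _ ⟨j, hj, rfl⟩
      have hj' : h j < h i := hj
      exact Submodule.span_mono (Set.image_mono fun k hk => by
        have hk' : h k < h j + 1 := hk
        change h k < h i + 1
        omega) (ih (h j) hj' j rfl)
    have h2 : C i ∈ Submodule.span R (C '' {j | h j < h i + 1}) :=
      Submodule.subset_span ⟨i, Nat.lt_succ_self _, rfl⟩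
    have := sub_mem h2 (h1 (hC i))
    rwa [sub_sub_cancel] at this

theorem span_image_le (hC : IsUnitriangular E h C) (n : ℕ) :
    Submodule.span K (E '' {j | h j < n}) ≤ Submodule.span K (C '' {j | h j < n}) := by
  rw [Submodule.span_le]
  rintro _ ⟨j, hj, rfl⟩
  have hj' : h j < n := hj
  exact Submodule.span_mono (Set.image_mono fun k hk => by
    have hk' : h k < h j + 1 := hk
    change h k < n
    omega) (mem_span_of_subring hC j)

theorem span_eq_top (hC : IsUnitriangular E h C) : Submodule.span K (Set.range C) = ⊤ := by
  rw [eq_top_iff, ← E.span_eq, Submodule.span_le]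
  rintro _ ⟨i, rfl⟩
  exact Submodule.span_mono (Set.image_subset_range _ _) (mem_span_of_subring hC i)

/-- The basis formed by a unitriangular family. -/
def basis (hC : IsUnitriangular E h C) : Module.Basis ι K V :=
  Module.Basis.mk hC.linearIndependent hC.span_eq_top.ge

@[simp]
theorem basis_apply (hC : IsUnitriangular E h C) (i : ι) : hC.basis i = C i := by simp [basis]

/-- A bar invariant element with coordinates in `v⁻¹ℤ[v⁻¹]` is zero. -/
theorem eq_zero_of_bar_invariant (hC : IsUnitriangular E h C) (ψ : V →ₛₗ[barK] V)
    (hψ : ∀ i, ψ (C i) = C i) {z : V} (hz : ψ z = z) (hcoef : ∀ i, E.repr z i ∈ vInvIdeal) :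
    z = 0 := by
  obtain ⟨l, hl⟩ : ∃ l, l = hC.basis.repr z := ⟨_, rfl⟩
  have hzl : Finsupp.linearCombination K C l = z := by
    have := hC.basis.linearCombination_repr z
    rwa [← hl, show ⇑hC.basis = C from funext hC.basis_apply] at this
  -- Applying ψ conjugates the coefficients of z in the family `C`; z is fixed and `C` is
  -- independent, so every coefficient is bar invariant.
  have hbar : ∀ i, barK (l i) = l i := by
    have h1 : Finsupp.linearCombination K C (l.mapRange barK (map_zero _)) = z := by
      rw [← hz, ← hzl, Finsupp.linearCombination_apply, Finsupp.linearCombination_apply,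
        Finsupp.sum_mapRange_index (by simp), Finsupp.sum, Finsupp.sum, map_sum]
      refine Finset.sum_congr rfl fun i _ => ?_
      rw [map_smulₛₗ, hψ]
    have h2 : l.mapRange barK (map_zero _) = l :=
      hC.linearIndependent.finsuppLinearCombination_injective (h1.trans hzl.symm)
    intro i
    have := DFunLike.congr_fun h2 i
    simpa using this
  have hl0 : l = 0 := by
    by_contra hne
    -- At a support index of maximal height the coefficient is also a coordinate of z in `E`. It is
    -- then both bar invariant and in v⁻¹ℤ[v⁻¹], hence zero.
    obtain ⟨i, hi, hmax⟩ := l.support.exists_max_image h (Finsupp.support_nonempty_iff.mpr hne)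
    have h1 := hC.repr_linearCombination hmax
    rw [hzl] at h1
    exact Finsupp.mem_support_iff.mp hi (eq_zero_of_bar_eq (h1 ▸ hcoef i) (hbar i))
  rw [← hzl, hl0, map_zero]

end IsUnitriangular
end Unitriangular

end
end FramedTensor

open scoped TensorProduct
namespace FramedTensor
noncomputable section

/-! ### The tight monomials of type `A₂` -/

/-- `θ_{i'}^{(b)} θ_i^{(a+b)} θ_{i'}^{(c)}`. -/
def monoA (a b c : ℕ) : HalfAlg A2 := dp θi' b * dp θi (a + b) * dp θi' c

/-- `θ_i^{(a)} θ_{i'}^{(b+c)} θ_i^{(b)}`. -/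
def monoB (a b c : ℕ) : HalfAlg A2 := dp θi a * dp θi' (b + c) * dp θi b

theorem monoA_eq (a b c : ℕ) : monoA a b c = ∑ u ∈ Finset.range (b + 1),
    (v ^ (-(((a : ℤ) + u) * u)) * gauss u c) • pbw (a + u, b - u, c + u) :=
  rootTriple_A2.expand_yxy a b c

theorem monoB_eq (a b c : ℕ) : monoB a b c = ∑ u ∈ Finset.range (b + 1),
    (v ^ (-(((c : ℤ) + u) * u)) * gauss a u) • pbw (a + u, b - u, c + u) :=
  rootTriple_A2.expand_xyx a b c

/-- For a = c the PBW expansions agree term by term, by the symmetry of Gaussian binomials. -/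
theorem monoA_eq_monoB (a b : ℕ) : monoA a b a = monoB a b a := by
  rw [monoA_eq, monoB_eq]
  simp only [gauss_comm]

/-- The canonical basis element with leading PBW term `(a, b, c)`. -/
def can (p : ℕ × ℕ × ℕ) : HalfAlg A2 :=
  if p.2.2 ≤ p.1 then monoA p.1 p.2.1 p.2.2 else monoB p.1 p.2.1 p.2.2

theorem can_of_le {a b c : ℕ} (h : c ≤ a) : can (a, b, c) = monoA a b c := if_pos h

theorem can_of_ge {a b c : ℕ} (h : a ≤ c) : can (a, b, c) = monoB a b c := by
  rcases h.eq_or_lt with rfl | h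
  · rw [can_of_le le_rfl, monoA_eq_monoB]
  · exact if_neg (by simpa using h)

/-- The coefficients of the canonical basis in the PBW basis. -/
def canCoeff (a c u : ℕ) : K :=
  if c ≤ a then v ^ (-(((a : ℤ) + u) * u)) * gauss u c else v ^ (-(((c : ℤ) + u) * u)) * gauss a u

theorem can_eq (a b c : ℕ) : can (a, b, c) =
    ∑ u ∈ Finset.range (b + 1), canCoeff a c u • pbw (a + u, b - u, c + u) := by
  rcases le_or_gt c a with h | h
  · simp only [can_of_le h, monoA_eq, canCoeff, if_pos h]
  · simp only [can_of_ge h.le, monoB_eq, canCoeff, if_neg (not_le.mpr h)]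

theorem canCoeff_zero (a c : ℕ) : canCoeff a c 0 = 1 := by
  simp [canCoeff, gauss_zero_left, gauss_zero_right]

/-- With u ≥ 1 the exponent (a+u)u exceeds the degree uc of the Gaussian binomial when c ≤ a, and
(c+u)u exceeds au when a ≤ c. This is why the family changes at a = c. -/
theorem canCoeff_succ_mem (a c u : ℕ) : canCoeff a c (u + 1) ∈ vInvIdeal := by
  rw [canCoeff]
  split_ifs with h
  · refine v_zpow_mul_gauss_mem _ _ ?_
    have : (c : ℤ) ≤ a := by exact_mod_cast h
    push_cast
    nlinarith
  · refine v_zpow_mul_gauss_mem _ _ ?_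
    have : (a : ℤ) ≤ c := by exact_mod_cast (not_le.mp h).le
    push_cast
    nlinarith

theorem can_sub_pbw (a b c : ℕ) : can (a, b, c) - pbw (a, b, c) =
    ∑ u ∈ Finset.range b, canCoeff a c (u + 1) • pbw (a + (u + 1), b - (u + 1), c + (u + 1)) := by
  rw [can_eq, Finset.sum_range_succ', canCoeff_zero, one_smul]
  simp

/-- The scalar ring is left open because unitriangularity is needed twice: over ℚ(v), and over ℤ[v,
v⁻¹] to compare lattices. -/
theorem can_sub_pbw_mem {R : Type*} [Ring R] [Module R (HalfAlg A2)] (p : ℕ × ℕ × ℕ)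
    (hR : ∀ c ∈ vInvIdeal, ∀ x : HalfAlg A2, ∃ c' : R, c • x = c' • x) :
    can p - pbwBasis p ∈ Submodule.span R (pbwBasis '' {q | q.2.1 < p.2.1}) := by
  obtain ⟨a, b, c⟩ := p
  rw [pbwBasis_apply, can_sub_pbw]
  refine sum_mem fun u hu => ?_
  have hub := Finset.mem_range.mp hu
  obtain ⟨c', hc'⟩ := hR _ (canCoeff_succ_mem a c u) (pbw (a + (u + 1), b - (u + 1), c + (u + 1)))
  rw [hc']
  refine Submodule.smul_mem _ _ (Submodule.subset_span ⟨_, ?_, pbwBasis_apply _⟩)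
  change b - (u + 1) < b
  omega

theorem isUnitriangular_can : IsUnitriangular pbwBasis (fun p => p.2.1) can :=
  fun p => can_sub_pbw_mem p fun c _ _ => ⟨c, rfl⟩

/-- No relation between a and c is imposed: even where this monomial is not canonical, its leading
term is the same. -/
theorem monoA_sub_pbw_mem (a b c : ℕ) :
    monoA a b c - pbw (a, b, c) ∈ Submodule.span K (pbwBasis '' {q | q.2.1 < b}) := by
  rw [monoA_eq, Finset.sum_range_succ', Nat.cast_zero, mul_zero, neg_zero, zpow_zero, one_mul,
    gauss_zero_left, one_smul, add_sub_assoc]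
  simp only [add_zero, Nat.sub_zero, sub_self]
  refine sum_mem fun u hu => Submodule.smul_mem _ _ (Submodule.subset_span ⟨_, ?_,
    pbwBasis_apply _⟩)
  have hub := Finset.mem_range.mp hu
  change b - (u + 1) < b
  omega

theorem repr_can_self (p : ℕ × ℕ × ℕ) : pbwBasis.repr (can p) p = 1 := by
  rw [isUnitriangular_can.repr_apply le_rfl, Finsupp.single_eq_same]

theorem repr_pbw (p q : ℕ × ℕ × ℕ) : pbwBasis.repr (pbw p) q = Finsupp.single p 1 q := by
  rw [← pbwBasis_apply, pbwBasis.repr_self]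

theorem repr_can_sub_pbw_mem (p q : ℕ × ℕ × ℕ) :
    pbwBasis.repr (can p - pbw p) q ∈ vInvIdeal := by
  classical
  obtain ⟨a, b, c⟩ := p
  rw [can_sub_pbw, map_sum, Finsupp.finsetSum_apply]
  refine sum_mem fun u _ => ?_
  rw [map_smul, Finsupp.smul_apply, repr_pbw, Finsupp.single_apply, smul_eq_mul]
  split_ifs
  · rw [mul_one]; exact canCoeff_succ_mem a c u
  · rw [mul_zero]; exact zero_mem _

theorem repr_can_mem {p q : ℕ × ℕ × ℕ} (h : q ≠ p) : pbwBasis.repr (can p) q ∈ vInvIdeal := by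
  have := repr_can_sub_pbw_mem p q
  rwa [map_sub, Finsupp.sub_apply, repr_pbw, Finsupp.single_eq_of_ne h, sub_zero] at this

theorem exists_of_repr_can_ne_zero {a b c : ℕ} {q : ℕ × ℕ × ℕ}
    (h : pbwBasis.repr (can (a, b, c)) q ≠ 0) : ∃ u ≤ b, q = (a + u, b - u, c + u) := by
  classical
  rw [can_eq, map_sum, Finsupp.finsetSum_apply] at h
  obtain ⟨u, hu, hne⟩ := Finset.exists_ne_zero_of_sum_ne_zero h
  refine ⟨u, Nat.lt_succ_iff.mp (Finset.mem_range.mp hu), ?_⟩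
  by_contra hq
  rw [map_smul, Finsupp.smul_apply, repr_pbw, Finsupp.single_eq_of_ne hq, smul_zero] at hne
  exact hne rfl

theorem bar_dp {I : Type} (C : CartanDatum I) (x : HalfAlg C) (n : ℕ) :
    bar C (dp x n) = dp (bar C x) n := by
  rw [dp, dp, bar_smul, map_inv₀, barK_qFact, map_pow]

theorem bar_dp_θi (n : ℕ) : bar A2 (dp θi n) = dp θi n := by rw [bar_dp, θi, bar_θ]

theorem bar_dp_θi' (n : ℕ) : bar A2 (dp θi' n) = dp θi' n := by rw [bar_dp, θi', bar_θ]

theorem bar_can (p : ℕ × ℕ × ℕ) : bar A2 (can p) = can p := by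
  rw [can]
  split_ifs <;> simp only [monoA, monoB, map_mul, bar_dp_θi, bar_dp_θi']

theorem can_mem_integralForm (p : ℕ × ℕ × ℕ) : can p ∈ integralForm A2 := by
  have h : ∀ n, dp θi n ∈ integralForm A2 := fun n => Algebra.subset_adjoin ⟨.inl (), n, rfl⟩
  have h' : ∀ n, dp θi' n ∈ integralForm A2 := fun n => Algebra.subset_adjoin ⟨.inr (), n, rfl⟩
  rw [can]
  split_ifs
  · exact mul_mem (mul_mem (h' _) (h _)) (h' _)
  · exact mul_mem (mul_mem (h _) (h' _)) (h _)

/-! ### The swap on the canonical basis -/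

/-- The action of `swapAlg` on the indices of the canonical basis. -/
def swapIdx (p : ℕ × ℕ × ℕ) : ℕ × ℕ × ℕ :=
  if p.2.2 ≤ p.1 then (p.2.1, p.2.2, p.1 + p.2.1 - p.2.2) else (p.2.1 + p.2.2 - p.1, p.1, p.2.1)

theorem swapIdx_of_le {a b c : ℕ} (h : c ≤ a) : swapIdx (a, b, c) = (b, c, a + b - c) := if_pos h

theorem swapIdx_of_gt {a b c : ℕ} (h : a < c) : swapIdx (a, b, c) = (b + c - a, a, b) :=
  if_neg (by simpa using h)

/-- The swap carries y^{(b)} x^{(a+b)} y^{(c)} to x^{(b)} y^{(a+b)} x^{(c)}, so it exchanges the two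
families. The condition c ≤ a becomes b ≤ a + b - c, which places the image on the correct side. -/
theorem swapAlg_can (p : ℕ × ℕ × ℕ) : swapAlg (can p) = can (swapIdx p) := by
  obtain ⟨a, b, c⟩ := p
  rcases le_or_gt c a with h | h
  · rw [can_of_le h, swapIdx_of_le h, can_of_ge (by omega), monoA, monoB,
      show c + (a + b - c) = a + b by omega]
    simp only [map_mul, map_dp, swapAlg_θi, swapAlg_θi']
  · rw [can_of_ge h.le, swapIdx_of_gt h, can_of_le (by omega), monoA, monoB,
      show b + c - a + a = b + c by omega]
    simp only [map_mul, map_dp, swapAlg_θi, swapAlg_θi']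

/-! ### The integral form -/

/-- The `ℤ[v, v⁻¹]`-span of the PBW basis. -/
def pbwLattice : Submodule laurentInt (HalfAlg A2) := Submodule.span laurentInt (Set.range pbw)

theorem smul_mem_pbwLattice {c : K} (hc : c ∈ laurentInt) {x : HalfAlg A2} (hx : x ∈ pbwLattice) :
    c • x ∈ pbwLattice :=
  pbwLattice.smul_mem ⟨c, hc⟩ hx

/-- Each description shows one symmetry: the PBW span is visibly stable under left multiplication by
θ_i^{(n)}, the span of the tight monomials under the swap. -/
theorem pbwLattice_eq_span_can :
    pbwLattice = Submodule.span laurentInt (Set.range can) := by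
  have ht : ∀ p, can p - pbwBasis p ∈
      Submodule.span laurentInt (pbwBasis '' {q | q.2.1 < p.2.1}) := fun p =>
    can_sub_pbw_mem p fun c hc x => ⟨⟨c, intVInv_le_laurentInt (vInvIdeal_le hc)⟩, rfl⟩
  apply le_antisymm
  · rw [pbwLattice, Submodule.span_le]
    rintro _ ⟨p, rfl⟩
    have h1 := IsUnitriangular.mem_span_of_subring (R := laurentInt) (E := pbwBasis) (C := can)
      (h := fun p => p.2.1) ht p
    rw [pbwBasis_apply] at h1
    exact Submodule.span_mono (Set.image_subset_range _ _) h1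
  · rw [Submodule.span_le]
    rintro _ ⟨p, rfl⟩
    have h1 : pbwBasis p ∈ pbwLattice := Submodule.subset_span ⟨p, (pbwBasis_apply p).symm⟩
    have h2 : can p - pbwBasis p ∈ pbwLattice := by
      refine Submodule.span_mono ?_ (ht p)
      rintro _ ⟨q, -, rfl⟩
      exact ⟨q, (pbwBasis_apply q).symm⟩
    have := add_mem h2 h1
    rwa [sub_add_cancel] at this

theorem swapAlg_mem_pbwLattice {x : HalfAlg A2} (hx : x ∈ pbwLattice) :
    swapAlg x ∈ pbwLattice := by
  rw [pbwLattice_eq_span_can] at hx ⊢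
  induction hx using Submodule.span_induction with
  | mem x hx =>
    obtain ⟨p, rfl⟩ := hx
    exact Submodule.subset_span ⟨swapIdx p, (swapAlg_can p).symm⟩
  | zero => rw [map_zero]; exact zero_mem _
  | add x y _ _ hx hy => rw [map_add]; exact add_mem hx hy
  | smul c x _ hx =>
    have : swapAlg (c • x) = c • swapAlg x := map_smul swapAlg (c : K) x
    rw [this]
    exact Submodule.smul_mem _ _ hx

theorem dp_θi_mul_pbw (n a b c : ℕ) :
    dp θi n * pbw (a, b, c) = gauss n a • pbw (n + a, b, c) := by
  rw [pbw_eq, pbw_eq, mul_assoc, ← mul_assoc, dp_mul_dp, smul_mul_assoc, mul_assoc]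

theorem dp_θi_mul_mem (n : ℕ) {x : HalfAlg A2} (hx : x ∈ pbwLattice) :
    dp θi n * x ∈ pbwLattice := by
  induction hx using Submodule.span_induction with
  | mem x hx =>
    obtain ⟨⟨a, b, c⟩, rfl⟩ := hx
    rw [dp_θi_mul_pbw]
    exact smul_mem_pbwLattice (gauss_mem_laurentInt _ _) (Submodule.subset_span ⟨_, rfl⟩)
  | zero => rw [mul_zero]; exact zero_mem _
  | add x y _ _ hx hy => rw [mul_add]; exact add_mem hx hy
  | smul c x _ hx =>
    have : dp θi n * (c • x) = c • (dp θi n * x) := mul_smul_comm (c : K) _ x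
    rw [this]
    exact Submodule.smul_mem _ _ hx

/-- Left multiplication by θ_{i'}^{(n)} is the conjugate by the swap of that by θ_i^{(n)}, so both
preserve the lattice, which contains 1. -/
theorem integralForm_le {x : HalfAlg A2} (hx : x ∈ integralForm A2) : x ∈ pbwLattice := by
  have key : ∀ s ∈ pbwLattice, x * s ∈ pbwLattice := by
    induction hx using Algebra.adjoin_induction with
    | mem x hx =>
      intro s hs
      obtain ⟨j | j, n, rfl⟩ := hx
      · exact dp_θi_mul_mem n hs
      · have := swapAlg_mem_pbwLattice (dp_θi_mul_mem n (swapAlg_mem_pbwLattice hs))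
        rw [map_mul, swapAlg_swapAlg, map_dp, swapAlg_θi] at this
        exact this
    | algebraMap c => intro s hs; rw [← Algebra.smul_def]; exact Submodule.smul_mem _ _ hs
    | add x y _ _ hx hy => intro s hs; rw [add_mul]; exact add_mem (hx s hs) (hy s hs)
    | mul x y _ _ hx hy => intro s hs; rw [mul_assoc]; exact hx _ (hy s hs)
  have h1 : (1 : HalfAlg A2) ∈ pbwLattice :=
    Submodule.subset_span ⟨(0, 0, 0), by simp [pbw_eq, dp_zero]⟩
  simpa using key 1 h1

theorem repr_mem_laurentInt {x : HalfAlg A2} (hx : x ∈ pbwLattice) (p : ℕ × ℕ × ℕ) :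
    pbwBasis.repr x p ∈ laurentInt := by
  classical
  induction hx using Submodule.span_induction with
  | mem x hx =>
    obtain ⟨q, rfl⟩ := hx
    rw [repr_pbw, Finsupp.single_apply]
    split_ifs
    · exact one_mem _
    · exact zero_mem _
  | zero => simp
  | add x y _ _ hx hy => rw [map_add]; exact add_mem hx hy
  | smul c x _ hx =>
    have : pbwBasis.repr (c • x) = (c : K) • pbwBasis.repr x := map_smul pbwBasis.repr (c : K) x
    rw [this]
    exact mul_mem c.2 hx

/-! ### The signed basis -/

theorem valInf_le_one_of_sub_one {x : K} (h : valInf (x - 1) < 1) : valInf x ≤ 1 := by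
  have := valInf.map_add_le h.le (valInf.map_one.le)
  rwa [sub_add_cancel] at this

theorem valInf_mul_sub_one {x y : K} (hx : valInf (x - 1) < 1) (hy : valInf (y - 1) < 1) :
    valInf (x * y - 1) < 1 := by
  have e : x * y - 1 = (x - 1) * y + (y - 1) := by ring
  rw [e]
  refine valInf.map_add_lt ?_ hy
  rw [map_mul]
  exact mul_lt_one_of_lt_of_le hx (valInf_le_one_of_sub_one hy)

theorem valInf_dpNorm_sub_one (a : ℕ) : valInf (dpNorm a - 1) < 1 := by
  rw [dpNorm]
  induction a with
  | zero => simp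
  | succ a ih =>
    rw [Finset.prod_range_succ]
    refine valInf_mul_sub_one ih ?_
    have h0 := one_sub_zpow_ne_zero (k := -2 * ((a : ℤ) + 1)) (by omega)
    have h1 := valInf_v_zpow (k := -2 * ((a : ℤ) + 1)) (by omega)
    set x := v ^ (-2 * ((a : ℤ) + 1))
    have e : (1 - x)⁻¹ - 1 = x * (1 - x)⁻¹ := by field_simp; ring
    rw [e, map_mul, map_inv₀, valInf.map_one_sub_of_lt h1, inv_one, mul_one]
    exact h1

/-- The norm of a PBW basis element. -/
def pbwNorm (p : ℕ × ℕ × ℕ) : K := dpNorm p.1 * (dpNorm p.2.1 * dpNorm p.2.2)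

theorem valInf_pbwNorm_sub_one (p : ℕ × ℕ × ℕ) : valInf (pbwNorm p - 1) < 1 :=
  valInf_mul_sub_one (valInf_dpNorm_sub_one _)
    (valInf_mul_sub_one (valInf_dpNorm_sub_one _) (valInf_dpNorm_sub_one _))

theorem form_self (x : HalfAlg A2) : form A2 x x =
    ∑ p ∈ (pbwBasis.repr x).support, pbwBasis.repr x p ^ 2 * pbwNorm p := by
  classical
  have hx := pbwBasis.linearCombination_repr x
  rw [Finsupp.linearCombination_apply, Finsupp.sum] at hx
  conv_lhs => rw [← hx]
  rw [map_sum]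
  refine Finset.sum_congr rfl fun p hp => ?_
  rw [map_smul, map_sum, LinearMap.sum_apply, Finset.sum_eq_single_of_mem p hp]
  · rw [map_smul, LinearMap.smul_apply, pbwBasis_apply, form_pbw, if_pos rfl, pbwNorm, smul_eq_mul,
      smul_eq_mul]
    ring
  · intro q _ hqp
    rw [map_smul, LinearMap.smul_apply, pbwBasis_apply, pbwBasis_apply, form_pbw, if_neg hqp,
      smul_zero]

theorem can_mem_signedBasis (p : ℕ × ℕ × ℕ) : can p ∈ signedBasis A2 := by
  classical
  refine ⟨can_mem_integralForm p, bar_can p, ?_⟩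
  have hp : p ∈ (pbwBasis.repr (can p)).support := by
    rw [Finsupp.mem_support_iff, repr_can_self]
    exact one_ne_zero
  rw [vanishesAtInfinity_iff, form_self, ← Finset.add_sum_erase _ _ hp, repr_can_self, one_pow,
    one_mul, add_sub_right_comm]
  -- The diagonal term is a norm in 1 + v⁻¹𝐀; every other term contains the square of an element of
  -- v⁻¹ℤ[v⁻¹].
  refine valInf.map_add_lt (valInf_pbwNorm_sub_one p) (valInf.map_sum_lt one_ne_zero fun q hq => ?_)
  rw [map_mul, map_pow]
  exact mul_lt_one_of_lt_of_le (pow_lt_one₀ zero_le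
    (valInf_lt_one (repr_can_mem (Finset.ne_of_mem_erase hq))) two_ne_zero)
    (valInf_le_one_of_sub_one (valInf_pbwNorm_sub_one q))

/-- Integrality gives Laurent coordinates and the norm condition singles out one of them as ±1 at
infinity. Subtracting ± the matching `can p` leaves a bar invariant vector with all coordinates in
v⁻¹ℤ[v⁻¹], which is zero. -/
theorem eq_smul_can_of_mem_signedBasis {x : HalfAlg A2} (hx : x ∈ signedBasis A2) :
    ∃ p, ∃ ε : K, (ε = 1 ∨ ε = -1) ∧ x = ε • can p := by
  obtain ⟨hint, hbar, hnorm⟩ := hx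
  rw [vanishesAtInfinity_iff, form_self] at hnorm
  obtain ⟨p, -, ε, hε, hp, hq⟩ := exists_unique_sign _ _ _
    (fun q _ => repr_mem_laurentInt (integralForm_le hint) q)
    (fun q _ => valInf_pbwNorm_sub_one q) hnorm
  refine ⟨p, ε, hε, ?_⟩
  have hεbar : barK ε = ε := by rcases hε with rfl | rfl <;> simp
  have hεint : ε ∈ intVInv := by
    rcases hε with rfl | rfl
    · exact one_mem _
    · exact neg_mem (one_mem _)
  rw [← sub_eq_zero]
  refine isUnitriangular_can.eq_zero_of_bar_invariant (barLin A2) bar_can ?_ fun q => ?_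
  · change bar A2 _ = _
    rw [map_sub, hbar, bar_smul, bar_can, hεbar]
  · rw [map_sub, map_smul, Finsupp.sub_apply, Finsupp.smul_apply, smul_eq_mul]
    by_cases hqp : q = p
    · rw [hqp, repr_can_self, mul_one]
      exact hp
    · refine sub_mem ?_ (mul_mem_vInvIdeal hεint (repr_can_mem hqp))
      by_cases hqs : q ∈ (pbwBasis.repr x).support
      · exact hq q hqs hqp
      · rw [Finsupp.notMem_support_iff.mp hqs]
        exact zero_mem _

/-! ### The canonical basis of type `A₂` -/

theorem repr_eq_zero_of_mem_powLeft {x : HalfAlg A2} {n : ℕ} (hx : x ∈ powLeft A2 (.inl ()) n)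
    {p : ℕ × ℕ × ℕ} (hp : p.1 < n) : pbwBasis.repr x p = 0 := by
  obtain ⟨y, rfl⟩ := hx
  have : y ∈ (⊤ : Submodule K (HalfAlg A2)) := trivial
  rw [← span_pbw] at this
  change pbwBasis.repr (θi ^ n * y) p = 0
  induction this using Submodule.span_induction with
  | mem x hx =>
    obtain ⟨⟨a, b, c⟩, rfl⟩ := hx
    rw [pow_eq_dp, smul_mul_assoc, dp_θi_mul_pbw, map_smul, map_smul, Finsupp.smul_apply,
      Finsupp.smul_apply, repr_pbw, Finsupp.single_eq_of_ne, smul_zero, smul_zero]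
    rintro rfl
    change n + a < n at hp
    omega
  | zero => simp
  | add x y _ _ hx hy => rw [mul_add, map_add, Finsupp.add_apply, hx, hy, add_zero]
  | smul c x _ hx => rw [mul_smul_comm, map_smul, Finsupp.smul_apply, hx, smul_zero]

/-- All PBW terms of the element have θ_i-exponent at least that of the leading term, and the
leading coefficient is 1. -/
theorem can_mem_powLeft_inl {p : ℕ × ℕ × ℕ} {n : ℕ} :
    can p ∈ powLeft A2 (.inl ()) n ↔ n ≤ p.1 := by
  constructor
  · intro h
    by_contra hn
    have := repr_eq_zero_of_mem_powLeft h (p := p) (by omega)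
    rw [repr_can_self] at this
    exact one_ne_zero this
  · intro h
    obtain ⟨a, b, c⟩ := p
    obtain ⟨d, rfl⟩ : ∃ d, a = n + d := ⟨a - n, by simp at h; omega⟩
    refine ⟨∑ u ∈ Finset.range (b + 1), canCoeff (n + d) c u • (qFact (n + d + u))⁻¹ •
      (θi ^ (d + u) * (dp θT (b - u) * dp θi' (c + u))), ?_⟩
    change _ = θi ^ n * _
    rw [can_eq, Finset.mul_sum]
    refine Finset.sum_congr rfl fun u _ => ?_
    rw [mul_smul_comm, mul_smul_comm, ← mul_assoc, ← pow_add, pbw_eq, mul_assoc, dp,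
      smul_mul_assoc, add_assoc]

theorem swapAlg_mem_powLeft {x : HalfAlg A2} {n : ℕ} :
    swapAlg x ∈ powLeft A2 (.inl ()) n ↔ x ∈ powLeft A2 (.inr ()) n := by
  constructor
  · rintro ⟨y, hy⟩
    refine ⟨swapAlg y, ?_⟩
    rw [← swapAlg_swapAlg x, hy, map_mul, map_pow]
    exact congrArg (· ^ n * _) swapAlg_θi
  · rintro ⟨y, rfl⟩
    refine ⟨swapAlg y, ?_⟩
    rw [map_mul, map_pow]
    exact congrArg (· ^ n * _) swapAlg_θi'

theorem can_mem_powLeft_inr {p : ℕ × ℕ × ℕ} {n : ℕ} :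
    can p ∈ powLeft A2 (.inr ()) n ↔ n ≤ (swapIdx p).1 := by
  rw [← swapAlg_mem_powLeft, swapAlg_can, can_mem_powLeft_inl]

theorem zero_mem_powLeft {I : Type} (C : CartanDatum I) (i : I) (n : ℕ) :
    (0 : HalfAlg C) ∈ powLeft C i n := ⟨0, by simp⟩

/-- The special case of the inductive step in which θ_i^{(n)}b is already the new element, so the
required congruence is an equality. -/
theorem isCanonical_inl {n : ℕ} (hn : 0 < n) {p q : ℕ × ℕ × ℕ} (hp : IsCanonical A2 (can p))
    (hp0 : p.1 = 0) (hq : q.1 = n) (h : can q = dp θi n * can p) : IsCanonical A2 (can q) := by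
  refine .step (.inl ()) n _ _ hn hp ?_ (can_mem_signedBasis q) ?_ ?_ ?_
  · rw [can_mem_powLeft_inl]; omega
  · rw [can_mem_powLeft_inl]; omega
  · rw [can_mem_powLeft_inl]; omega
  · rw [h]
    change dp θi n * can p - _ ∈ _
    rw [sub_self]
    exact zero_mem_powLeft _ _ _

theorem isCanonical_inr {n : ℕ} (hn : 0 < n) {p q : ℕ × ℕ × ℕ} (hp : IsCanonical A2 (can p))
    (hp0 : (swapIdx p).1 = 0) (hq : (swapIdx q).1 = n) (h : can q = dp θi' n * can p) :
    IsCanonical A2 (can q) := by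
  refine .step (.inr ()) n _ _ hn hp ?_ (can_mem_signedBasis q) ?_ ?_ ?_
  · rw [can_mem_powLeft_inr]; omega
  · rw [can_mem_powLeft_inr]; omega
  · rw [can_mem_powLeft_inr]; omega
  · rw [h]
    change dp θi' n * can p - _ ∈ _
    rw [sub_self]
    exact zero_mem_powLeft _ _ _

/-- Each tight monomial is built from 1 by left multiplications with divided powers, every
intermediate product being one of the `can q` and not left divisible by the next generator: y^{(c)},
x^{(a+b)}y^{(c)}, y^{(b)}x^{(a+b)}y^{(c)} for c ≤ a, and x^{(b)}, y^{(b+c)}x^{(b)},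
x^{(a)}y^{(b+c)}x^{(b)} for a < c. -/
theorem isCanonical_can (p : ℕ × ℕ × ℕ) : IsCanonical A2 (can p) := by
  have h000 : can (0, 0, 0) = 1 := by simp [can_of_le le_rfl, monoA, dp_zero]
  have h00c : ∀ c, IsCanonical A2 (can (0, 0, c)) := by
    intro c
    rcases c.eq_zero_or_pos with rfl | hc
    · rw [h000]; exact .one
    · refine isCanonical_inr hc (p := (0, 0, 0)) (by rw [h000]; exact .one) rfl ?_ ?_
      · rw [swapIdx_of_gt hc]; simp
      · rw [h000, can_of_ge hc.le, monoB]; simp [dp_zero]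
  have ha0c : ∀ a c, c ≤ a → IsCanonical A2 (can (a, 0, c)) := by
    intro a c hca
    rcases a.eq_zero_or_pos with rfl | ha
    · exact h00c c
    · refine isCanonical_inl ha (h00c c) rfl rfl ?_
      rw [can_of_le hca, can_of_ge (Nat.zero_le c), monoA, monoB]; simp [dp_zero]
  obtain ⟨a, b, c⟩ := p
  rcases le_or_gt c a with hca | hca
  · rcases b.eq_zero_or_pos with rfl | hb
    · exact ha0c a c hca
    · refine isCanonical_inr hb (ha0c (a + b) c (by omega)) ?_ ?_ ?_
      · rw [swapIdx_of_le (by omega)]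
      · rw [swapIdx_of_le hca]
      · rw [can_of_le hca, can_of_le (by omega), monoA, monoA]; simp [dp_zero, mul_assoc]
  · have h0bc : IsCanonical A2 (can (0, b, c)) := by
      refine isCanonical_inr (n := b + c) (by omega) (ha0c b 0 (Nat.zero_le b)) ?_ ?_ ?_
      · rw [swapIdx_of_le (Nat.zero_le b)]
      · rw [swapIdx_of_gt (by omega)]; simp
      · rw [can_of_ge (Nat.zero_le c), can_of_le (Nat.zero_le b), monoB, monoA]; simp [dp_zero]
    rcases a.eq_zero_or_pos with rfl | ha
    · exact h0bc
    · refine isCanonical_inl ha h0bc rfl rfl ?_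
      rw [can_of_ge hca.le, can_of_ge (Nat.zero_le c), monoB, monoB]; simp [dp_zero, mul_assoc]

/-- Compare the PBW coordinate at (n, b, c). It is 1 in θ_i^{(n)} `can (0, b, c)`, whose other terms
have larger θ_i-exponent, and 0 in the difference, which lies in θ_i^{n+1}f. So ε times the
coordinate of `can q` is 1. As q has first entry at least n, this forces q = (n, b, c), where the
coordinate is 1. -/
theorem sign_eq_one {n : ℕ} {p q : ℕ × ℕ × ℕ} {ε : K} (hε : ε = 1 ∨ ε = -1)
    (hp : can p ∉ powLeft A2 (.inl ()) 1) (hq : ε • can q ∈ powLeft A2 (.inl ()) n)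
    (h : dp θi n * can p - ε • can q ∈ powLeft A2 (.inl ()) (n + 1)) : ε = 1 := by
  have hε0 : ε ≠ 0 := by rcases hε with rfl | rfl <;> simp
  rw [can_mem_powLeft_inl] at hp
  obtain ⟨a, b, c⟩ := p
  obtain rfl : a = 0 := by simp at hp; omega
  have hqn : n ≤ q.1 := by
    by_contra hn
    have := repr_eq_zero_of_mem_powLeft hq (p := q) (by omega)
    rw [map_smul, Finsupp.smul_apply, repr_can_self, smul_eq_mul, mul_one] at this
    exact hε0 this
  have h1 : pbwBasis.repr (dp θi n * can (0, b, c)) (n, b, c) = 1 := by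
    have e : dp θi n * can (0, b, c) = pbw (n, b, c) +
        dp θi n * (can (0, b, c) - pbw (0, b, c)) := by
      rw [mul_sub, dp_θi_mul_pbw, gauss_zero_right, one_smul, add_zero, add_sub_cancel]
    rw [e, map_add, Finsupp.add_apply, repr_pbw, Finsupp.single_eq_same, can_sub_pbw,
      Finset.mul_sum, map_sum, Finsupp.finsetSum_apply, Finset.sum_eq_zero, add_zero]
    intro u _
    rw [mul_smul_comm, dp_θi_mul_pbw, map_smul, map_smul, Finsupp.smul_apply, Finsupp.smul_apply,
      repr_pbw, Finsupp.single_eq_of_ne, smul_zero, smul_zero]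
    intro e
    have := congrArg Prod.fst e
    simp at this
  have h2 := repr_eq_zero_of_mem_powLeft h (p := (n, b, c)) (Nat.lt_succ_self n)
  rw [map_sub, Finsupp.sub_apply, h1, map_smul, Finsupp.smul_apply, smul_eq_mul] at h2
  have h3 : pbwBasis.repr (can q) (n, b, c) ≠ 0 := by
    intro h0
    rw [h0, mul_zero, sub_zero] at h2
    exact one_ne_zero h2
  obtain ⟨a', b', c'⟩ := q
  obtain ⟨u, hu, e⟩ := exists_of_repr_can_ne_zero h3
  simp only [Prod.mk.injEq] at e hqn
  obtain rfl : u = 0 := by omega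
  obtain ⟨rfl, rfl, rfl⟩ : n = a' ∧ b = b' ∧ c = c' := by omega
  rw [repr_can_self, mul_one, sub_eq_zero] at h2
  exact h2.symm

theorem canonicalBasis_A2 : canonicalBasis A2 = Set.range can := by
  ext x
  constructor
  · intro hx
    induction hx with
    | one => exact ⟨(0, 0, 0), by simp [can_of_le le_rfl, monoA, dp_zero]⟩
    | step i n b b' hn hb hbi hb' hin hnot h ih =>
      obtain ⟨p, rfl⟩ := ih
      obtain ⟨q, ε, hε, rfl⟩ := eq_smul_can_of_mem_signedBasis hb'
      refine ⟨q, ?_⟩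
      suffices ε = 1 by rw [this, one_smul]
      rcases i with i | i
      · exact sign_eq_one hε hbi hin h
      -- The step for θ_{i'} is reduced to the one for θ_i by the swap.
      · rw [← swapAlg_mem_powLeft, swapAlg_can] at hbi
        rw [← swapAlg_mem_powLeft, map_smul, swapAlg_can] at hin
        rw [← swapAlg_mem_powLeft, map_sub, map_smul, map_mul, map_dp, swapAlg_can,
          swapAlg_can] at h
        have e : swapAlg (θ A2 (.inr i)) = θi := swapAlg_θi'
        rw [e] at h
        exact sign_eq_one hε hbi hin h
  · rintro ⟨p, rfl⟩
    exact isCanonical_can p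

end
end FramedTensor

open scoped TensorProduct
namespace FramedTensor
noncomputable section

/-! ### The framed basis -/

theorem elemA_eq (m n k l : ℕ) : elemA m n k l = swapAlg (monoB (n - l) l (m - k)) := by
  simp only [elemA, monoB, map_mul, map_dp, swapAlg_θi, swapAlg_θi', add_comm l]

theorem elemB_eq {n l : ℕ} (m k : ℕ) (hl : l ≤ n) :
    elemB m n k l = swapAlg (monoA (n - l) l (m - k)) := by
  simp only [elemB, monoA, map_mul, map_dp, swapAlg_θi, swapAlg_θi', Nat.sub_add_cancel hl]

theorem elemA_eq_can {m n k l : ℕ} (h : n - l ≤ m - k) :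
    elemA m n k l = swapAlg (can (n - l, l, m - k)) := by
  rw [elemA_eq, can_of_ge h]

theorem elemB_eq_can {m n k l : ℕ} (hl : l ≤ n) (h : m - k ≤ n - l) :
    elemB m n k l = swapAlg (can (n - l, l, m - k)) := by
  rw [elemB_eq m k hl, can_of_le h]

theorem linearIndependent_swap_can : LinearIndependent K fun p => swapAlg (can p) :=
  isUnitriangular_can.linearIndependent.map' swapAlg.toLinearMap
    (LinearMap.ker_eq_bot.mpr (Function.LeftInverse.injective swapAlg_swapAlg))

theorem range_swap_can : (Set.range fun p => swapAlg (can p)) = canonicalBasis A2 := by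
  rw [canonicalBasis_A2]
  ext x
  constructor
  · rintro ⟨p, rfl⟩
    exact ⟨swapIdx p, (swapAlg_can p).symm⟩
  · rintro ⟨p, rfl⟩
    refine ⟨swapIdx p, ?_⟩
    rw [← swapAlg_swapAlg (can p), swapAlg_can p]

theorem appears_iff {I ι : Type} [DecidableEq I] (C : CartanDatum I) {B : ι → HalfAlg C}
    (hB : LinearIndependent K B) (hr : Set.range B = canonicalBasis C) (p : ι) (x : HalfAlg C) :
    Appears C (B p) x ↔ ∃ l : ι →₀ K, Finsupp.linearCombination K B l = x ∧ l p ≠ 0 := by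
  have hmem : ∀ q, B q ∈ canonicalBasis C := fun q => hr ▸ Set.mem_range_self q
  let e : ι → canonicalBasis C := fun q => ⟨B q, hmem q⟩
  have hinj : Function.Injective e := fun q q' h => hB.injective (congrArg Subtype.val h)
  have hsurj : Function.Surjective e := by
    rintro ⟨b, hb⟩
    obtain ⟨q, rfl⟩ : b ∈ Set.range B := hr.symm ▸ hb
    exact ⟨q, rfl⟩
  have hlc : ∀ l : ι →₀ K, Finsupp.linearCombination K (Subtype.val : canonicalBasis C → _)
      (l.mapDomain e) = Finsupp.linearCombination K B l := fun l =>
    Finsupp.linearCombination_mapDomain K _ _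
  constructor
  · rintro ⟨hb, c, hc, hne⟩
    obtain ⟨l, rfl⟩ := Finsupp.mapDomain_surjective hsurj c
    refine ⟨l, (hlc l).symm.trans hc, ?_⟩
    rwa [show (⟨B p, hb⟩ : canonicalBasis C) = e p from rfl, Finsupp.mapDomain_apply hinj] at hne
  · rintro ⟨l, hl, hne⟩
    refine ⟨hmem p, l.mapDomain e, (hlc l).trans hl, ?_⟩
    rwa [show (⟨B p, hmem p⟩ : canonicalBasis C) = e p from rfl, Finsupp.mapDomain_apply hinj]

/-! ### Monomials through θ_n and the θ_{i'}-degree -/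

theorem incl_dp (a : ℕ) : incl (dp θ₁ a) = dp θi a := by
  rw [map_dp]
  exact congrArg (dp · a) (lift_θ _ _ _ _)

theorem incl_θ₁ : incl θ₁ = θi := lift_θ _ _ _ _

theorem exists_incl_monomial (s : List ℕ) : ∃ (c : K) (a : ℕ), incl (monomial s) = c • dp θi a := by
  induction s with
  | nil => exact ⟨1, 0, by simp [monomial, dp_zero]⟩
  | cons b s ih =>
    obtain ⟨c, a, h⟩ := ih
    refine ⟨c * gauss b a, b + a, ?_⟩
    have e : monomial (b :: s) = dp θ₁ b * monomial s := by simp [monomial]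
    rw [e, map_mul, h, incl_dp, mul_smul_comm, dp_mul_dp, smul_smul]

/-- The automorphism that multiplies elements of `θ_i`-degree `d` by `v^d`. -/
def wtAlg : HalfAlg A2 →ₐ[K] HalfAlg A2 := scale A2 (Sum.elim (fun _ => v) fun _ => 1)

theorem wtAlg_θi : wtAlg θi = v • θi := scale_θ _ _ _

theorem wtAlg_θi' : wtAlg θi' = θi' := (scale_θ _ _ _).trans (one_smul _ _)

theorem wtAlg_dp_θi (n : ℕ) : wtAlg (dp θi n) = v ^ n • dp θi n := by
  rw [map_dp, wtAlg_θi, dp, smul_pow, smul_comm, ← dp]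

theorem wtAlg_dp_θi' (n : ℕ) : wtAlg (dp θi' n) = dp θi' n := by
  rw [map_dp, wtAlg_θi']

theorem wtAlg_can (a b c : ℕ) : wtAlg (can (a, b, c)) = v ^ (a + b) • can (a, b, c) := by
  rcases le_total c a with h | h
  · simp only [can_of_le h, monoA, map_mul, wtAlg_dp_θi, wtAlg_dp_θi', mul_smul_comm,
      smul_mul_assoc]
  · simp only [can_of_ge h, monoB, map_mul, wtAlg_dp_θi, wtAlg_dp_θi', mul_smul_comm,
      smul_mul_assoc, smul_smul, pow_add, mul_comm]

theorem wtAlg_pbw (a b c : ℕ) : wtAlg (pbw (a, b, c)) = v ^ (a + b) • pbw (a, b, c) := by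
  have hT : wtAlg θT = v • θT := by
    simp only [θT, map_sub, map_smul, map_mul, wtAlg_θi, wtAlg_θi', mul_smul_comm, smul_mul_assoc,
      smul_sub, smul_comm v v⁻¹]
  have hT' : wtAlg (dp θT b) = v ^ b • dp θT b := by
    rw [map_dp, hT, dp, smul_pow, smul_comm, ← dp]
  simp only [pbw_eq, map_mul, wtAlg_dp_θi, wtAlg_dp_θi', hT', mul_smul_comm, smul_mul_assoc,
    smul_smul, pow_add, mul_comm]

theorem v_pow_injective {a b : ℕ} (h : v ^ a = v ^ b) : a = b := by
  have hv := v_ne_zero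
  by_contra hne
  refine v_zpow_ne_one (k := (a : ℤ) - b) (by omega) ?_
  rw [zpow_sub₀ hv, zpow_natCast, zpow_natCast, h, div_self (pow_ne_zero _ hv)]

/-- An eigenvector of an operator diagonal in an independent family involves only members with the
same eigenvalue. Applied to a weight operator, this says that homogeneous elements expand in
homogeneous basis elements. -/
theorem eigenvalue_eq {ι V : Type*} [AddCommGroup V] [Module K V] {B : ι → V}
    (hB : LinearIndependent K B) (W : V →ₗ[K] V) {w : ι → K} (hW : ∀ i, W (B i) = w i • B i)
    {l : ι →₀ K} {c : K}
    (h : W (Finsupp.linearCombination K B l) = c • Finsupp.linearCombination K B l) {i : ι}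
    (hi : l i ≠ 0) : w i = c := by
  have h0 : ∑ j ∈ l.support, (l j * (w j - c)) • B j = 0 := by
    rw [Finsupp.linearCombination_apply, Finsupp.sum, map_sum, ← sub_eq_zero, Finset.smul_sum,
      ← Finset.sum_sub_distrib] at h
    rw [← h]
    refine Finset.sum_congr rfl fun j _ => ?_
    rw [map_smul, hW, smul_smul, smul_smul, ← sub_smul]
    ring_nf
  have := linearIndependent_iff'.mp hB _ _ h0 i (Finsupp.mem_support_iff.mpr hi)
  exact sub_eq_zero.mp ((mul_eq_zero.mp this).resolve_left hi)

/-- Everything that appears has θ_{i'}-degree n, which is a + b after the swap. Conversely each such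
basis element already appears in a product of three divided powers. -/
theorem basisfθf_eq (n : ℕ) :
    basisfθf n = {x | ∃ a b c : ℕ, a + b = n ∧ x = swapAlg (can (a, b, c))} := by
  ext x
  constructor
  · rintro ⟨s₁, s₂, h⟩
    have hx : x ∈ canonicalBasis A2 := h.choose
    rw [← range_swap_can] at hx
    obtain ⟨⟨a, b, c⟩, rfl⟩ := hx
    refine ⟨a, b, c, ?_, rfl⟩
    obtain ⟨l, hl, hne⟩ :=
      (appears_iff A2 linearIndependent_swap_can range_swap_can (a, b, c) _).mp h
    obtain ⟨c₁, a₁, e₁⟩ := exists_incl_monomial s₁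
    obtain ⟨c₂, a₂, e₂⟩ := exists_incl_monomial s₂
    have e : Finsupp.linearCombination K can l =
        (c₁ * c₂) • (dp θi' a₁ * dp θi n * dp θi' a₂) := by
      have := congrArg swapAlg hl
      rw [e₁, e₂, θwt, Finsupp.linearCombination_apply, Finsupp.sum, map_sum] at this
      rw [Finsupp.linearCombination_apply, Finsupp.sum]
      simp only [map_smul, map_mul, map_dp, swapAlg_swapAlg, swapAlg_θi, swapAlg_θi',
        smul_mul_assoc, mul_smul_comm, smul_smul] at this
      rw [this, mul_comm]
    have hw : wtAlg (Finsupp.linearCombination K can l) =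
        v ^ n • Finsupp.linearCombination K can l := by
      rw [e, map_smul, map_mul, map_mul, wtAlg_dp_θi, wtAlg_dp_θi', wtAlg_dp_θi']
      simp only [mul_smul_comm, smul_mul_assoc, smul_comm (v ^ n)]
    exact v_pow_injective (eigenvalue_eq isUnitriangular_can.linearIndependent wtAlg.toLinearMap
      (w := fun p => v ^ (p.1 + p.2.1)) (fun p => wtAlg_can p.1 p.2.1 p.2.2) hw hne)
  · rintro ⟨a, b, c, rfl, rfl⟩
    -- The product θ_i^{(b)} θ_n θ_i^{(c)} is the swap of y^{(b)} x^{(a+b)} y^{(c)}, which has the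
    -- right leading term whether or not c ≤ a.
    refine ⟨[b], [c], ?_⟩
    refine (appears_iff A2 linearIndependent_swap_can range_swap_can (a, b, c) _).mpr ?_
    -- The difference of the two elements has only PBW terms with T-exponent below b, hence is
    -- spanned by canonical elements with that property. So the coefficient of `can (a, b, c)` is
    -- exactly 1.
    have h1 : monoA a b c - can (a, b, c) ∈ Submodule.span K (can '' {q | q.2.1 < b}) := by
      have := sub_mem (monoA_sub_pbw_mem a b c) (isUnitriangular_can (a, b, c))
      rw [pbwBasis_apply, sub_sub_sub_cancel_right] at this
      exact isUnitriangular_can.span_image_le b this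
    obtain ⟨l, hl, e⟩ := (Finsupp.mem_span_image_iff_linearCombination K).mp h1
    refine ⟨l + Finsupp.single (a, b, c) 1, ?_, ?_⟩
    · have h2 : Finsupp.linearCombination K (fun p => swapAlg (can p)) l =
          swapAlg (Finsupp.linearCombination K can l) := by
        simp only [Finsupp.linearCombination_apply, Finsupp.sum, map_sum, map_smul]
      rw [map_add, h2, e, Finsupp.linearCombination_single, one_smul, ← map_add, sub_add_cancel]
      simp [monomial, incl_θ₁, monoA, θwt, map_dp, swapAlg_θi, swapAlg_θi']
    · have : l (a, b, c) = 0 := by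
        by_contra hne
        exact lt_irrefl b (hl (Finsupp.mem_support_iff.mpr hne))
      rw [Finsupp.add_apply, this, zero_add, Finsupp.single_eq_same]
      exact one_ne_zero

/-! ### Right divisibility and the strata -/

theorem repr_eq_zero_of_mem_powRight {x : HalfAlg A2} {n : ℕ} (hx : x ∈ powRight A2 (.inr ()) n)
    {p : ℕ × ℕ × ℕ} (hp : p.2.2 < n) : pbwBasis.repr x p = 0 := by
  obtain ⟨y, rfl⟩ := hx
  have : y ∈ (⊤ : Submodule K (HalfAlg A2)) := trivial
  rw [← span_pbw] at this
  change pbwBasis.repr (y * θi' ^ n) p = 0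
  induction this using Submodule.span_induction with
  | mem x hx =>
    obtain ⟨⟨a, b, c⟩, rfl⟩ := hx
    rw [pow_eq_dp, mul_smul_comm, pbw_eq, mul_assoc, dp_mul_dp, mul_smul_comm, ← pbw_eq, map_smul,
      map_smul, Finsupp.smul_apply, Finsupp.smul_apply, repr_pbw, Finsupp.single_eq_of_ne,
      smul_zero, smul_zero]
    rintro rfl
    change c + n < n at hp
    omega
  | zero => simp
  | add x y _ _ hx hy => rw [add_mul, map_add, Finsupp.add_apply, hx, hy, add_zero]
  | smul c x _ hx => rw [smul_mul_assoc, map_smul, Finsupp.smul_apply, hx, smul_zero]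

theorem can_mem_powRight_inr {a b c n : ℕ} :
    can (a, b, c) ∈ powRight A2 (.inr ()) n ↔ n ≤ c := by
  constructor
  · intro h
    by_contra hn
    have := repr_eq_zero_of_mem_powRight h (p := (a, b, c)) (by change c < n; omega)
    rw [repr_can_self] at this
    exact one_ne_zero this
  · intro h
    refine ⟨∑ u ∈ Finset.range (b + 1), canCoeff a c u • (qFact (c + u))⁻¹ •
      (dp θi (a + u) * dp θT (b - u) * θi' ^ (c + u - n)), ?_⟩
    change _ = _ * θi' ^ n
    rw [can_eq, Finset.sum_mul]
    refine Finset.sum_congr rfl fun u _ => ?_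
    rw [smul_mul_assoc, smul_mul_assoc, mul_assoc, ← pow_add, pbw_eq, dp.eq_1 θi',
      mul_smul_comm, Nat.sub_add_cancel (by omega)]

theorem swapAlg_mem_powRight {x : HalfAlg A2} {n : ℕ} :
    swapAlg x ∈ powRight A2 (.inl ()) n ↔ x ∈ powRight A2 (.inr ()) n := by
  constructor
  · rintro ⟨y, hy⟩
    refine ⟨swapAlg y, ?_⟩
    rw [← swapAlg_swapAlg x, hy, map_mul, map_pow]
    exact congrArg (_ * · ^ n) swapAlg_θi
  · rintro ⟨y, rfl⟩
    refine ⟨swapAlg y, ?_⟩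
    rw [map_mul, map_pow]
    exact congrArg (_ * · ^ n) swapAlg_θi'

theorem swap_can_mem_sigmaStratum {a b c t : ℕ} :
    swapAlg (can (a, b, c)) ∈ sigmaStratum A2 (.inl ()) t ↔ t = c := by
  have h : swapAlg (can (a, b, c)) ∈ canonicalBasis A2 := range_swap_can ▸ Set.mem_range_self _
  simp only [sigmaStratum, Set.mem_sdiff, Set.mem_inter_iff, h, true_and, swapAlg_mem_powRight,
    can_mem_powRight_inr]
  omega

/-- The stratum of the swapped element is its last index c, so t ≤ m bounds c; put k = m - c and l =
b. -/
theorem framedBasis_eq (m n : ℕ) : framedBasis m n =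
    {x | ∃ k l : ℕ, k ≤ m ∧ l ≤ n ∧ x = swapAlg (can (n - l, l, m - k))} := by
  ext x
  simp only [framedBasis, basisfθf_eq, Set.mem_inter_iff, Set.mem_ofPred_eq, Set.mem_iUnion]
  constructor
  · rintro ⟨⟨a, b, c, rfl, rfl⟩, t, ht, h⟩
    obtain rfl := swap_can_mem_sigmaStratum.mp h
    have := ht.2
    refine ⟨m - t, b, by omega, by omega, ?_⟩
    rw [show a + b - b = a by omega, show m - (m - t) = t by omega]
  · rintro ⟨k, l, hk, hl, rfl⟩
    exact ⟨⟨n - l, l, m - k, by omega, rfl⟩, m - k, ⟨Nat.zero_le _, Nat.sub_le _ _⟩,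
      swap_can_mem_sigmaStratum.mpr rfl⟩

end
end FramedTensor

open scoped TensorProduct
namespace FramedTensor
noncomputable section

/-! ### The modules `Λ_n` -/

/-- Mapping θ_i to the variable of a polynomial ring sends divided powers to non-zero multiples of
distinct powers. -/
theorem linearIndependent_dp_θ₁ : LinearIndependent K (dp θ₁) := by
  let g : HalfAlg A1 →ₐ[K] Polynomial K :=
    lift A1 (fun _ => Polynomial.X) fun _ _ h => absurd rfl h
  have hg : ∀ a, g (dp θ₁ a) = (qFact a)⁻¹ • Polynomial.X ^ a := by
    intro a
    rw [map_dp, show g θ₁ = Polynomial.X from lift_θ _ _ _ _, dp]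
  rw [linearIndependent_iff']
  intro s l hl i hi
  have h := congrArg (fun z => (g z).coeff i) hl
  simp only [map_sum, map_smul, hg, Polynomial.finsetSum_coeff, Polynomial.coeff_smul,
    Polynomial.coeff_X_pow, smul_eq_mul, mul_ite, mul_one, mul_zero, map_zero,
    Polynomial.coeff_zero, Finset.sum_ite_eq, if_pos hi] at h
  exact (mul_eq_zero.mp h).resolve_right (inv_ne_zero (qFact_ne_zero i))

theorem span_dp_θ₁ : Submodule.span K (Set.range (dp θ₁)) = ⊤ := by
  refine submodule_eq_top A1 _ (Submodule.subset_span ⟨0, dp_zero _⟩) ?_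
  intro _ x hx
  change θ₁ * x ∈ _
  induction hx using Submodule.span_induction with
  | mem x hx =>
    obtain ⟨a, rfl⟩ := hx
    rw [mul_dp]
    exact Submodule.smul_mem _ _ (Submodule.subset_span ⟨_, rfl⟩)
  | zero => rw [mul_zero]; exact zero_mem _
  | add x y _ _ hx hy => rw [mul_add]; exact add_mem hx hy
  | smul c x _ hx => rw [mul_smul_comm]; exact Submodule.smul_mem _ _ hx

/-- The basis of divided powers. -/
def dpBasis : Module.Basis ℕ K (HalfAlg A1) :=
  Module.Basis.mk linearIndependent_dp_θ₁ span_dp_θ₁.ge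

@[simp]
theorem dpBasis_apply (a : ℕ) : dpBasis a = dp θ₁ a := by simp [dpBasis]

theorem repr_mul_pow (y : HalfAlg A1) {n a : ℕ} (ha : a ≤ n) :
    dpBasis.repr (y * θ₁ ^ (n + 1)) a = 0 := by
  have : y ∈ (⊤ : Submodule K (HalfAlg A1)) := trivial
  rw [← span_dp_θ₁] at this
  induction this using Submodule.span_induction with
  | mem x hx =>
    obtain ⟨b, rfl⟩ := hx
    rw [pow_eq_dp, mul_smul_comm, dp_mul_dp, map_smul, map_smul, Finsupp.smul_apply,
      Finsupp.smul_apply, ← dpBasis_apply, dpBasis.repr_self, Finsupp.single_eq_of_ne (by omega),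
      smul_zero, smul_zero]
  | zero => simp
  | add x y _ _ hx hy => rw [add_mul, map_add, Finsupp.add_apply, hx, hy, add_zero]
  | smul c x _ hx => rw [smul_mul_assoc, map_smul, Finsupp.smul_apply, hx, smul_zero]

theorem Fη_eq_zero {n a : ℕ} (h : n < a) : Fη n a = 0 := by
  rw [Fη, hwProj, Submodule.mkQ_apply, Submodule.Quotient.mk_eq_zero, hwSubspace_A1]
  refine ⟨(qFact a)⁻¹ • θ₁ ^ (a - (n + 1)), ?_⟩
  rw [smul_mul_assoc, ← pow_add, dp, Nat.sub_add_cancel h]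

theorem linearIndependent_Fη (n : ℕ) : LinearIndependent K fun a : Fin (n + 1) => Fη n a := by
  rw [linearIndependent_iff']
  intro s l hl i hi
  have h1 : hwProj A1 (fun _ => n) (∑ a ∈ s, l a • dp θ₁ a) = 0 := by
    rw [← hl, map_sum]
    exact Finset.sum_congr rfl fun a _ => map_smul _ _ _
  rw [hwProj, Submodule.mkQ_apply, Submodule.Quotient.mk_eq_zero, hwSubspace_A1] at h1
  obtain ⟨y, hy⟩ := h1
  have h2 := repr_mul_pow y (Nat.lt_succ_iff.mp i.2)
  rw [hy, map_sum, Finsupp.finsetSum_apply, Finset.sum_eq_single_of_mem i hi] at h2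
  · rwa [map_smul, Finsupp.smul_apply, ← dpBasis_apply, dpBasis.repr_self, Finsupp.single_eq_same,
      smul_eq_mul, mul_one] at h2
  · intro a _ hai
    rw [map_smul, Finsupp.smul_apply, ← dpBasis_apply, dpBasis.repr_self, Finsupp.single_eq_of_ne,
      smul_zero]
    exact fun e => hai (Fin.ext e).symm

theorem span_Fη (n : ℕ) :
    Submodule.span K (Set.range fun a : Fin (n + 1) => Fη n a) = ⊤ := by
  have h1 : Submodule.map (hwProj A1 fun _ => n) ⊤ = ⊤ := by
    rw [Submodule.map_top, hwProj, Submodule.range_mkQ]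
  rw [eq_top_iff, ← h1, ← span_dp_θ₁, Submodule.map_span, Submodule.span_le]
  rintro _ ⟨_, ⟨a, rfl⟩, rfl⟩
  change Fη n a ∈ _
  rcases Nat.lt_or_ge n a with h | h
  · rw [Fη_eq_zero h]; exact zero_mem _
  · exact Submodule.subset_span ⟨⟨a, by omega⟩, rfl⟩

/-- The canonical basis of `Λ_n`. -/
def LBasis (n : ℕ) : Module.Basis (Fin (n + 1)) K (L n) :=
  Module.Basis.mk (linearIndependent_Fη n) (span_Fη n).ge

@[simp]
theorem LBasis_apply (n : ℕ) (a : Fin (n + 1)) : LBasis n a = Fη n a := by simp [LBasis]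

/-- The tensor product of the canonical bases. -/
def TBasis (m n : ℕ) : Module.Basis (Fin (m + 1) × Fin (n + 1)) K (L m ⊗[K] L n) :=
  (LBasis m).tensorProduct (LBasis n)

@[simp]
theorem TBasis_apply (m n : ℕ) (p : Fin (m + 1) × Fin (n + 1)) :
    TBasis m n p = Fη m p.1 ⊗ₜ[K] Fη n p.2 := by
  obtain ⟨a, b⟩ := p
  simp [TBasis, Module.Basis.tensorProduct_apply]

/-! ### Operators on the simple modules -/

theorem actF_hwProj (n : ℕ) (x : HalfAlg A1) :
    actF n (hwProj A1 (fun _ => n) x) = hwProj A1 (fun _ => n) (θ₁ * x) := rfl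

theorem actE_hwProj (n : ℕ) (x : HalfAlg A1) :
    actE n (hwProj A1 (fun _ => n) x) = hwProj A1 (fun _ => n) (vermaE n x) := rfl

theorem barL_hwProj (n : ℕ) (x : HalfAlg A1) :
    barL n (hwProj A1 (fun _ => n) x) = hwProj A1 (fun _ => n) (bar A1 x) := rfl

theorem actF_Fη (n a : ℕ) : actF n (Fη n a) = qInt (a + 1) • Fη n (a + 1) := by
  rw [Fη, actF_hwProj, mul_dp, map_smul, Fη]

/-- The operator `x η_n ↦ c^{deg x} x η_n` on `Λ_n`. -/
def scaleL (n : ℕ) (c : K) : Module.End K (L n) :=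
  (hwSubspace A1 fun _ => n).mapQ (hwSubspace A1 fun _ => n) (scale A1 fun _ => c).toLinearMap
    fun x hx => scale_mem_hwSubspace n c x hx

theorem scaleL_hwProj (n : ℕ) (c : K) (x : HalfAlg A1) :
    scaleL n c (hwProj A1 (fun _ => n) x) = hwProj A1 (fun _ => n) (scale A1 (fun _ => c) x) := rfl

theorem scaleL_Fη (n a : ℕ) (c : K) : scaleL n c (Fη n a) = c ^ a • Fη n a := by
  have h : scale A1 (fun _ => c) θ₁ = c • θ₁ := scale_θ _ _ _
  rw [Fη, scaleL_hwProj, map_dp, h, dp, smul_pow, smul_comm, ← dp, map_smul]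

/-- The action of `K_i` on `Λ_n`. -/
def actK (n : ℕ) : Module.End K (L n) := v ^ (n : ℤ) • scaleL n (v ^ (-2 : ℤ))

/-- The action of `K_i⁻¹` on `Λ_n`. -/
def actKinv (n : ℕ) : Module.End K (L n) := v ^ (-(n : ℤ)) • scaleL n (v ^ (2 : ℤ))

theorem actKinv_Fη (n a : ℕ) : actKinv n (Fη n a) = v ^ (-(n : ℤ) + 2 * a) • Fη n a := by
  rw [actKinv, LinearMap.smul_apply, scaleL_Fη, smul_smul, ← zpow_natCast, ← zpow_mul,
    ← zpow_add₀ v_ne_zero]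

/-- The action of `F_i` on `Λ_m ⊗ Λ_n`. -/
def coF (m n : ℕ) : Module.End K (L m ⊗[K] L n) :=
  TensorProduct.map LinearMap.id (actF n) + TensorProduct.map (actF m) (actKinv n)

theorem coF_tmul (m n : ℕ) (x : L m) (y : L n) :
    coF m n (x ⊗ₜ y) = x ⊗ₜ actF n y + actF m x ⊗ₜ actKinv n y := rfl

/-- Multiplicativity of r: θ ⊗ 1 acts, after the flip of the factors, as 1 ⊗ F. The part 1 ⊗ θ picks
up v^{2 deg x₁} from the twisted product and v^{-n} from θ_n, which together are K⁻¹ on Λ_n. -/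
theorem framedFormula_θ₁_mul (m n : ℕ) (x y : HalfAlg A1) :
    framedFormula m n (θ₁ * x) y = coF m n (framedFormula m n x y) := by
  have hr : r A1 (θ₁ * x) = mulPrim A1 () (r A1 x) := r_θ_mul A1 () x
  rw [framedFormula, framedFormula, hr]
  have hs : ∀ (c : K) z, scale A1 (fun _ => c) (θ A1 () * z) =
      c • (θ A1 () * scale A1 (fun _ => c) z) := by
    intro c z
    rw [map_mul, scale_θ, smul_mul_assoc]
  induction r A1 x with
  | zero => simp
  | add a b ha hb => simp only [map_add, ha, hb]
  | tmul a b =>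
    simp only [mulPrim, LinearMap.add_apply, TensorProduct.map_tmul, LinearMap.mulLeft_apply,
      LinearMap.id_apply, map_add, TensorProduct.comm_tmul, LinearMap.comp_apply,
      AlgHom.toLinearMap_apply, LinearMap.mulRight_apply, coF_tmul, actF_hwProj, hs,
      map_smul, actKinv, LinearMap.smul_apply, scaleL_hwProj,
      TensorProduct.smul_tmul, mul_assoc]
    rfl

/-! ### The map `Φ` -/

/-- The linear map given on the swapped PBW basis `θ_{i'}^{(a)} T'^{(b)} θ_i^{(c)}` by
`F^{(c)} η_m ⊗ F^{(b)} η_n` if `a + b = n`, and by `0` otherwise. -/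
def Φ (m n : ℕ) : HalfAlg A2 →ₗ[K] L m ⊗[K] L n :=
  (pbwBasis.constr K fun p => if p.1 + p.2.1 = n then Fη m p.2.2 ⊗ₜ[K] Fη n p.2.1 else 0).comp
    swapAlg.toLinearMap

theorem Φ_swap_pbw (m n a b c : ℕ) : Φ m n (swapAlg (pbw (a, b, c))) =
    if a + b = n then Fη m c ⊗ₜ[K] Fη n b else 0 := by
  rw [Φ, LinearMap.comp_apply, AlgHom.toLinearMap_apply, swapAlg_swapAlg, ← pbwBasis_apply,
    Module.Basis.constr_basis]

theorem Φ_swap_pbw_of_eq (m : ℕ) {n a b : ℕ} (c : ℕ) (h : a + b = n) :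
    Φ m n (swapAlg (pbw (a, b, c))) = Fη m c ⊗ₜ[K] Fη n b := by rw [Φ_swap_pbw, if_pos h]

theorem Φ_swap_pbw_of_ne (m : ℕ) {n a b : ℕ} (c : ℕ) (h : a + b ≠ n) :
    Φ m n (swapAlg (pbw (a, b, c))) = 0 := by rw [Φ_swap_pbw, if_neg h]

/-- Linear maps out of the framed algebra that agree on the swapped PBW basis are equal. -/
theorem swap_pbw_ext {M : Type*} [AddCommGroup M] [Module K M] {f g : HalfAlg A2 →ₗ[K] M}
    (h : ∀ a b c, f (swapAlg (pbw (a, b, c))) = g (swapAlg (pbw (a, b, c)))) : f = g := by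
  have : f.comp swapAlg.toLinearMap = g.comp swapAlg.toLinearMap :=
    pbwBasis.ext fun p => by
      rw [pbwBasis_apply]
      exact h _ _ _
  ext x
  have := LinearMap.congr_fun this (swapAlg x)
  simpa [swapAlg_swapAlg] using this

/-- After the swap this is the formula for y times a PBW monomial. Since n = a + b, the exponent b -
a there equals -n + 2b, the weight of K⁻¹ on F^{(b)}η_n. -/
theorem Φ_θi_mul (m n : ℕ) (x : HalfAlg A2) : Φ m n (θi * x) = coF m n (Φ m n x) := by
  have hv := v_ne_zero
  suffices h : (Φ m n).comp (LinearMap.mulLeft K θi) = (coF m n).comp (Φ m n) from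
    LinearMap.congr_fun h x
  refine swap_pbw_ext fun a b c => ?_
  rw [LinearMap.comp_apply, LinearMap.comp_apply, LinearMap.mulLeft_apply, ← swapAlg_θi',
    ← map_mul]
  by_cases h : a + b = n
  · rw [Φ_swap_pbw_of_eq m c h, coF_tmul, actF_Fη, actF_Fη, actKinv_Fη, TensorProduct.tmul_smul,
      TensorProduct.tmul_smul, ← TensorProduct.smul_tmul', smul_smul]
    cases a with
    | zero =>
      -- For a = 0 one has b = n, so F^{(b+1)}η_n = 0, matching the missing T-term on the other
      -- side.
      rw [θi'_mul_pbw_zero, map_smul, map_smul, Φ_swap_pbw_of_eq m _ h, Fη_eq_zero (a := b + 1)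
        (by omega), TensorProduct.tmul_zero, smul_zero, zero_add]
      congr 3
      subst h
      push_cast
      ring
    | succ a =>
      rw [θi'_mul_pbw_succ, map_add, map_add, map_smul, map_smul, map_smul, map_smul,
        Φ_swap_pbw_of_eq m _ h, Φ_swap_pbw_of_eq m _ (by omega : a + (b + 1) = n), add_comm]
      congr 4
      subst h
      push_cast
      ring
  · rw [Φ_swap_pbw_of_ne m c h, map_zero]
    cases a with
    | zero => rw [θi'_mul_pbw_zero, map_smul, map_smul, Φ_swap_pbw_of_ne m _ h, smul_zero]
    | succ a =>
      rw [θi'_mul_pbw_succ, map_add, map_add, map_smul, map_smul, map_smul, map_smul,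
        Φ_swap_pbw_of_ne m _ h, Φ_swap_pbw_of_ne m _ (by omega : a + (b + 1) ≠ n), smul_zero,
        smul_zero, add_zero]

theorem framedFormula_one (m n : ℕ) (y : HalfAlg A1) :
    framedFormula m n 1 y = hwProj A1 (fun _ => m) y ⊗ₜ[K] Fη n 0 := by
  simp [framedFormula, r_one, Fη, dp_zero]

theorem Φ_θwt_mul (m n : ℕ) (y : HalfAlg A1) :
    Φ m n (θwt n * incl y) = hwProj A1 (fun _ => m) y ⊗ₜ[K] Fη n 0 := by
  suffices h : (Φ m n).comp ((LinearMap.mulLeft K (θwt n)).comp incl.toLinearMap) =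
      ((TensorProduct.mk K (L m) (L n)).flip (Fη n 0)).comp (hwProj A1 fun _ => m) from
    LinearMap.congr_fun h y
  refine dpBasis.ext fun s => ?_
  rw [dpBasis_apply]
  change Φ m n (θwt n * incl (dp θ₁ s)) = Fη m s ⊗ₜ[K] Fη n 0
  rw [incl_dp, ← Φ_swap_pbw_of_eq m s (add_zero n), pbw_eq, dp_zero, mul_one,
    map_mul swapAlg, map_dp, map_dp, swapAlg_θi, swapAlg_θi', θwt]

/-- As functions of x both sides obey the same recursion under left multiplication by θ_i and agree
at x = 1. -/
theorem Φ_eq_framedFormula (m n : ℕ) (x y : HalfAlg A1) :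
    Φ m n (incl x * θwt n * incl y) = framedFormula m n x y := by
  let g : HalfAlg A1 →ₗ[K] L m ⊗[K] L n := (Φ m n).comp
    ((LinearMap.mulRight K (θwt n * incl y)).comp incl.toLinearMap)
  let h : HalfAlg A1 →ₗ[K] L m ⊗[K] L n := (TensorProduct.map
    ((hwProj A1 fun _ => m).comp
      ((LinearMap.mulRight K y).comp (scale A1 fun _ => v ^ (-(n : ℤ))).toLinearMap))
    (hwProj A1 fun _ => n)).comp
    ((TensorProduct.comm K (HalfAlg A1) (HalfAlg A1)).toLinearMap.comp (r A1))
  have hg : ∀ x, g x = Φ m n (incl x * (θwt n * incl y)) := fun _ => rfl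
  have hh : ∀ x, h x = framedFormula m n x y := fun _ => rfl
  have : g = h := by
    refine linearMap_ext A1 _ _ ?_ fun _ z hz => ?_
    · rw [hg, hh, map_one, one_mul, Φ_θwt_mul, framedFormula_one]
    · rw [hg, hh] at hz ⊢
      change Φ m n (incl (θ₁ * z) * _) = framedFormula m n (θ₁ * z) y
      rw [framedFormula_θ₁_mul, ← hz, map_mul incl, incl_θ₁, mul_assoc, Φ_θi_mul]
  rw [mul_assoc, ← hg, this, hh]

theorem Φ_mul_θi_pow (m n : ℕ) (x : HalfAlg A2) : Φ m n (x * θi ^ (m + 1)) = 0 := by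
  suffices h : (Φ m n).comp (LinearMap.mulRight K (θi ^ (m + 1))) = 0 from
    LinearMap.congr_fun h x
  refine swap_pbw_ext fun a b c => ?_
  rw [LinearMap.comp_apply, LinearMap.mulRight_apply, ← swapAlg_θi', ← map_pow, ← map_mul,
    pow_eq_dp, mul_smul_comm, pbw_eq, mul_assoc, dp_mul_dp, mul_smul_comm, ← pbw_eq, map_smul,
    map_smul, map_smul, map_smul, Φ_swap_pbw, Fη_eq_zero (n := m) (by omega),
    TensorProduct.zero_tmul]
  simp

theorem Φ_wt (m n : ℕ) (x : HalfAlg A2) :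
    Φ m n (swapAlg (wtAlg (swapAlg x))) = v ^ n • Φ m n x := by
  suffices h : (Φ m n).comp (swapAlg.comp (wtAlg.comp swapAlg)).toLinearMap = v ^ n • Φ m n from
    LinearMap.congr_fun h x
  refine swap_pbw_ext fun a b c => ?_
  change Φ m n (swapAlg (wtAlg (swapAlg (swapAlg _)))) = v ^ n • Φ m n _
  rw [swapAlg_swapAlg, wtAlg_pbw, map_smul, map_smul]
  by_cases h : a + b = n
  · rw [h]
  · rw [Φ_swap_pbw_of_ne m c h, smul_zero, smul_zero]

/-- By `Φ_wt`, `Φ` sees only θ_{i'}-degree n, while right multiplication by θ_{i'}^{n+1} pushes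
every degree above n. -/
theorem Φ_mul_θi'_pow (m n : ℕ) (x : HalfAlg A2) : Φ m n (x * θi' ^ (n + 1)) = 0 := by
  suffices h : (Φ m n).comp (LinearMap.mulRight K (θi' ^ (n + 1))) = 0 from
    LinearMap.congr_fun h x
  refine swap_pbw_ext fun a b c => ?_
  have h := Φ_wt m n (swapAlg (pbw (a, b, c)) * θi' ^ (n + 1))
  rw [map_mul, swapAlg_swapAlg, map_pow, swapAlg_θi', map_mul, wtAlg_pbw, map_pow, wtAlg_θi,
    smul_pow, smul_mul_smul_comm, map_smul, map_smul, map_mul, map_pow, swapAlg_θi,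
    ← pow_add] at h
  by_contra hne
  have := v_pow_injective (smul_left_injective K hne h)
  omega

theorem Φ_eq_zero_of_mem (m n : ℕ) {x : HalfAlg A2}
    (hx : x ∈ hwSubspace A2 (Sum.elim (fun _ => m) fun _ => n)) : Φ m n x = 0 := by
  rw [hwSubspace, Submodule.restrictScalars_mem, Ideal.span] at hx
  -- Quantifying over all left multiples lets the induction on the left ideal pass through its
  -- scalar step.
  suffices h : ∀ a, Φ m n (a * x) = 0 by simpa using h 1
  induction hx using Submodule.span_induction with
  | mem x hx =>
    intro a
    obtain ⟨j | j, rfl⟩ := hx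
    · exact Φ_mul_θi_pow m n a
    · exact Φ_mul_θi'_pow m n a
  | zero => simp
  | add x y _ _ hx hy => intro a; rw [mul_add, map_add, hx, hy, add_zero]
  | smul b x _ hx => intro a; rw [smul_eq_mul, ← mul_assoc, hx]

/-! ### The subspace `f θ_λ f` -/

/-- The space is the full component of θ_{i'}-degree n. One inclusion holds because the span on the
right is stable under left multiplication by θ_i; the other is unitriangularity. -/
theorem fθf_eq (n : ℕ) :
    fθf n = Submodule.span K ((fun p => swapAlg (pbw p)) '' {p | p.1 + p.2.1 = n}) := by
  apply le_antisymm
  · rw [fθf, Submodule.span_le]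
    rintro _ ⟨x, y, rfl⟩
    set S := Submodule.span K ((fun p => swapAlg (pbw p)) '' {p | p.1 + p.2.1 = n}) with hS
    have hm : ∀ a b c, a + b = n → swapAlg (pbw (a, b, c)) ∈ S := fun a b c h =>
      Submodule.subset_span ⟨(a, b, c), h, rfl⟩
    have h1 : ∀ y, θwt n * incl y ∈ S := by
      intro y
      suffices h : (⊤ : Submodule K (HalfAlg A1)) ≤
        S.comap ((LinearMap.mulLeft K (θwt n)).comp incl.toLinearMap) from h trivial
      rw [← span_dp_θ₁, Submodule.span_le]
      rintro _ ⟨s, rfl⟩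
      change θwt n * incl (dp θ₁ s) ∈ S
      have := hm n 0 s (add_zero n)
      rwa [pbw_eq, dp_zero, mul_one, map_mul, map_dp, map_dp, swapAlg_θi, swapAlg_θi',
        ← incl_dp] at this
    have h2 : ∀ z ∈ S, θi * z ∈ S := by
      intro z hz
      suffices h : S ≤ S.comap (LinearMap.mulLeft K θi) from h hz
      conv_lhs => rw [hS]
      rw [Submodule.span_le]
      rintro _ ⟨⟨a, b, c⟩, hab, rfl⟩
      change a + b = n at hab
      change θi * swapAlg (pbw (a, b, c)) ∈ S
      rw [← swapAlg_θi', ← map_mul]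
      cases a with
      | zero =>
        rw [θi'_mul_pbw_zero, map_smul]
        exact S.smul_mem _ (hm _ _ _ hab)
      | succ a =>
        rw [θi'_mul_pbw_succ, map_add, map_smul, map_smul]
        exact add_mem (S.smul_mem _ (hm _ _ _ hab)) (S.smul_mem _ (hm _ _ _ (by omega)))
    have h3 := submodule_eq_top A1
      (S.comap ((LinearMap.mulRight K (θwt n * incl y)).comp incl.toLinearMap))
      (by
        change incl 1 * (θwt n * incl y) ∈ S
        rw [map_one, one_mul]
        exact h1 y)
      (by
        intro _ z hz
        change incl (θ₁ * z) * (θwt n * incl y) ∈ S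
        rw [map_mul, incl_θ₁, mul_assoc]
        exact h2 _ hz)
    have h4 : x ∈ (⊤ : Submodule K (HalfAlg A1)) := trivial
    rw [← h3] at h4
    change incl x * θwt n * incl y ∈ S
    rw [mul_assoc]
    exact h4
  · rw [Submodule.span_le]
    rintro _ ⟨⟨a, b, c⟩, hab, rfl⟩
    change a + b = n at hab
    change swapAlg (pbw (a, b, c)) ∈ fθf n
    -- θ_i^{(b)} θ_n θ_i^{(c)} equals the desired swapped PBW element plus terms with smaller
    -- T-exponent and the same a + b.
    induction b using Nat.strong_induction_on generalizing a c with
    | _ b ih =>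
      have h1 := monoA_eq a b c
      rw [Finset.sum_range_succ', Nat.cast_zero, mul_zero, neg_zero, zpow_zero, one_mul,
        gauss_zero_left, one_smul, ← sub_eq_iff_eq_add] at h1
      have h2 : swapAlg (monoA a b c) ∈ fθf n := by
        have := mem_fθf n (dp θ₁ b) (dp θ₁ c)
        simpa only [monoA, map_mul, map_dp, swapAlg_θi, swapAlg_θi', hab, incl_θ₁, θwt] using this
      have h3 : pbw (a, b, c) = monoA a b c - (monoA a b c - pbw (a, b, c)) := by abel
      rw [h3, map_sub]
      refine sub_mem h2 ?_
      simp only [add_zero, Nat.sub_zero] at h1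
      rw [h1, map_sum]
      refine sum_mem fun u hu => ?_
      have hub := Finset.mem_range.mp hu
      rw [map_smul]
      exact Submodule.smul_mem _ _ (ih _ (by omega) _ _ (by omega))

theorem swap_can_mem_fθf {a b n : ℕ} (c : ℕ) (h : a + b = n) :
    swapAlg (can (a, b, c)) ∈ fθf n := by
  rw [fθf_eq, can_eq, map_sum]
  refine sum_mem fun u hu => ?_
  have hub := Finset.mem_range.mp hu
  rw [map_smul]
  refine Submodule.smul_mem _ _ (Submodule.subset_span ⟨(a + u, b - u, c + u), ?_, rfl⟩)
  change a + u + (b - u) = n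
  omega

/-- In degree n the PBW elements with c ≤ m go to distinct basis tensors and those with c > m go to
0. A kernel element therefore involves only c > m, and these are right divisible by θ_i^{m+1}. -/
theorem mem_hwSubspace_of_Φ_eq_zero {m n : ℕ} {x : HalfAlg A2} (hx : x ∈ fθf n)
    (h : Φ m n x = 0) : x ∈ hwSubspace A2 (Sum.elim (fun _ => m) fun _ => n) := by
  rw [fθf_eq, Finsupp.mem_span_image_iff_linearCombination] at hx
  obtain ⟨l, hl, rfl⟩ := hx
  rw [Finsupp.linearCombination_apply, Finsupp.sum] at h ⊢
  have hle : ∀ p ∈ l.support, p.1 + p.2.1 = n := fun p hp => hl hp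
  have key : ∀ p ∈ l.support, m < p.2.2 := by
    rintro ⟨a, b, c⟩ hp
    by_contra hc
    change ¬ m < c at hc
    have hab := hle _ hp
    change a + b = n at hab
    have h1 := congrArg (fun z => (TBasis m n).repr z
      (⟨c, by omega⟩, ⟨b, by omega⟩)) h
    simp only [map_sum, Finsupp.finsetSum_apply, map_smul, Finsupp.smul_apply, map_zero,
      Finsupp.zero_apply] at h1
    rw [Finset.sum_eq_single_of_mem _ hp] at h1
    · rw [Φ_swap_pbw_of_eq m c hab, show Fη m c ⊗ₜ[K] Fη n b =
        TBasis m n (⟨c, by omega⟩, ⟨b, by omega⟩) by rw [TBasis_apply],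
        Module.Basis.repr_self, Finsupp.single_eq_same, smul_eq_mul, mul_one] at h1
      exact Finsupp.mem_support_iff.mp hp h1
    · rintro ⟨a', b', c'⟩ hq hne
      have hab' := hle _ hq
      change a' + b' = n at hab'
      rw [Φ_swap_pbw_of_eq m c' hab']
      rcases Nat.lt_or_ge m c' with hc' | hc'
      · rw [Fη_eq_zero hc', TensorProduct.zero_tmul, map_zero, Finsupp.zero_apply, smul_zero]
      · rw [show Fη m c' ⊗ₜ[K] Fη n b' = TBasis m n (⟨c', by omega⟩, ⟨b', by omega⟩) by
          rw [TBasis_apply], Module.Basis.repr_self, Finsupp.single_eq_of_ne, smul_zero]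
        intro e
        simp only [Prod.mk.injEq, Fin.mk.injEq] at e
        apply hne
        simp only [Prod.mk.injEq]
        omega
  refine sum_mem fun p hp => Submodule.smul_mem _ _ ?_
  obtain ⟨a, b, c⟩ := p
  have hc : m + 1 ≤ c := key _ hp
  have e : swapAlg (pbw (a, b, c)) = (swapAlg (dp θi a * dp θT b) *
      ((qFact c)⁻¹ • θi ^ (c - (m + 1)))) * θi ^ (m + 1) := by
    rw [mul_assoc, smul_mul_assoc, ← pow_add, Nat.sub_add_cancel hc, pbw_eq, map_mul,
      map_dp swapAlg θi', swapAlg_θi', dp.eq_1 θi c]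
  change swapAlg (pbw (a, b, c)) ∈ _
  rw [e]
  exact Ideal.mul_mem_left _ _ (Ideal.subset_span ⟨.inl (), rfl⟩)

/-- The map induced by `Φ` on `Λ_{m,n}`. -/
def ΦSub (m n : ℕ) : subL m n →ₗ[K] L m ⊗[K] L n :=
  ((hwSubspace A2 _).liftQ (Φ m n) fun _ hx => Φ_eq_zero_of_mem m n hx).comp (subL m n).subtype

theorem ΦSub_framedProj (m n : ℕ) (z : fθf n) : ΦSub m n (framedProj m n z) = Φ m n z := rfl

theorem framedProj_surjective (m n : ℕ) : Function.Surjective (framedProj m n) :=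
  LinearMap.submoduleMap_surjective _ _

theorem ΦSub_bijective (m n : ℕ) : Function.Bijective (ΦSub m n) := by
  constructor
  · rw [← LinearMap.ker_eq_bot, LinearMap.ker_eq_bot']
    intro z hz
    obtain ⟨⟨x, hx⟩, rfl⟩ := framedProj_surjective m n z
    rw [ΦSub_framedProj] at hz
    exact Subtype.ext ((Submodule.Quotient.mk_eq_zero _).mpr (mem_hwSubspace_of_Φ_eq_zero hx hz))
  · rw [← LinearMap.range_eq_top, eq_top_iff, ← (TBasis m n).span_eq, Submodule.span_le]
    rintro _ ⟨⟨c, b⟩, rfl⟩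
    have hb := b.2
    have hx : swapAlg (pbw (n - b, b, c)) ∈ fθf n := by
      rw [fθf_eq]
      refine Submodule.subset_span ⟨(n - b, b, c), ?_, rfl⟩
      change n - (b : ℕ) + b = n
      omega
    refine ⟨framedProj m n ⟨_, hx⟩, ?_⟩
    rw [ΦSub_framedProj, TBasis_apply]
    exact Φ_swap_pbw_of_eq m _ (by omega)

/-- The isomorphism `Λ_{m,n} → Λ_m ⊗ Λ_n`. -/
def framedIso (m n : ℕ) : subL m n ≃ₗ[K] L m ⊗[K] L n :=
  LinearEquiv.ofBijective (ΦSub m n) (ΦSub_bijective m n)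

theorem isFramedIso_framedIso (m n : ℕ) : IsFramedIso m n (framedIso m n) :=
  fun x y => Φ_eq_framedFormula m n x y

/-- The elements xθ_ny span fθ_nf, so the prescribed formula leaves no freedom. Uniqueness and the
explicit images both follow. -/
theorem IsFramedIso.apply_framedProj {m n : ℕ} {φ : subL m n ≃ₗ[K] L m ⊗[K] L n}
    (hφ : IsFramedIso m n φ) (z : fθf n) : φ (framedProj m n z) = Φ m n z := by
  obtain ⟨z, hz⟩ := z
  induction hz using Submodule.span_induction with
  | mem z hz =>
    obtain ⟨x, y, rfl⟩ := hz
    exact (hφ x y).trans (Φ_eq_framedFormula m n x y).symm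
  | zero => exact (congrArg φ (map_zero (framedProj m n))).trans (by simp)
  | add x y hx hy h1 h2 =>
    have hx' : x ∈ fθf n := hx
    have hy' : y ∈ fθf n := hy
    exact (congrArg φ (map_add (framedProj m n) ⟨x, hx'⟩ ⟨y, hy'⟩)).trans ((map_add φ _ _).trans
      ((congrArg₂ (· + ·) h1 h2).trans (map_add (Φ m n) x y).symm))
  | smul c x hx h1 =>
    have hx' : x ∈ fθf n := hx
    exact (congrArg φ (map_smul (framedProj m n) c ⟨x, hx'⟩)).trans ((map_smul φ c _).trans
      ((congrArg (c • ·) h1).trans (map_smul (Φ m n) c x).symm))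

theorem existsUnique_framedIso (m n : ℕ) :
    ∃! φ : subL m n ≃ₗ[K] L m ⊗[K] L n, IsFramedIso m n φ := by
  refine ⟨framedIso m n, isFramedIso_framedIso m n, fun φ hφ => ?_⟩
  ext z
  obtain ⟨x, rfl⟩ := framedProj_surjective m n z
  rw [hφ.apply_framedProj, (isFramedIso_framedIso m n).apply_framedProj]

theorem Φ_swap_monoB {m n k l : ℕ} (hk : k ≤ m) (hl : l ≤ n) :
    Φ m n (swapAlg (monoB (n - l) l (m - k))) = α m n k l := by
  -- The PBW expansion runs to u = l, the sum α only to min(k, l): for u > k the factor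
  -- F^{(m-k+u)}η_m is zero.
  have h0 : ∀ u ∈ Finset.range (l + 1), u ∉ Finset.range (min k l + 1) →
      (v ^ ((u : ℤ) * (k - m - u)) * qBinom (n - l + u) u) •
        (Fη m (m - k + u) ⊗ₜ[K] Fη n (l - u)) = 0 := by
    intro u hu hu'
    rw [Finset.mem_range] at hu hu'
    rw [Fη_eq_zero (n := m) (by omega), TensorProduct.zero_tmul, smul_zero]
  rw [α, Finset.sum_subset (Finset.range_mono (by omega)) h0, monoB_eq, map_sum, map_sum]
  refine Finset.sum_congr rfl fun u hu => ?_
  have hul := Finset.mem_range.mp hu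
  rw [map_smul, map_smul, Φ_swap_pbw_of_eq m _ (by omega), ← qBinom_eq_gauss]
  congr 2
  · congr 1
    push_cast [hk]
    ring
  · congr 1
    push_cast [hl]
    ring

theorem Φ_swap_monoA {m n k l : ℕ} (hk : k ≤ m) (hl : l ≤ n) :
    Φ m n (swapAlg (monoA (n - l) l (m - k))) = β m n k l := by
  have h0 : ∀ u ∈ Finset.range (l + 1), u ∉ Finset.range (min k l + 1) →
      (v ^ ((u : ℤ) * (l - n - u)) * qBinom (m - k + u) u) •
        (Fη m (m - k + u) ⊗ₜ[K] Fη n (l - u)) = 0 := by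
    intro u hu hu'
    rw [Finset.mem_range] at hu hu'
    rw [Fη_eq_zero (n := m) (by omega), TensorProduct.zero_tmul, smul_zero]
  rw [β, Finset.sum_subset (Finset.range_mono (by omega)) h0, monoA_eq, map_sum, map_sum]
  refine Finset.sum_congr rfl fun u hu => ?_
  have hul := Finset.mem_range.mp hu
  rw [map_smul, map_smul, Φ_swap_pbw_of_eq m _ (by omega), gauss_comm, ← qBinom_eq_gauss]
  congr 2
  · congr 1
    push_cast [hl]
    ring
  · congr 1
    push_cast [hk]
    ring

end
end FramedTensor

open scoped TensorProduct
namespace FramedTensor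
noncomputable section

/-! ### Commutation relations for divided powers -/

/-- The usual commutator of E^{(k+1)} with F, by induction on k from the defining relations alone.
-/
theorem dp_succ_mul_comm {A : Type*} [Ring A] [Algebra K A] {E F Kp Km : A}
    (hEF : E * F = F * E + (v - v⁻¹)⁻¹ • (Kp - Km)) (hp : Kp * E = v ^ (2 : ℤ) • (E * Kp))
    (hm : Km * E = v ^ (-2 : ℤ) • (E * Km)) (k : ℕ) :
    dp E (k + 1) * F = F * dp E (k + 1) +
      (v - v⁻¹)⁻¹ • (dp E k * (v ^ (k : ℤ) • Kp - v ^ (-(k : ℤ)) • Km)) := by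
  induction k with
  | zero => simp [dp_zero, dp_one, hEF]
  | succ k ih =>
    have hv := v_ne_zero
    have hq := qInt_succ_ne_zero (k + 1)
    -- Two splittings of [k+2], one for the coefficient of K and one for that of K⁻¹; they differ by
    -- the symmetry v ↔ v⁻¹.
    have h1 : qInt ((k + 1 : ℕ) + 1) = v ^ ((k : ℤ) + 1) + v⁻¹ * qInt (k + 1) := by
      rw [add_comm, qInt_add, qInt_one]
      push_cast
      simp
    have h2 : qInt ((k + 1 : ℕ) + 1) = v ^ (-((k : ℤ) + 1)) + v * qInt (k + 1) := by
      rw [qInt_add, qInt_one]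
      push_cast
      simp [add_comm]
    have hE : E * dp E k = qInt (k + 1) • dp E (k + 1) := mul_dp E k
    have hKp := mul_dp_comm hp (k + 1)
    have hKm := mul_dp_comm hm (k + 1)
    have key : E * dp E (k + 1) * F = F * (E * dp E (k + 1)) +
        (v - v⁻¹)⁻¹ • (qInt ((k + 1 : ℕ) + 1) • (dp E (k + 1) *
          (v ^ ((k + 1 : ℕ) : ℤ) • Kp - v ^ (-((k + 1 : ℕ) : ℤ)) • Km))) := by
      rw [mul_assoc, ih, mul_add, ← mul_assoc E F, hEF, mul_smul_comm, ← mul_assoc E, hE,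
        add_mul, smul_mul_assoc, sub_mul, hKp, hKm, mul_assoc, add_assoc, ← smul_add, mul_sub,
        mul_sub, smul_sub (qInt _)]
      simp only [mul_smul_comm, smul_mul_assoc, smul_sub, smul_add, smul_smul]
      nth_rewrite 1 [h1]
      rw [h2]
      have e1 : v ^ ((k + 1 : ℕ) : ℤ) = v ^ (k : ℤ) * v := by
        push_cast
        rw [zpow_add_one₀ hv]
      have e2 : v ^ (-((k + 1 : ℕ) : ℤ)) = v ^ (-(k : ℤ)) * v⁻¹ := by
        push_cast
        rw [neg_add, zpow_add₀ hv, zpow_neg_one]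
      have e3 : (v ^ (2 : ℤ)) ^ (k + 1) = v ^ (k : ℤ) * v * (v ^ (k : ℤ) * v) := by
        rw [zpow_natCast, ← pow_succ, ← zpow_natCast, ← zpow_mul, mul_comm, zpow_mul, zpow_natCast,
          zpow_ofNat, pow_two]
      have e4 : (v ^ (-2 : ℤ)) ^ (k + 1) = v ^ (-(k : ℤ)) * v⁻¹ * (v ^ (-(k : ℤ)) * v⁻¹) := by
        rw [zpow_neg, inv_pow, e3, zpow_neg, mul_inv, mul_inv]
      rw [e1, e2, e3, e4, zpow_add_one₀ hv, neg_add, zpow_add₀ hv, zpow_neg_one]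
      generalize (v - v⁻¹)⁻¹ = κ, v ^ (k : ℤ) = p, v ^ (-(k : ℤ)) = q
      congr 1
      rw [sub_add_sub_comm, ← add_smul, ← add_smul]
      congr 2
      · field_simp
      · field_simp
    rw [mul_dp, smul_mul_assoc, mul_smul_comm, smul_comm _ (qInt _), ← smul_add] at key
    exact smul_right_injective _ hq key

/-! ### The action of `U_v(sl₂)` on `Λ_n` -/

theorem hwProj_surjective (n : ℕ) : Function.Surjective (hwProj A1 fun _ => n) :=
  Submodule.mkQ_surjective _

theorem actE_Fη_zero (n : ℕ) : actE n (Fη n 0) = 0 := by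
  rw [Fη, actE_hwProj, dp_zero, vermaE_one, map_zero]

/-- Only the lowering of the index matters: the K-commutation relations and the nilpotency of E do
not depend on the value of c. -/
theorem exists_actE_Fη_succ (n b : ℕ) : ∃ c : K, actE n (Fη n (b + 1)) = c • Fη n b := by
  refine ⟨(qFact (b + 1))⁻¹ * ((∑ j ∈ Finset.range (b + 1), qInt (n - 2 * j)) * qFact b), ?_⟩
  rw [Fη, actE_hwProj, dp, map_smul, vermaE_pow, pow_eq_dp, smul_smul, smul_smul, map_smul, Fη,
    mul_assoc]

theorem L_ext {n : ℕ} {M : Type*} [AddCommMonoid M] [Module K M] {σ : K →+* K}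
    {f g : L n →ₛₗ[σ] M} (h : ∀ a, f (Fη n a) = g (Fη n a)) : f = g :=
  (LBasis n).ext fun a => by rw [LBasis_apply, h]

theorem actK_Fη (n a : ℕ) : actK n (Fη n a) = v ^ ((n : ℤ) - 2 * a) • Fη n a := by
  rw [actK, LinearMap.smul_apply, scaleL_Fη, smul_smul, ← zpow_natCast, ← zpow_mul,
    ← zpow_add₀ v_ne_zero, neg_mul, ← sub_eq_add_neg]

theorem actE_mul_actF (n : ℕ) :
    actE n * actF n = actF n * actE n + (v - v⁻¹)⁻¹ • (actK n - actKinv n) := by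
  refine LinearMap.ext fun x => ?_
  obtain ⟨x, rfl⟩ := hwProj_surjective n x
  simp only [Module.End.mul_apply, LinearMap.add_apply, LinearMap.smul_apply, LinearMap.sub_apply,
    actK, actKinv, actF_hwProj, actE_hwProj, scaleL_hwProj, vermaE_θ_mul, vermaH, map_add, map_sub,
    map_smul, AlgHom.toLinearMap_apply]

theorem actK_mul_actE (n : ℕ) : actK n * actE n = v ^ (2 : ℤ) • (actE n * actK n) := by
  refine L_ext fun a => ?_
  rw [LinearMap.smul_apply, Module.End.mul_apply, Module.End.mul_apply, actK_Fη, map_smul]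
  cases a with
  | zero => simp [actE_Fη_zero]
  | succ b =>
    obtain ⟨c, hc⟩ := exists_actE_Fη_succ n b
    rw [hc, map_smul, actK_Fη, smul_smul, smul_smul, smul_smul, ← zpow_add₀ v_ne_zero, mul_comm c]
    push_cast
    ring_nf

theorem actKinv_mul_actE (n : ℕ) : actKinv n * actE n = v ^ (-2 : ℤ) • (actE n * actKinv n) := by
  refine L_ext fun a => ?_
  rw [LinearMap.smul_apply, Module.End.mul_apply, Module.End.mul_apply, actKinv_Fη, map_smul]
  cases a with
  | zero => simp [actE_Fη_zero]
  | succ b =>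
    obtain ⟨c, hc⟩ := exists_actE_Fη_succ n b
    rw [hc, map_smul, actKinv_Fη, smul_smul, smul_smul, smul_smul, ← zpow_add₀ v_ne_zero, mul_comm c]
    push_cast
    ring_nf

theorem actE_pow_Fη {n b k : ℕ} (h : b < k) : (actE n ^ k) (Fη n b) = 0 := by
  induction b generalizing k with
  | zero =>
    obtain ⟨k, rfl⟩ : ∃ j, k = j + 1 := ⟨k - 1, by omega⟩
    rw [pow_succ, Module.End.mul_apply, actE_Fη_zero, map_zero]
  | succ b ih =>
    obtain ⟨k, rfl⟩ : ∃ j, k = j + 1 := ⟨k - 1, by omega⟩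
    obtain ⟨c, hc⟩ := exists_actE_Fη_succ n b
    rw [pow_succ, Module.End.mul_apply, hc, map_smul, ih (by omega), smul_zero]

theorem dp_actE_Fη {n b k : ℕ} (h : b < k) : dp (actE n) k (Fη n b) = 0 := by
  rw [dp, LinearMap.smul_apply, actE_pow_Fη h, smul_zero]

theorem dp_actE_succ (n : ℕ) : dp (actE n) (n + 1) = 0 := by
  refine (LBasis n).ext fun b => ?_
  rw [LBasis_apply, dp_actE_Fη b.isLt, LinearMap.zero_apply]

/-! ### The quasi-`ℛ`-matrix -/

theorem form_dp_θ₁ (k : ℕ) : form A1 (dp θ₁ k) (dp θ₁ k) = dpNorm k := by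
  induction k with
  | zero => simp [dp_zero, dpNorm_zero, form_one]
  | succ k ih =>
    have hd : leftDer A1 () (dp θ₁ (k + 1)) = v ^ (k : ℤ) • dp θ₁ k := by
      have := map_dp_succ_mul (leftDer A1 ()) (x := θ₁) (z := 1) (c := 1) (fun a => by
        rw [one_smul, θ₁, leftDer_θ_mul, if_pos rfl]
        rfl) (leftDer_one A1 ()) k
      rwa [mul_one, mul_one, one_mul] at this
    have hm : ∀ x y, form A1 (θ₁ * x) y = (1 - v ^ (-2 : ℤ))⁻¹ * form A1 x (leftDer A1 () y) :=
      fun x y => form_θ_mul A1 () x y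
    nth_rewrite 1 [dp_succ]
    rw [map_smul, LinearMap.smul_apply, hm, hd, map_smul, ih, dpNorm_succ,
      smul_eq_mul, smul_eq_mul]
    ring

/-- The coefficients of the quasi-`ℛ`-matrix. -/
def quasiCoeff (k : ℕ) : K := (-v) ^ k * (dpNorm k)⁻¹

theorem quasiR_eq (m n : ℕ) : quasiR m n = ∑ k ∈ Finset.range (n + 1),
    quasiCoeff k • TensorProduct.map (dp (actF m) k) (dp (actE n) k) := by
  simp only [quasiR, form_dp_θ₁, quasiCoeff]

/-- The ratio of consecutive coefficients is what makes the intertwining sum telescope. -/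
theorem quasiCoeff_succ (k : ℕ) : quasiCoeff (k + 1) =
    -(quasiCoeff k * (qInt (k + 1) * ((v - v⁻¹) * v ^ (-(k : ℤ))))) := by
  have hv := v_ne_zero
  have hq : 1 - v ^ (-2 : ℤ) = v⁻¹ * (v - v⁻¹) := by
    rw [zpow_neg, zpow_ofNat]
    field_simp
  rw [quasiCoeff, quasiCoeff, dpNorm_succ, hq, zpow_neg]
  simp only [mul_inv, inv_inv, pow_succ]
  field_simp

/-- The conjugate of the action of `F_i` on `Λ_m ⊗ Λ_n` by the bar involution. -/
def coFBar (m n : ℕ) : Module.End K (L m ⊗[K] L n) :=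
  TensorProduct.map LinearMap.id (actF n) + TensorProduct.map (actF m) (actK n)

/-- Termwise, the difference of the two sides is `G (k + 1) - G k`, where `G k` is the k-th
coefficient times F'^{(k)} ⊗ (E^{(k)}F - FE^{(k)}). The commutator formula and the recursion for the
coefficients match the K-terms with `G (k + 1)`. The sum telescopes to 0, since E^{(0)} = 1 commutes
with F and E^{(n+1)} = 0. -/
theorem quasiR_intertwines {M N : Type*} [AddCommGroup M] [Module K M] [AddCommGroup N] [Module K N]
    {F' : Module.End K M} {E F Kp Km : Module.End K N}
    (hEF : E * F = F * E + (v - v⁻¹)⁻¹ • (Kp - Km)) (hp : Kp * E = v ^ (2 : ℤ) • (E * Kp))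
    (hm : Km * E = v ^ (-2 : ℤ) • (E * Km)) {n : ℕ} (hn : dp E (n + 1) = 0) :
    (TensorProduct.map LinearMap.id F + TensorProduct.map F' Km) *
      ∑ k ∈ Finset.range (n + 1), quasiCoeff k • TensorProduct.map (dp F' k) (dp E k) =
    (∑ k ∈ Finset.range (n + 1), quasiCoeff k • TensorProduct.map (dp F' k) (dp E k)) *
      (TensorProduct.map LinearMap.id F + TensorProduct.map F' Kp) := by
  have hv := v_ne_zero
  let G : ℕ → Module.End K (M ⊗[K] N) := fun k =>
    quasiCoeff k • TensorProduct.map (dp F' k) (dp E k * F - F * dp E k)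
  have hG : ∀ k ∈ Finset.range (n + 1),
      (TensorProduct.map LinearMap.id F + TensorProduct.map F' Km) *
        (quasiCoeff k • TensorProduct.map (dp F' k) (dp E k)) -
      (quasiCoeff k • TensorProduct.map (dp F' k) (dp E k)) *
        (TensorProduct.map LinearMap.id F + TensorProduct.map F' Kp) = G (k + 1) - G k := by
    intro k _
    have h1 : dp E (k + 1) * F - F * dp E (k + 1) =
        (v - v⁻¹)⁻¹ • (dp E k * (v ^ (k : ℤ) • Kp - v ^ (-(k : ℤ)) • Km)) :=
      sub_eq_of_eq_add' (dp_succ_mul_comm hEF hp hm k)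
    have h2 := mul_dp_comm hm k
    have h3 : quasiCoeff (k + 1) * (v - v⁻¹)⁻¹ =
        -(quasiCoeff k * qInt (k + 1) * v ^ (-(k : ℤ))) := by
      rw [quasiCoeff_succ, mul_comm (v - v⁻¹), ← mul_assoc (qInt _), ← mul_assoc, ← neg_mul,
        mul_assoc, mul_inv_cancel₀ v_sub_inv_ne_zero]
      ring
    simp only [G, h1]
    rw [TensorProduct.map_smul_right, smul_smul, h3]
    simp only [mul_smul_comm, smul_mul_assoc, add_mul, mul_add, ← TensorProduct.map_mul]
    rw [← Module.End.one_eq_id, one_mul, mul_one, mul_dp, dp_mul_self, h2]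
    have hs : ∀ f : Module.End K M, ∀ g h : Module.End K N,
        TensorProduct.map f (g - h) = TensorProduct.map f g - TensorProduct.map f h :=
      fun f => map_sub (TensorProduct.mapBilinear (.id K) M N M N f)
    have e : (v ^ (-2 : ℤ)) ^ k = v ^ (-(k : ℤ)) * v ^ (-(k : ℤ)) := by
      rw [← zpow_natCast, ← zpow_mul, ← zpow_add₀ hv]
      ring_nf
    have e' : v ^ (-(k : ℤ)) * v ^ (k : ℤ) = 1 := by rw [← zpow_add₀ hv]; simp
    have hc : v ^ (-(k : ℤ)) * (v ^ (-(k : ℤ)) * qInt (k + 1)) =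
        qInt (k + 1) * (v ^ (-(k : ℤ)) * v ^ (-(k : ℤ))) := by ring
    simp only [mul_sub, hs, mul_smul_comm, TensorProduct.map_smul_left,
      TensorProduct.map_smul_right, smul_sub, smul_add, smul_smul, e, neg_mul, neg_smul, mul_assoc,
      hc, e', mul_one]
    abel
  have := Finset.sum_congr rfl hG
  rw [Finset.sum_range_sub, Finset.sum_sub_distrib, ← Finset.mul_sum, ← Finset.sum_mul] at this
  rw [← sub_eq_zero, this]
  simp [G, dp_zero, hn]

theorem coF_mul_quasiR (m n : ℕ) : coF m n * quasiR m n = quasiR m n * coFBar m n := by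
  rw [quasiR_eq]
  exact quasiR_intertwines (actE_mul_actF n) (actK_mul_actE n) (actKinv_mul_actE n)
    (dp_actE_succ n)

/-! ### The involution `Ψ` -/

theorem barL_comp_actF (n : ℕ) (x : L n) : barL n (actF n x) = actF n (barL n x) := by
  obtain ⟨x, rfl⟩ := hwProj_surjective n x
  rw [actF_hwProj, barL_hwProj, barL_hwProj, actF_hwProj, map_mul, θ₁, bar_θ]

theorem barL_Fη (n a : ℕ) : barL n (Fη n a) = Fη n a := by
  rw [Fη, barL_hwProj, bar_dp, θ₁, bar_θ]

theorem barL_actKinv (n : ℕ) (x : L n) : barL n (actKinv n x) = actK n (barL n x) := by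
  suffices h : (barL n).comp (actKinv n) = (actK n).comp (barL n) from LinearMap.congr_fun h x
  refine L_ext fun a => ?_
  rw [LinearMap.comp_apply, LinearMap.comp_apply, barL_Fη, actKinv_Fη, actK_Fη, map_smulₛₗ,
    barL_Fη, map_zpow₀, barK_v, inv_zpow']
  congr 2
  ring

/-- The involution `Ψ` as a semilinear map. -/
def ΨLin (m n : ℕ) : L m ⊗[K] L n →ₛₗ[barK] L m ⊗[K] L n :=
  (quasiR m n).comp (TensorProduct.map (barL m) (barL n))

theorem ΨLin_apply (m n : ℕ) (z : L m ⊗[K] L n) : ΨLin m n z = Ψ m n z := rfl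

theorem map_bar_coF (m n : ℕ) (z : L m ⊗[K] L n) :
    TensorProduct.map (barL m) (barL n) (coF m n z) =
      coFBar m n (TensorProduct.map (barL m) (barL n) z) := by
  induction z using TensorProduct.induction_on with
  | zero => simp only [map_zero]
  | add x y hx hy => simp only [map_add, hx, hy]
  | tmul x y =>
    rw [coF_tmul, map_add, TensorProduct.map_tmul, TensorProduct.map_tmul, TensorProduct.map_tmul,
      barL_comp_actF, barL_comp_actF, barL_actKinv]
    rfl

theorem Ψ_coF (m n : ℕ) (z : L m ⊗[K] L n) : Ψ m n (coF m n z) = coF m n (Ψ m n z) := by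
  rw [Ψ, Ψ, map_bar_coF, ← Module.End.mul_apply, ← Module.End.mul_apply, coF_mul_quasiR]

/-- E kills the highest weight vector of Λ_n, so only the term k = 0 of the quasi-ℛ-matrix survives.
-/
theorem Ψ_tmul_Fη_zero (m n : ℕ) (x : L m) : Ψ m n (x ⊗ₜ Fη n 0) = barL m x ⊗ₜ Fη n 0 := by
  rw [Ψ, TensorProduct.map_tmul, barL_Fη, quasiR_eq, LinearMap.sum_apply, Finset.sum_range_succ',
    Finset.sum_eq_zero, zero_add]
  · simp [quasiCoeff, dpNorm_zero, dp_zero]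
  · intro k _
    rw [LinearMap.smul_apply, TensorProduct.map_tmul, dp_actE_Fη k.succ_pos, TensorProduct.tmul_zero,
      smul_zero]

theorem bar_incl (x : HalfAlg A1) : bar A2 (incl x) = incl (bar A1 x) := by
  suffices h : (barLin A2).comp incl.toLinearMap = incl.toLinearMap.comp (barLin A1) from
    LinearMap.congr_fun h x
  refine dpBasis.ext fun a => ?_
  rw [dpBasis_apply]
  change bar A2 (incl (dp θ₁ a)) = incl (bar A1 (dp θ₁ a))
  rw [bar_dp, θ₁, bar_θ, ← θ₁, incl_dp, bar_dp_θi]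

theorem bar_θwt (n : ℕ) : bar A2 (θwt n) = θwt n := bar_dp_θi' n

/-- The isomorphism onto `Λ_m ⊗ Λ_n` intertwines the bar involution and `Ψ`. -/
theorem Φ_bar (m n : ℕ) {z : HalfAlg A2} (hz : z ∈ fθf n) : Φ m n (bar A2 z) = Ψ m n (Φ m n z) := by
  -- Both composites are semilinear for the bar involution of ℚ(v), so their coincidence set is a
  -- subspace. It contains all θ_n y, and is stable under left multiplication by θ_i because Ψ
  -- commutes with 1 ⊗ F + F ⊗ K⁻¹.
  let S : Submodule K (HalfAlg A2) :=
    LinearMap.eqLocus ((Φ m n).comp (barLin A2)) ((ΨLin m n).comp (Φ m n))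
  have hS : ∀ x, x ∈ S ↔ Φ m n (bar A2 x) = Ψ m n (Φ m n x) := fun _ => Iff.rfl
  suffices h : fθf n ≤ S from h hz
  rw [fθf, Submodule.span_le]
  rintro _ ⟨x, y, rfl⟩
  have htop := submodule_eq_top A1
    (S.comap ((LinearMap.mulRight K (θwt n * incl y)).comp incl.toLinearMap))
    (by
      change incl 1 * (θwt n * incl y) ∈ S
      rw [hS, map_one, one_mul, map_mul, bar_θwt, bar_incl, Φ_θwt_mul, Φ_θwt_mul, Ψ_tmul_Fη_zero,
        barL_hwProj])
    (by
      intro _ x hx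
      change incl (θ₁ * x) * (θwt n * incl y) ∈ S
      have hx' := (hS (incl x * (θwt n * incl y))).mp hx
      rw [hS, map_mul incl, incl_θ₁, mul_assoc, map_mul (bar A2), θi, bar_θ, ← θi, Φ_θi_mul, hx',
        Φ_θi_mul, Ψ_coF])
  have : x ∈ (⊤ : Submodule K (HalfAlg A1)) := trivial
  rw [← htop] at this
  rw [mul_assoc]
  exact this

theorem Ψ_Φ_swap_can (m : ℕ) {n a b : ℕ} (c : ℕ) (h : a + b = n) :
    Ψ m n (Φ m n (swapAlg (can (a, b, c)))) = Φ m n (swapAlg (can (a, b, c))) := by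
  rw [← Φ_bar m n (swap_can_mem_fθf c h), swapAlg_can, bar_can]

/-! ### The canonical basis of `Λ_m ⊗ Λ_n` -/

theorem Fη_tmul_mem_lattice (m n a b : ℕ) : Fη m a ⊗ₜ[K] Fη n b ∈ lattice m n := by
  by_cases h : a ≤ m ∧ b ≤ n
  · exact Submodule.subset_span ⟨a, b, h.1, h.2, rfl⟩
  · rw [not_and_or, not_le, not_le] at h
    rcases h with h | h <;> simp [Fη_eq_zero h]

theorem smul_mem_lattice {m n : ℕ} {c : K} (hc : c ∈ intVInv) {z : L m ⊗[K] L n}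
    (hz : z ∈ lattice m n) : c • z ∈ lattice m n :=
  (lattice m n).smul_mem ⟨c, hc⟩ hz

theorem repr_mem_intVInv {m n : ℕ} {z : L m ⊗[K] L n} (hz : z ∈ lattice m n)
    (i : Fin (m + 1) × Fin (n + 1)) : (TBasis m n).repr z i ∈ intVInv := by
  induction hz using Submodule.span_induction with
  | mem z hz =>
    obtain ⟨a, b, ha, hb, rfl⟩ := hz
    have := TBasis_apply m n (⟨a, Nat.lt_succ_of_le ha⟩, ⟨b, Nat.lt_succ_of_le hb⟩)
    rw [← this, Module.Basis.repr_self, Finsupp.single_apply]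
    split_ifs
    · exact one_mem _
    · exact zero_mem _
  | zero => rw [map_zero]; exact zero_mem _
  | add x y _ _ hx hy => rw [map_add]; exact add_mem hx hy
  | smul c x _ hx =>
    have : (TBasis m n).repr ((c : K) • x) i = c * (TBasis m n).repr x i := by
      rw [map_smul, Finsupp.smul_apply, smul_eq_mul]
    exact this ▸ mul_mem c.2 hx

/-- The images in `Λ_m ⊗ Λ_n` of the elements of the framed basis. -/
def tensorCan (m n : ℕ) (p : Fin (m + 1) × Fin (n + 1)) : L m ⊗[K] L n :=
  Φ m n (swapAlg (can (n - p.2, p.2, p.1)))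

theorem Ψ_tensorCan {m n : ℕ} (p : Fin (m + 1) × Fin (n + 1)) :
    Ψ m n (tensorCan m n p) = tensorCan m n p :=
  Ψ_Φ_swap_can m _ (Nat.sub_add_cancel (Nat.lt_succ_iff.mp p.2.isLt))

theorem tensorCan_sub {m n : ℕ} (p : Fin (m + 1) × Fin (n + 1)) :
    tensorCan m n p - Fη m p.1 ⊗ₜ[K] Fη n p.2 = ∑ u ∈ Finset.range p.2,
      canCoeff (n - p.2) p.1 (u + 1) • (Fη m (p.1 + (u + 1)) ⊗ₜ[K] Fη n (p.2 - (u + 1))) := by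
  have hp : (p.2 : ℕ) ≤ n := Nat.lt_succ_iff.mp p.2.isLt
  rw [tensorCan, ← Φ_swap_pbw_of_eq m p.1 (Nat.sub_add_cancel hp), ← map_sub, ← map_sub,
    can_sub_pbw, map_sum, map_sum]
  refine Finset.sum_congr rfl fun u hu => ?_
  have := Finset.mem_range.mp hu
  rw [map_smul, map_smul, Φ_swap_pbw_of_eq m _ (by omega)]

/-- The congruence between canonical and PBW basis elements is transported by `Φ`; PBW terms that
leave the range of indices become zero. -/
theorem exists_tensorCan_sub {m n : ℕ} (p : Fin (m + 1) × Fin (n + 1)) :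
    ∃ w ∈ lattice m n, tensorCan m n p - Fη m p.1 ⊗ₜ[K] Fη n p.2 = v⁻¹ • w := by
  choose w hw hc using canCoeff_succ_mem (n - p.2) p.1
  refine ⟨_, Submodule.sum_mem (lattice m n) fun u (_ : u ∈ Finset.range p.2) =>
    smul_mem_lattice (hw u) (Fη_tmul_mem_lattice m n (p.1 + (u + 1)) (p.2 - (u + 1))), ?_⟩
  rw [tensorCan_sub, Finset.smul_sum]
  exact Finset.sum_congr rfl fun u _ => by rw [hc, mul_smul]

theorem isUnitriangular_tensorCan (m n : ℕ) :
    IsUnitriangular (TBasis m n) (fun p => (p.2 : ℕ)) (tensorCan m n) := by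
  intro p
  rw [TBasis_apply, tensorCan_sub]
  refine Submodule.sum_mem _ fun u hu => Submodule.smul_mem _ _ ?_
  have hu' := Finset.mem_range.mp hu
  by_cases h : (p.1 : ℕ) + (u + 1) ≤ m
  · exact Submodule.subset_span ⟨(⟨p.1 + (u + 1), by omega⟩, ⟨p.2 - (u + 1), by omega⟩),
      by change (p.2 : ℕ) - (u + 1) < p.2; omega, TBasis_apply _ _ _⟩
  · rw [Fη_eq_zero (n := m) (by omega), TensorProduct.zero_tmul]
    exact Submodule.zero_mem _

theorem repr_inv_smul_mem {m n : ℕ} {w : L m ⊗[K] L n} (hw : w ∈ lattice m n)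
    (i : Fin (m + 1) × Fin (n + 1)) : (TBasis m n).repr (v⁻¹ • w) i ∈ vInvIdeal :=
  ⟨_, repr_mem_intVInv hw i, by rw [map_smul, Finsupp.smul_apply, smul_eq_mul]⟩

/-- Two Ψ-invariant vectors congruent to the same F^{(a)}η_m ⊗ F^{(b)}η_n differ by a Ψ-invariant
vector in v⁻¹ℒ, which is zero by unitriangularity. -/
theorem tensorCanonicalBasis_eq (m n : ℕ) :
    tensorCanonicalBasis m n = Set.range (tensorCan m n) := by
  ext z
  constructor
  · rintro ⟨_, hz, a, b, ha, hb, w, hw, h⟩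
    let p : Fin (m + 1) × Fin (n + 1) := (⟨a, Nat.lt_succ_of_le ha⟩, ⟨b, Nat.lt_succ_of_le hb⟩)
    obtain ⟨w', hw', h'⟩ := exists_tensorCan_sub p
    refine ⟨p, (sub_eq_zero.mp ?_).symm⟩
    refine (isUnitriangular_tensorCan m n).eq_zero_of_bar_invariant (ΨLin m n) Ψ_tensorCan ?_ ?_
    · rw [map_sub, ΨLin_apply, ΨLin_apply, hz, Ψ_tensorCan]
    · intro i
      have e : z - tensorCan m n p = v⁻¹ • w - v⁻¹ • w' := by rw [← h, ← h']; exact (sub_sub_sub_cancel_right _ _ _).symm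
      rw [e, map_sub]
      exact sub_mem (repr_inv_smul_mem hw i) (repr_inv_smul_mem hw' i)
  · rintro ⟨p, rfl⟩
    obtain ⟨w, hw, h⟩ := exists_tensorCan_sub p
    refine ⟨?_, Ψ_tensorCan p, p.1, p.2, Nat.lt_succ_iff.mp p.1.isLt, Nat.lt_succ_iff.mp p.2.isLt,
      w, hw, h⟩
    rw [sub_eq_iff_eq_add.mp h]
    exact add_mem (smul_mem_lattice v_inv_mem_intVInv hw) (Fη_tmul_mem_lattice m n _ _)

theorem tensorCanonicalBasis_eq_setOf (m n : ℕ) : tensorCanonicalBasis m n =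
    {z | ∃ k l : ℕ, k ≤ m ∧ l ≤ n ∧ z = Φ m n (swapAlg (can (n - l, l, m - k)))} := by
  rw [tensorCanonicalBasis_eq]
  ext z
  constructor
  · rintro ⟨⟨a, b⟩, rfl⟩
    refine ⟨m - a, b, Nat.sub_le _ _, Nat.lt_succ_iff.mp b.isLt, ?_⟩
    rw [Nat.sub_sub_self (Nat.lt_succ_iff.mp a.isLt)]
    rfl
  · rintro ⟨k, l, hk, hl, rfl⟩
    exact ⟨(⟨m - k, by omega⟩, ⟨l, by omega⟩), rfl⟩

end
end FramedTensor

open FramedTensor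
open scoped TensorProduct

/-! ### Assembly of the three parts -/

theorem mainTheorem7 (m n : ℕ) :
    framedBasis m n =
      {b | ∃ k l : ℕ, k ≤ m ∧ l ≤ n ∧ (k : ℤ) - l ≤ (m : ℤ) - n ∧ b = elemA m n k l} ∪
      {b | ∃ k l : ℕ, k ≤ m ∧ l ≤ n ∧ (m : ℤ) - n ≤ (k : ℤ) - l ∧ b = elemB m n k l} ∧
    (∀ k l : ℕ, k ≤ m → l ≤ n → (k : ℤ) - l = (m : ℤ) - n → elemA m n k l = elemB m n k l) ∧
    (∃! φ : subL m n ≃ₗ[K] L m ⊗[K] L n, IsFramedIso m n φ) ∧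
    (∀ φ : subL m n ≃ₗ[K] L m ⊗[K] L n, IsFramedIso m n φ →
      (∀ k l : ℕ, k ≤ m → l ≤ n → (k : ℤ) - l ≤ (m : ℤ) - n →
        ∃ h : elemA m n k l ∈ fθf n, φ (framedProj m n ⟨elemA m n k l, h⟩) = α m n k l) ∧
      (∀ k l : ℕ, k ≤ m → l ≤ n → (m : ℤ) - n ≤ (k : ℤ) - l →
        ∃ h : elemB m n k l ∈ fθf n, φ (framedProj m n ⟨elemB m n k l, h⟩) = β m n k l)) ∧
    tensorCanonicalBasis m n =
      {z | ∃ k l : ℕ, k ≤ m ∧ l ≤ n ∧ (k : ℤ) - l ≤ (m : ℤ) - n ∧ z = α m n k l} ∪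
      {z | ∃ k l : ℕ, k ≤ m ∧ l ≤ n ∧ (m : ℤ) - n ≤ (k : ℤ) - l ∧ z = β m n k l} := by
  -- For k ≤ m and l ≤ n both inequalities say n + k ≤ m + l, so the truncated subtractions in the
  -- indices are harmless. This is the condition a ≤ c for a = n - l, c = m - k.
  have hA : ∀ {k l : ℕ}, k ≤ m → l ≤ n → ((k : ℤ) - l ≤ (m : ℤ) - n ↔ n - l ≤ m - k) := by
    intro k l hk hl
    omega
  have hB : ∀ {k l : ℕ}, k ≤ m → l ≤ n → ((m : ℤ) - n ≤ (k : ℤ) - l ↔ m - k ≤ n - l) := by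
    intro k l hk hl
    omega
  have hα : ∀ {k l : ℕ}, k ≤ m → l ≤ n → n - l ≤ m - k →
      Φ m n (swapAlg (can (n - l, l, m - k))) = α m n k l := fun hk hl h => by
    rw [can_of_ge h, Φ_swap_monoB hk hl]
  have hβ : ∀ {k l : ℕ}, k ≤ m → l ≤ n → m - k ≤ n - l →
      Φ m n (swapAlg (can (n - l, l, m - k))) = β m n k l := fun hk hl h => by
    rw [can_of_le h, Φ_swap_monoA hk hl]
  refine ⟨?_, fun k l hk hl h => ?_, existsUnique_framedIso m n, fun φ hφ =>
    ⟨fun k l hk hl h => ?_, fun k l hk hl h => ?_⟩, ?_⟩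
  · rw [framedBasis_eq]
    ext x
    constructor
    · rintro ⟨k, l, hk, hl, rfl⟩
      rcases le_total (n - l) (m - k) with h | h
      · exact Or.inl ⟨k, l, hk, hl, (hA hk hl).mpr h, (elemA_eq_can h).symm⟩
      · exact Or.inr ⟨k, l, hk, hl, (hB hk hl).mpr h, (elemB_eq_can hl h).symm⟩
    · rintro (⟨k, l, hk, hl, h, rfl⟩ | ⟨k, l, hk, hl, h, rfl⟩)
      · exact ⟨k, l, hk, hl, elemA_eq_can ((hA hk hl).mp h)⟩
      · exact ⟨k, l, hk, hl, elemB_eq_can hl ((hB hk hl).mp h)⟩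
  · rw [elemA_eq_can ((hA hk hl).mp h.le), elemB_eq_can hl ((hB hk hl).mp h.ge)]
  · have h' := (hA hk hl).mp h
    refine ⟨elemA_eq_can h' ▸ swap_can_mem_fθf (m - k) (Nat.sub_add_cancel hl), ?_⟩
    exact (hφ.apply_framedProj _).trans
      ((congrArg (Φ m n) (elemA_eq_can h')).trans (hα hk hl h'))
  · have h' := (hB hk hl).mp h
    refine ⟨elemB_eq_can hl h' ▸ swap_can_mem_fθf (m - k) (Nat.sub_add_cancel hl), ?_⟩
    exact (hφ.apply_framedProj _).trans
      ((congrArg (Φ m n) (elemB_eq_can hl h')).trans (hβ hk hl h'))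
  · rw [tensorCanonicalBasis_eq_setOf]
    ext z
    constructor
    · rintro ⟨k, l, hk, hl, rfl⟩
      rcases le_total (n - l) (m - k) with h | h
      · exact Or.inl ⟨k, l, hk, hl, (hA hk hl).mpr h, hα hk hl h⟩
      · exact Or.inr ⟨k, l, hk, hl, (hB hk hl).mpr h, hβ hk hl h⟩
    · rintro (⟨k, l, hk, hl, h, rfl⟩ | ⟨k, l, hk, hl, h, rfl⟩)
      · exact ⟨k, l, hk, hl, (hα hk hl ((hA hk hl).mp h)).symm⟩
      · exact ⟨k, l, hk, hl, (hβ hk hl ((hB hk hl).mp h)).symm⟩
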